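/- **Setting.** Let $n\ge 2$ and $0\le\sigma\le n-1$ with $n-1-\sigma$ even. Let $B^d$ be the unit ball of $\mathbb R^d$, write $x=(x',x_n)\in\mathbb R^{n-1}\times\mathbb R$, and let $\mathrm I_{n-1,\sigma}$ be the diagonal matrix with $\frac{n-1+\sigma}{2}$ entries $1$ followed by $\frac{n-1-\sigma}{2}$ entries $-1$. For $1\le m\le n$ put $$\mu(n,\sigma,m)=\max\Big\{n-2m+1,\ \frac{n+1+\sigma}{2}-m,\ 0\Big\}.$$ *Operators.* Let $X=X'\times X_n\subset B^{n-1}\times B^1$ and $\Omega\subset B^{n-1}$, where $X',X_n,\Omega$ are balls centred at $0$. Given $c_{\rm ex}>0$ and $N_{\rm ex}\in\mathbb N$, a phase $\phi$ of signature $\sigma$ is *reduced* if on $X\times\Omega$ one has $\phi(x;\omega)=\langle x',\omega\rangle+x_nh(\omega)+\mathcal E(x;\omega)$, where $h,\mathcal E$ are smooth, $h$ and its gradient vanish at $0$, $\partial_\omega^\beta\partial_x^\alpha\mathcal E(x;0)=0$ for $x\in X$, $|\beta|\le1$ and all $\alpha$, and $\partial_\omega^\beta\partial_x^\alpha\mathcal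 E(0;\omega)=0$ for $\omega\in\Omega$, $|\alpha|\le1$ and all $\beta$; and, on $X\times\Omega$, $$\|\partial^2_{\omega x'}\phi-\mathrm I_{n-1}\|_{\rm op}<c_{\rm ex},\quad |\partial_\omega\partial_{x_n}\phi|<c_{\rm ex},\quad \|\partial^2_{\omega\omega}\partial_{x_k}\phi-\delta_{kn}\mathrm I_{n-1,\sigma}\|_{\rm op}<c_{\rm ex}\ (1\le k\le n),$$ and $|\partial_\omega^\beta\partial_x^\alpha\phi|<c_{\rm ex}$ whenever $1\le|\alpha|\le N_{\rm ex}$, $3\le|\beta|\le N_{\rm ex}$, and whenever $2\le|\alpha|\le N_{\rm ex}$, $0\le|\beta|\le N_{\rm ex}$. The amplitude $a$ is smooth, complex-valued, supported in $X\times\Omega$, with $|\partial_\omega^\beta\partial_x^\alpha a|\le A$ for $|\alpha|,|\beta|\le N_{\rm ex}$. For $\lambda\ge1$ let $\phi^\lambda(x;\omega)=\lambda\phi(x/\lambda;\omega)$ and $$T^\lambda f(x)=\int_{B^{n-1}}e^{2\pi i\phi^\lambda(x;\omega)}a(x/\lambda;\omega)f(\omega)\,d\omega .$$ Let $G^\lambda(x;\omega)$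 be the normalisation to unit length of $\bigwedge_{j=1}^{n-1}\partial_{\omega_j}\partial_x\phi(x/\lambda;\omega)\in\mathbb R^n$. *Wave packets.* Let $R\ge1$ and $\delta>0$. Take a finitely-overlapping cover of $B^{n-1}$ by balls $\theta$ of radius $R^{-1/2}$ (caps) with centres $\omega_\theta\in B^{n-1}$; smooth $\psi_\theta\ge0$ supported in $\theta$ with $\sum_\theta\psi_\theta=1$ on $B^{n-1}$ and $\|\nabla^k\psi_\theta\|_\infty\le C_kR^{k/2}$ for all $k$; a fixed smooth real $\tilde\psi$ such that $\tilde\psi_\theta(\omega)=\tilde\psi(R^{1/2}(\omega-\omega_\theta))$ is supported in $\theta$ and equals $1$ on the $cR^{-1/2}$-neighbourhood of $\operatorname{supp}\psi_\theta$ for a fixed $c>0$; and a fixed Schwartz function $\eta_0$ on $\mathbb R^{n-1}$ with $\sum_{k\in\mathbb Z^{n-1}}\eta_0(\cdot-k)=1$. For $v\in R^{(1+\delta)/2}\mathbb Z^{n-1}$ let $\eta_v(z)=\eta_0(R^{-(1+\delta)/2}(z-v))$. For $f$ supported in $B^{n-1}$ put $f_{\theta,v}=\tilde\psi_\theta\cdot(\eta_v(\psi_\theta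 f)\,\check{}\,)\,\hat{}\,$. If $\omega_\theta\in\Omega$, let $T_{\theta,v}$ be the set of $x\in B(0,R)$ for which there is $y\in\lambda X$ with $\partial_\omega\phi^\lambda(y;\omega_\theta)=v$, $y_n=x_n$ and $|x'-y'|\le R^{1/2+\delta}$; if $\omega_\theta\notin\Omega$, let $T_{\theta,v}=\emptyset$. *Concentration.* $e=\mathrm{RapDec}(R)$ with implied constant $K$ means $|e|\le KR^{-N}$ for all $N\le\sqrt{N_{\rm ex}}$. A function $g$ is concentrated on wave packets from a set $\mathbb S$ of pairs $(\theta,v)$, with constant $K$, if $\|g-\sum_{(\theta,v)\in\mathbb S}g_{\theta,v}\|_{L^\infty(B^{n-1})}\le e\,\|g\|_{L^2(B^{n-1})}$ for some $e=\mathrm{RapDec}(R)$ with implied constant $K$. *Tangency.* Let $\delta_m>0$, let $B$ be the ball of radius $R^{1/2+\delta_m}$ with centre $\bar x\in\mathbb R^n$, let $2B$ be its concentric double, let $R^{1/2}<\rho<R$, and let $\tau\subset\mathbb R^{n-1}$ be a ball of radius at most $C_\tau\rho^{-1/2+\delta_m}$ centred at a point of $B^{n-1}$. For a linear subspace $V\subseteq\mathbb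 R^n$ let $\mathbb T_{V,B,\tau}$ be the set of pairs $(\theta,v)$ with $\angle(G^\lambda(\bar x;\omega_\theta),V)\le C_{\rm ang}R^{-1/2+\delta_m}$, $T_{\theta,v}\cap B\ne\emptyset$ and $\theta\cap(\tfrac1{10}\cdot\tau)\ne\emptyset$, where $\tfrac1{10}\cdot\tau$ is concentric to $\tau$ with one tenth of its radius. **Lemma 5.2.** There are constants $K_0\ge1$ and $C_0,c_{\rm trans},c_0>0$ depending only on $n$ and $\sigma$ such that the following holds. Let $\delta>0$, and let $0<c_{\rm ex}\le c_0$ and $N_{\rm ex}\ge N_0$, where $N_0$ depends only on $n,\sigma,\delta$. There are $R_0\ge1$ and, for each $K$, a constant $C_K$, which depend only on $n,\sigma,\delta,c_{\rm ex},N_{\rm ex},A,C_{\rm ang},C_\tau$, the radii of $X',X_n,\Omega$ and the fixed choices in the wave packet decomposition ($\eta_0$, $\tilde\psi$, $c$, the $C_k$ and the overlap constant), such that, whenever $K_0\delta\le\delta_m\le1/K_0$, $R\ge R_0$ and $\lambda\ge R_0R$, for all $\phi$ (reduced, of signature $\sigma$), $a$, caps and $\psi_\theta$, $\rho$, $\bar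 x$, $\tau$ as above and every linear subspace $V\ne\{0\}$ of $\mathbb R^n$ there exists a linear subspace $V'\subseteq\mathbb R^n$ with the following properties. 1. $\mu(n,\sigma,\dim V)\le\dim V'\le n-\dim V$. 2. $\angle(v,v')\ge2c_{\rm trans}$ for all non-zero $v\in V$ and $v'\in V'$. 3. For every $K$ and every $g\in L^2(B^{n-1})$ that is concentrated on wave packets from $\mathbb T_{V,B,\tau}$ with constant $K$, every plane $\Pi$ parallel to $V'$ and every $x_0\in\Pi\cap B$, $$\int_{\Pi\cap B(x_0,\rho^{1/2+\delta_m})}|T^\lambda g|^2\le C_KR^{C_0\delta_m}\Big(\frac{\rho}{R}\Big)^{\dim V'/2}\|g\|_{L^2(B^{n-1})}^{2\delta/(1+\delta)}\Big(\int_{\Pi\cap2B}|T^\lambda g|^2\Big)^{1/(1+\delta)}+e\,\|g\|_{L^2(B^{n-1})}^2$$ for some $e=\mathrm{RapDec}(R)$ with implied constant $C_K$, where the integrals are with respect to $(\dim V')$-dimensional Lebesgue measure on $\Pi$. -/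

import Mathlib

open MeasureTheory Set Metric
open scoped FourierTransform SchwartzMap

noncomputable section

/-- Euclidean space. Throughout, `d = n - 1`: spatial points `x = (x', x_n)` live in `Euc (d + 1)`
with `x_n = x (Fin.last d)`, frequencies `ω` live in `Euc d`. -/
abbrev Euc (d : ℕ) : Type := EuclideanSpace ℝ (Fin d)

/-- The first `d` coordinates `x'` of `x = (x', x_n)`. -/
def horiz {d : ℕ} (x : Euc (d + 1)) : Euc d := WithLp.toLp 2 fun j => x j.castSucc

/-- The unit ball `B^d`. -/
def unitBall (d : ℕ) : Set (Euc d) := ball 0 1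

/-! ### Partial derivatives of functions of `(x ; ω)` -/

section Partials

variable {m d : ℕ} {F : Type*} [NormedAddCommGroup F] [NormedSpace ℝ F]

/-- `∂_{x_i} f`. -/
def dX (i : Fin m) (f : Euc m → Euc d → F) : Euc m → Euc d → F :=
  fun x ω => lineDeriv ℝ (fun y => f y ω) x (EuclideanSpace.single i 1)

/-- `∂_{ω_j} f`. -/
def dW (j : Fin d) (f : Euc m → Euc d → F) : Euc m → Euc d → F :=
  fun x ω => lineDeriv ℝ (f x) ω (EuclideanSpace.single j 1)

/-- `∂_ω^β ∂_x^α f`; a multi-index is written as the list of the variables of differentiation,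
so that its order `|α|` is the length of the list. -/
def dMix (α : List (Fin m)) (β : List (Fin d)) (f : Euc m → Euc d → F) : Euc m → Euc d → F :=
  β.foldr dW (α.foldr dX f)

end Partials

/-- The operator norm of a real matrix with respect to Euclidean norms. -/
def opNorm {d : ℕ} (M : Matrix (Fin d) (Fin d) ℝ) : ℝ := ‖Matrix.toEuclideanCLM (𝕜 := ℝ) M‖

/-- The matrix `I_{d,σ}`: diagonal, with `(d + σ)/2` entries `1` followed by `(d - σ)/2`
entries `-1`. -/
def signMatrix (d σ : ℕ) : Matrix (Fin d) (Fin d) ℝ :=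
  Matrix.diagonal fun j => if (j : ℕ) < (d + σ) / 2 then 1 else -1

/-- `X = X' × X_n`, where `X'` and `X_n` are the balls centred at `0` of radii `r'` and `r_n`. -/
def spaceBox (d : ℕ) (rX rN : ℝ) : Set (Euc (d + 1)) :=
  {x | ‖horiz x‖ < rX ∧ |x (Fin.last d)| < rN}

/-- `Ω`, the ball of radius `rW` centred at `0`. -/
def freqBall (d : ℕ) (rW : ℝ) : Set (Euc d) := ball 0 rW

/-- Reduced phases of signature `σ` on `X × Ω`, with parameters `c_ex` and `N_ex`.
(If `c_ex` is small, the rank and curvature conditions of a Hörmander-type phase, and the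
value `σ` of its signature, follow from these conditions on `X × Ω`.) -/
structure IsReducedPhase (d σ : ℕ) (cex : ℝ) (Nex : ℕ) (rX rN rW : ℝ)
    (φ : Euc (d + 1) → Euc d → ℝ) : Prop where
  /-- `φ(x;ω) = ⟨x',ω⟩ + x_n h(ω) + E(x;ω)` with `h` quadratic in `ω` and `E` quadratic in
  `x` and in `ω`. -/
  form : ∃ (h : Euc d → ℝ) (E : Euc (d + 1) → Euc d → ℝ),
    ContDiffOn ℝ ((⊤ : ℕ∞) : WithTop ℕ∞) h (freqBall d rW) ∧
    ContDiffOn ℝ ((⊤ : ℕ∞) : WithTop ℕ∞) (fun p : Euc (d + 1) × Euc d => E p.1 p.2)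
      (spaceBox d rX rN ×ˢ freqBall d rW) ∧
    (h 0 = 0 ∧ fderiv ℝ h 0 = 0) ∧
    (∀ α β, β.length ≤ 1 → ∀ x ∈ spaceBox d rX rN, dMix α β E x 0 = 0) ∧
    (∀ α β, α.length ≤ 1 → ∀ ω ∈ freqBall d rW, dMix α β E 0 ω = 0) ∧
    ∀ x ∈ spaceBox d rX rN, ∀ ω ∈ freqBall d rW,
      φ x ω = inner ℝ (horiz x) ω + x (Fin.last d) * h ω + E x ω
  /-- `‖∂²_{ωx'} φ - I‖ < c_ex` -/
  mixed_hessian : ∀ x ∈ spaceBox d rX rN, ∀ ω ∈ freqBall d rW,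
    opNorm (Matrix.of (fun i j : Fin d => dW i (dX j.castSucc φ) x ω) - 1) < cex
  /-- `|∂_ω ∂_{x_n} φ| < c_ex` -/
  vertical : ∀ x ∈ spaceBox d rX rN, ∀ ω ∈ freqBall d rW,
    ‖(WithLp.toLp 2 fun j : Fin d => dW j (dX (Fin.last d) φ) x ω : Euc d)‖ < cex
  /-- `‖∂²_{ωω} ∂_{x_k} φ - δ_{kn} I_{n-1,σ}‖ < c_ex` -/
  curvature : ∀ x ∈ spaceBox d rX rN, ∀ ω ∈ freqBall d rW, ∀ k : Fin (d + 1),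
    opNorm (Matrix.of (fun i j : Fin d => dW i (dW j (dX k φ)) x ω)
      - (if k = Fin.last d then signMatrix d σ else 0)) < cex
  /-- `|∂_ω^β ∂_x^α φ| < c_ex` for `1 ≤ |α| ≤ N_ex`, `3 ≤ |β| ≤ N_ex`, and for
  `2 ≤ |α| ≤ N_ex`, `0 ≤ |β| ≤ N_ex` -/
  higher : ∀ (α : List (Fin (d + 1))) (β : List (Fin d)),
    α.length ≤ Nex → β.length ≤ Nex →
    ((1 ≤ α.length ∧ 3 ≤ β.length) ∨ 2 ≤ α.length) →
    ∀ x ∈ spaceBox d rX rN, ∀ ω ∈ freqBall d rW, |dMix α β φ x ω| < cex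

/-- Smooth amplitudes supported in `X × Ω` whose derivatives `∂_ω^β ∂_x^α a`,
`0 ≤ |α|, |β| ≤ N_ex`, are bounded by `A`. -/
structure IsReducedAmplitude (d : ℕ) (Nex : ℕ) (A : ℝ) (rX rN rW : ℝ)
    (a : Euc (d + 1) → Euc d → ℂ) : Prop where
  smooth : ContDiff ℝ ((⊤ : ℕ∞) : WithTop ℕ∞) (fun p : Euc (d + 1) × Euc d => a p.1 p.2)
  support : ∀ x ω, a x ω ≠ 0 → x ∈ spaceBox d rX rN ∧ ω ∈ freqBall d rW
  bound : ∀ (α : List (Fin (d + 1))) (β : List (Fin d)),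
    α.length ≤ Nex → β.length ≤ Nex → ∀ x ω, ‖dMix α β a x ω‖ ≤ A

/-! ### The operator and its Gauss map -/

/-- `φ^λ(x;ω) = λ φ(x/λ;ω)`. -/
def phaseL {d : ℕ} (φ : Euc (d + 1) → Euc d → ℝ) (lam : ℝ) : Euc (d + 1) → Euc d → ℝ :=
  fun x ω => lam * φ (lam⁻¹ • x) ω

/-- `T^λ f(x) = ∫_{B^{n-1}} e^{2πi φ^λ(x;ω)} a^λ(x;ω) f(ω) dω`, where `a^λ(x;ω) = a(x/λ;ω)`. -/
def opT {d : ℕ} (φ : Euc (d + 1) → Euc d → ℝ) (a : Euc (d + 1) → Euc d → ℂ) (lam : ℝ)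
    (f : Euc d → ℂ) (x : Euc (d + 1)) : ℂ :=
  ∫ ω in unitBall d,
    Complex.exp (2 * Real.pi * Complex.I * (phaseL φ lam x ω : ℂ)) * a (lam⁻¹ • x) ω * f ω

/-- `G_0(x;ω) = ⋀_j ∂_{ω_j} ∂_x φ(x;ω)`, identified with the vector such that
`⟨G_0, w⟩ = det(∂_{ω_1} ∂_x φ, …, ∂_{ω_{n-1}} ∂_x φ, w)`. -/
def gaussZero {d : ℕ} (φ : Euc (d + 1) → Euc d → ℝ) (x : Euc (d + 1)) (ω : Euc d) :
    Euc (d + 1) :=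
  WithLp.toLp 2 fun i =>
    Matrix.det (Matrix.of
      (Fin.snoc (α := fun _ => Fin (d + 1) → ℝ) (fun j k => dW j (dX k φ) x ω) (Pi.single i 1)))

/-- The rescaled generalised Gauss map `G^λ(x;ω) = G(x/λ;ω)`, `G = G_0 / |G_0|`. -/
def gaussL {d : ℕ} (φ : Euc (d + 1) → Euc d → ℝ) (lam : ℝ) (x : Euc (d + 1)) (ω : Euc d) :
    Euc (d + 1) :=
  ‖gaussZero φ (lam⁻¹ • x) ω‖⁻¹ • gaussZero φ (lam⁻¹ • x) ω

/-- `∠(u, V) ≤ t` for a non-zero vector `u` and a linear subspace `V`: the least angle between `u`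
and a non-zero element of `V` is at most `t`. -/
def AngleToLE {n : ℕ} (u : Euc n) (V : Submodule ℝ (Euc n)) (t : ℝ) : Prop :=
  ∃ v ∈ V, v ≠ 0 ∧ InnerProductGeometry.angle u v ≤ t

/-! ### Wave packets -/

/-- The choices in the wave packet decomposition that do not depend on the scale `R`. -/
structure WavePacketProfile (d : ℕ) where
  /-- The profile `η₀` of the spatial partition of unity. -/
  eta : 𝓢(Euc d, ℂ)
  /-- `∑_{k ∈ ℤ^d} η₀(z - k) = 1` -/
  eta_sum : ∀ z : Euc d,
    HasSum (fun k : Fin d → ℤ => eta (z - WithLp.toLp 2 fun i => (k i : ℝ))) 1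
  /-- The profile `ψ̃` of the frequency cutoffs `ψ̃_θ`. -/
  bump : Euc d → ℝ
  bump_smooth : ContDiff ℝ ((⊤ : ℕ∞) : WithTop ℕ∞) bump
  bump_support : Function.support bump ⊆ ball 0 1
  /-- `ψ̃_θ = 1` on the `gap · R^{-1/2}`-neighbourhood of the support of `ψ_θ`. -/
  gap : ℝ
  gap_pos : 0 < gap
  /-- Bound for the overlap of the caps. -/
  overlap : ℕ
  /-- Bounds for the derivatives of the rescaled functions `ψ_θ`. -/
  psiBound : ℕ → ℝ

/-- A finitely-overlapping cover of `B^{n-1}` by `R^{-1/2}`-caps `θ` (each given by its centre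
`ω_θ`) and a smooth partition of unity `ψ_θ` adapted to it. -/
structure CapSystem {d : ℕ} (P : WavePacketProfile d) (R : ℝ) where
  centres : Finset (Euc d)
  centres_mem : ∀ c ∈ centres, c ∈ unitBall d
  cover : unitBall d ⊆ ⋃ c ∈ centres, ball c (R ^ (-(1 / 2) : ℝ))
  finite_overlap : ∀ ω : Euc d,
    {c | c ∈ centres ∧ ω ∈ ball c (R ^ (-(1 / 2) : ℝ))}.ncard ≤ P.overlap
  psi : Euc d → Euc d → ℝ
  psi_smooth : ∀ c ∈ centres, ContDiff ℝ ((⊤ : ℕ∞) : WithTop ℕ∞) (psi c)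
  psi_nonneg : ∀ c ∈ centres, ∀ ω, 0 ≤ psi c ω
  psi_support : ∀ c ∈ centres, tsupport (psi c) ⊆ ball c (R ^ (-(1 / 2) : ℝ))
  psi_sum : ∀ ω ∈ unitBall d, ∑ c ∈ centres, psi c ω = 1
  psi_bound : ∀ c ∈ centres, ∀ (k : ℕ) (ω : Euc d),
    ‖iteratedFDeriv ℝ k (psi c) ω‖ ≤ P.psiBound k * R ^ ((k : ℝ) / 2)
  bump_eq_one : ∀ c ∈ centres, ∀ ω' ∈ tsupport (psi c), ∀ ω : Euc d,
    dist ω ω' ≤ P.gap * R ^ (-(1 / 2) : ℝ) → P.bump (R ^ (1 / 2 : ℝ) • (ω - c)) = 1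

/-- The lattice point `v = R^{(1+δ)/2} k`. -/
def latticePt {d : ℕ} (R δ : ℝ) (k : Fin d → ℤ) : Euc d :=
  R ^ ((1 + δ) / 2) • (WithLp.toLp 2 fun i => (k i : ℝ) : Euc d)

/-- `f_{θ,v} = ψ̃_θ · (η_v (ψ_θ f)ˇ)^`, where `η_v(z) = η₀(R^{-(1+δ)/2} (z - v))`,
`θ` has centre `c` and `v = R^{(1+δ)/2} k`. -/
def wavePacket {d : ℕ} {P : WavePacketProfile d} {R : ℝ} (Θ : CapSystem P R) (δ : ℝ)
    (f : Euc d → ℂ) (c : Euc d) (k : Fin d → ℤ) (ω : Euc d) : ℂ :=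
  (P.bump (R ^ (1 / 2 : ℝ) • (ω - c)) : ℂ) *
    𝓕 (fun z : Euc d => P.eta (R ^ (-((1 + δ) / 2)) • (z - latticePt R δ k)) *
      𝓕⁻ (fun ξ : Euc d => (Θ.psi c ξ : ℂ) * f ξ) z) ω

/-- The curved tube `T_{θ,v}`, where `θ` has centre `c`: the points `x` of `B(0,R)` such that the
core curve `{y ∈ λX : ∂_ω φ^λ(y;ω_θ) = v}` has a point `y` at the height `y_n = x_n` with
`|x' - y'| ≤ R^{1/2+δ}`. It is empty if the phase is not defined at `ω_θ`. -/
def tube {d : ℕ} (rX rN rW : ℝ) (φ : Euc (d + 1) → Euc d → ℝ) (lam R δ : ℝ)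
    (c v : Euc d) : Set (Euc (d + 1)) :=
  {x | x ∈ ball (0 : Euc (d + 1)) R ∧ c ∈ freqBall d rW ∧
    ∃ y : Euc (d + 1), lam⁻¹ • y ∈ spaceBox d rX rN ∧ (∀ j, dW j (phaseL φ lam) y c = v j) ∧
      y (Fin.last d) = x (Fin.last d) ∧ ‖horiz x - horiz y‖ ≤ R ^ (1 / 2 + δ)}

/-- `𝕋_{V,B,τ}`, a set of pairs `(ω_θ, k)` with `v = R^{(1+δ)/2} k`. Here `B` is the ball of radius
`R^{1/2+δ_m}` about `xbar`, `τ` is the ball of radius `rτ` about `τ₀`, and `Cang` is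
the implied constant in `∠(G^λ(xbar;ω_θ), V) ≲ R^{-1/2+δ_m}`. -/
def tangentPackets {d : ℕ} {P : WavePacketProfile d} {R : ℝ} (Θ : CapSystem P R)
    (rX rN rW : ℝ) (φ : Euc (d + 1) → Euc d → ℝ) (lam δ δm Cang : ℝ)
    (V : Submodule ℝ (Euc (d + 1))) (xbar : Euc (d + 1)) (τ₀ : Euc d) (rτ : ℝ) :
    Set (Euc d × (Fin d → ℤ)) :=
  {p | p.1 ∈ Θ.centres ∧
    AngleToLE (gaussL φ lam xbar p.1) V (Cang * R ^ (-(1 / 2) + δm)) ∧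
    (tube rX rN rW φ lam R δ p.1 (latticePt R δ p.2) ∩ ball xbar (R ^ (1 / 2 + δm))).Nonempty ∧
    (ball p.1 (R ^ (-(1 / 2) : ℝ)) ∩ ball τ₀ (rτ / 10)).Nonempty}

/-- `e = RapDec(R)`, with implied constant `K`. -/
def RapDec (Nex : ℕ) (K R e : ℝ) : Prop :=
  ∀ N : ℝ, N ≤ Real.sqrt Nex → |e| ≤ K * R ^ (-N)

/-- The norm of `L²(B^{n-1})`. -/
def l2norm {d : ℕ} (f : Euc d → ℂ) : ℝ := (eLpNorm f 2 (volume.restrict (unitBall d))).toReal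

/-- `f` is concentrated on wave packets from `S`:
`f = ∑_{(θ,v) ∈ S} f_{θ,v} + RapDec(R) ‖f‖_{L²(B^{n-1})}` almost everywhere on `B^{n-1}`. -/
def ConcentratedOn {d : ℕ} {P : WavePacketProfile d} {R : ℝ} (Θ : CapSystem P R) (δ : ℝ)
    (Nex : ℕ) (K : ℝ) (S : Set (Euc d × (Fin d → ℤ))) (f : Euc d → ℂ) : Prop :=
  ∃ e : ℝ, RapDec Nex K R e ∧
    ∀ᵐ ω ∂(volume.restrict (unitBall d)),
      ‖f ω - ∑' p : S, wavePacket Θ δ f p.1.1 p.1.2 ω‖ ≤ e * l2norm f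

/-- Lebesgue measure (of dimension `dim W`) on the plane `p + W`, as a measure on `ℝ^n`. -/
def planeMeasure {n : ℕ} (W : Submodule ℝ (Euc n)) (p : Euc n) : Measure (Euc n) :=
  Measure.map
    (fun y : Euc (Module.finrank ℝ W) => p + ((stdOrthonormalBasis ℝ W).repr.symm y : Euc n))
    volume

/-- `μ(n,σ,m) = max {n - 2m + 1, (n + 1 + σ)/2 - m, 0}`; used when `n - 1 - σ` is even, so that
the division is exact. -/
def muDim (n σ m : ℕ) : ℤ :=
  max ((n : ℤ) - 2 * m + 1) (max (((n : ℤ) + 1 + σ) / 2 - m) 0)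

end

noncomputable section

/-! The mechanism is an uncertainty principle along `V'`. At a point `x`, the packet with frequency
`ω` oscillates in a direction `u` with frequency `u · ∂_x φ(x/λ; ω)`. If these numbers, over all
frequencies tangent to `V`, agree up to `R^{-1/2+δ_m}` for unit `u ∈ V'`, then `|T^λ g|` is
essentially constant along `V'` at scale about `R^{1/2}`. A ball of radius `ρ^{1/2+δ_m}` in a
translate of `V'` then carries only its proportional share `(ρ/R)^{dim V'/2}` of the mass, up to
`R^{O(δ_m)}`.

Choice of `V'`. The normal to `ω ↦ ∂_x φ(x; ω)` can be scaled to `(γ(ω), 1)`. Differentiating the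
normal equations gives `N dγ + S dω = 0` to first order, with `N = ∂²_{ωx'} φ` near the identity and
`S` the second fundamental form, near `I_{n-1,σ}` (`IsReducedPhase.norm_normal_variation_le`). If
the normals stay near `V`, then `dγ` is near `V₀`, the horizontal part of `V`, so `dω` is near `-S⁻¹
N V₀`. The gradient changes by `⟨N y, dω⟩` in a horizontal direction `y`, hence hardly at all if `y`
is orthogonal to `Q V₀`, where `Q = N* S⁻¹ N` is a perturbation of `I_{n-1,σ}`. The complement of `Q
V₀` may meet `V₀`, but its part close to `V₀` is almost isotropic for `Q`, so its dimension is at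
most the number of negative directions, and also at most `dim V₀`. Discarding that part leaves `V'`,
and the two bounds give the two nontrivial entries of `μ` (`exists_transverse_subspace`,
`exists_transverse_of_normal_near`, `IsReducedPhase.exists_transverse`). The quadratic errors are
harmless because `τ` has radius `O(ρ^{-1/2+δ_m})` and `ρ > R^{1/2}`.

Local constancy is proved by finite differences rather than by a Fourier cutoff. After demodulation
by a common frequency, each derivative of the kernel along `u ∈ V'`, `|u| ≤ R^{1/2-3δ_m}`, gains
`R^{-δ_m}`, so its difference of order `N_ex` is rapidly decreasing (`norm_fwdDiff_kernelLine_le`).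
Expanding the difference bounds `|T^λ g(x)|` by the values at `x + j u`, `1 ≤ j ≤ N_ex`
(`norm_opT_le_sum`); averaging over `u` gives the mass estimate
(`setIntegral_planeMeasure_le_of_le_sum`, `setIntegral_opT_le`). This is stronger than required: the
power of `‖g‖₂` in the conclusion comes from the trivial bound on the remaining integral
(`le_rpow_mul_rpow_of_le`). -/

/-! ### Finite differences -/

/-- The `N`-th forward difference with unit step is bounded by the `N`-th derivative. -/
theorem norm_fwdDiff_iter_le_of_hasDerivAt (N : ℕ) :
    ∀ (B : ℕ → ℝ → ℂ) (a M : ℝ),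
      (∀ i < N, ∀ t ∈ Icc a (a + N), HasDerivAt (B i) (B (i + 1) t) t) →
      (∀ t ∈ Icc a (a + N), ‖B N t‖ ≤ M) → ‖(fwdDiff 1)^[N] (B 0) a‖ ≤ M := by
  induction N with
  | zero =>
    intro B a M _ h
    simpa using h a (by simp)
  | succ N ih =>
    intro B a M hB hM
    rw [Function.iterate_succ_apply]
    -- The differences `fwdDiff 1 (B i)` again form a chain of derivatives, on an interval shorter
    -- by one, and the mean value inequality bounds the last of them.
    refine ih (fun i => fwdDiff 1 (B i)) a M ?_ ?_
    · intro i hi t ht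
      have h1 : t ∈ Icc a (a + (N + 1 : ℕ)) := by
        push_cast; exact ⟨ht.1, by linarith [ht.2]⟩
      have h2 : t + 1 ∈ Icc a (a + (N + 1 : ℕ)) := by
        push_cast; exact ⟨by linarith [ht.1], by linarith [ht.2]⟩
      exact ((hB i (by omega) _ h2).comp_add_const t 1).sub (hB i (by omega) _ h1)
    · intro t ht
      have hsub : Icc t (t + 1) ⊆ Icc a (a + (N + 1 : ℕ)) := by
        push_cast
        exact fun s hs => ⟨by linarith [ht.1, hs.1], by linarith [ht.2, hs.2]⟩
      have := (convex_Icc t (t + 1)).norm_image_sub_le_of_norm_hasDerivWithin_le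
        (fun s hs => (hB N (by omega) s (hsub hs)).hasDerivWithinAt)
        (fun s hs => hM s (hsub hs)) (left_mem_Icc.2 (by linarith))
        (right_mem_Icc.2 (by linarith))
      simpa [fwdDiff] using this

/-- Derivatives are taken within an open set because the phase is controlled only on `X × Ω`, so its
restriction to a line is smooth only for parameters that keep the line inside. -/
theorem norm_fwdDiff_iter_le_of_contDiffOn {β : ℝ → ℂ} {O : Set ℝ} (hO : IsOpen O)
    (hβ : ContDiffOn ℝ ((⊤ : ℕ∞) : WithTop ℕ∞) β O) {N : ℕ} {M : ℝ} (hsub : Icc 0 (N : ℝ) ⊆ O)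
    (hM : ∀ t ∈ Icc 0 (N : ℝ), ‖iteratedDerivWithin N β O t‖ ≤ M) :
    ‖(fwdDiff 1)^[N] β 0‖ ≤ M := by
  have h := norm_fwdDiff_iter_le_of_hasDerivAt N (fun i => iteratedDerivWithin i β O) 0 M ?_ ?_
  · simpa using h
  · intro i _ t ht
    rw [zero_add] at ht
    have hd := (hβ.differentiableOn_iteratedDerivWithin (m := i)
      (by exact_mod_cast ENat.natCast_lt_top i) hO.uniqueDiffOn) t (hsub ht)
    have hd' := hd.hasDerivWithinAt.hasDerivAt (hO.mem_nhds (hsub ht))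
    rwa [← iteratedDerivWithin_succ] at hd'
  · intro t ht
    exact hM t (by simpa using ht)

/-! ### Averaging over dilates -/

/-- Integrate the hypothesis over the ball of `u`. For fixed `j ≥ 1` the substitution `x = y + j u`
has Jacobian `j^{-k} ≤ 1` and lands in `S`, so each of the `N` terms contributes at most the
integral over `S`. -/
theorem le_average_of_forall_le_sum {k : ℕ} {f : Euc k → ℝ} (hf : Continuous f)
    (hf0 : ∀ y, 0 ≤ f y) {S : Set (Euc k)} (hS : MeasurableSet S) (hSb : Bornology.IsBounded S)
    {N : ℕ} {r C E : ℝ} (hr : 0 < r) (hC : 0 ≤ C) {y : Euc k}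
    (hmem : ∀ u ∈ ball (0 : Euc k) r, ∀ j ∈ Finset.Icc 1 N, y + (j : ℝ) • u ∈ S)
    (hle : ∀ u ∈ ball (0 : Euc k) r, f y ≤ C * ∑ j ∈ Finset.Icc 1 N, f (y + (j : ℝ) • u) + E) :
    f y ≤ C * N * (∫ x in S, f x) / volume.real (ball (0 : Euc k) r) + E := by
  have hvpos : 0 < volume.real (ball (0 : Euc k) r) :=
    ENNReal.toReal_pos (measure_ball_pos _ _ hr).ne' measure_ball_lt_top.ne
  set J := ∫ x in S, f x with hJ
  have hJ0 : 0 ≤ J := integral_nonneg hf0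
  have hSint : IntegrableOn f S :=
    (hf.continuousOn.integrableOn_compact hSb.isCompact_closure).mono_set subset_closure
  have hfint : ∀ j : ℕ, IntegrableOn (fun u : Euc k => f (y + (j : ℝ) • u)) (ball 0 r) := by
    intro j
    exact ((by fun_prop : Continuous fun u : Euc k => f (y + (j : ℝ) • u)).continuousOn.integrableOn_compact
      (isCompact_closedBall 0 r)).mono_set ball_subset_closedBall
  have hterm : ∀ j ∈ Finset.Icc 1 N, ∫ u in ball (0 : Euc k) r, f (y + (j : ℝ) • u) ≤ J := by
    intro j hj
    have hj1 : (1 : ℝ) ≤ j := by exact_mod_cast (Finset.mem_Icc.1 hj).1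
    -- Cutting `f` off to `S` allows translation and dilation to be carried out over the whole
    -- space.
    have hind : Integrable (fun x : Euc k => S.indicator f x) := hSint.integrable_indicator hS
    have hind2 : Integrable (fun u : Euc k => S.indicator f (y + (j : ℝ) • u)) := by
      have := (hind.comp_add_left y)
      exact this.comp_smul (by positivity)
    calc ∫ u in ball (0 : Euc k) r, f (y + (j : ℝ) • u)
        = ∫ u in ball (0 : Euc k) r, S.indicator f (y + (j : ℝ) • u) := by
          refine setIntegral_congr_fun measurableSet_ball fun u hu => ?_
          exact (indicator_of_mem (hmem u hu j hj) f).symm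
      _ ≤ ∫ u, S.indicator f (y + (j : ℝ) • u) :=
          setIntegral_le_integral hind2
            (Filter.Eventually.of_forall fun u => indicator_nonneg (fun x _ => hf0 x) _)
      _ = |((j : ℝ) ^ Module.finrank ℝ (Euc k))⁻¹| • ∫ u, S.indicator f (y + u) :=
          Measure.integral_comp_smul volume (fun u => S.indicator f (y + u)) (j : ℝ)
      _ = |((j : ℝ) ^ Module.finrank ℝ (Euc k))⁻¹| * J := by
          rw [integral_add_left_eq_self (fun u => S.indicator f u) y, integral_indicator hS,
            smul_eq_mul]
      _ ≤ 1 * J := by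
          refine mul_le_mul_of_nonneg_right ?_ hJ0
          rw [abs_of_nonneg (by positivity)]
          exact inv_le_one_of_one_le₀ (one_le_pow₀ hj1)
      _ = J := one_mul J
  have hmain : f y * volume.real (ball (0 : Euc k) r) ≤
      C * N * J + E * volume.real (ball (0 : Euc k) r) := by
    have hfin : volume (ball (0 : Euc k) r) ≠ ⊤ := measure_ball_lt_top.ne
    have hconst : ∀ c : ℝ, IntegrableOn (fun _ : Euc k => c) (ball 0 r) := fun c =>
      integrableOn_const hfin
    have hsumint : IntegrableOn
        (fun u : Euc k => C * ∑ j ∈ Finset.Icc 1 N, f (y + (j : ℝ) • u)) (ball 0 r) :=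
      (integrable_finsetSum _ fun j _ => hfint j).const_mul C
    have h1 : ∫ _ in ball (0 : Euc k) r, f y ≤
        ∫ u in ball (0 : Euc k) r, (C * ∑ j ∈ Finset.Icc 1 N, f (y + (j : ℝ) • u) + E) :=
      setIntegral_mono_on (hconst _) (hsumint.add (hconst E)) measurableSet_ball hle
    rw [integral_add hsumint (hconst E), integral_const_mul,
      integral_finsetSum _ (fun j _ => hfint j), setIntegral_const, setIntegral_const] at h1
    have h2 : ∑ j ∈ Finset.Icc 1 N, ∫ u in ball (0 : Euc k) r, f (y + (j : ℝ) • u) ≤ N * J := by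
      refine (Finset.sum_le_card_nsmul _ _ J hterm).trans ?_
      simp
    simp only [smul_eq_mul] at h1
    nlinarith [mul_le_mul_of_nonneg_left h2 hC]
  rw [← sub_le_iff_le_add, le_div_iff₀ hvpos]
  linarith

/-! ### Partial derivatives of smooth functions of `(x ; ω)` -/

theorem Euc.sum_smul_single {m : ℕ} (y : Euc m) :
    ∑ i, y i • (EuclideanSpace.single i (1 : ℝ) : Euc m) = y := by
  simpa using (EuclideanSpace.basisFun (Fin m) ℝ).sum_repr y

theorem Euc.sum_abs_le {m : ℕ} (y : Euc m) : ∑ i, |y i| ≤ m * ‖y‖ := by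
  calc ∑ i, |y i| ≤ ∑ _i : Fin m, ‖y‖ :=
        Finset.sum_le_sum fun i _ => by simpa using PiLp.norm_apply_le y i
    _ = m * ‖y‖ := by simp

section Partials

variable {m d : ℕ} {F : Type*} [NormedAddCommGroup F] [NormedSpace ℝ F]
  {f : Euc m → Euc d → F} {U : Set (Euc m)} {W : Set (Euc d)}

/-- `f(x;ω)` is smooth on `U × W`. -/
def SmoothOn (f : Euc m → Euc d → F) (U : Set (Euc m)) (W : Set (Euc d)) : Prop :=
  ContDiffOn ℝ ((⊤ : ℕ∞) : WithTop ℕ∞) (fun p : Euc m × Euc d => f p.1 p.2) (U ×ˢ W)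

theorem SmoothOn.differentiableAt (hf : SmoothOn f U W) (hU : IsOpen U) (hW : IsOpen W)
    {x : Euc m} {ω : Euc d} (hx : x ∈ U) (hω : ω ∈ W) :
    DifferentiableAt ℝ (fun p : Euc m × Euc d => f p.1 p.2) (x, ω) :=
  ((hf.contDiffAt ((hU.prod hW).mem_nhds ⟨hx, hω⟩)).differentiableAt (by simp))

theorem SmoothOn.hasFDerivAt_left (hf : SmoothOn f U W) (hU : IsOpen U) (hW : IsOpen W)
    {x : Euc m} {ω : Euc d} (hx : x ∈ U) (hω : ω ∈ W) :
    HasFDerivAt (fun y => f y ω) ((fderiv ℝ (fun p : Euc m × Euc d => f p.1 p.2) (x, ω)).comp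
      (ContinuousLinearMap.inl ℝ (Euc m) (Euc d))) x := by
  have h1 := (hf.differentiableAt hU hW hx hω).hasFDerivAt
  exact HasFDerivAt.comp x (f := fun y => (y, ω)) h1 (hasFDerivAt_prodMk_left x ω)

theorem SmoothOn.hasFDerivAt_right (hf : SmoothOn f U W) (hU : IsOpen U) (hW : IsOpen W)
    {x : Euc m} {ω : Euc d} (hx : x ∈ U) (hω : ω ∈ W) :
    HasFDerivAt (f x) ((fderiv ℝ (fun p : Euc m × Euc d => f p.1 p.2) (x, ω)).comp
      (ContinuousLinearMap.inr ℝ (Euc m) (Euc d))) ω := by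
  have h1 := (hf.differentiableAt hU hW hx hω).hasFDerivAt
  exact HasFDerivAt.comp ω (f := fun y => (x, y)) h1 (hasFDerivAt_prodMk_right x ω)

/-- On an open product the line derivative is a value of the joint Fréchet derivative; this is how
partial derivatives inherit joint smoothness. -/
theorem SmoothOn.dX_eq (hf : SmoothOn f U W) (hU : IsOpen U) (hW : IsOpen W)
    {x : Euc m} {ω : Euc d} (hx : x ∈ U) (hω : ω ∈ W) (i : Fin m) :
    dX i f x ω = fderiv ℝ (fun p : Euc m × Euc d => f p.1 p.2) (x, ω)
      (EuclideanSpace.single i 1, 0) := by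
  have := ((hf.hasFDerivAt_left hU hW hx hω).hasLineDerivAt
    (EuclideanSpace.single i (1 : ℝ))).lineDeriv
  simpa [dX] using this

theorem SmoothOn.dW_eq (hf : SmoothOn f U W) (hU : IsOpen U) (hW : IsOpen W)
    {x : Euc m} {ω : Euc d} (hx : x ∈ U) (hω : ω ∈ W) (j : Fin d) :
    dW j f x ω = fderiv ℝ (fun p : Euc m × Euc d => f p.1 p.2) (x, ω)
      (0, EuclideanSpace.single j 1) := by
  have := ((hf.hasFDerivAt_right hU hW hx hω).hasLineDerivAt
    (EuclideanSpace.single j (1 : ℝ))).lineDeriv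
  simpa [dW] using this

theorem SmoothOn.smoothOn_dX (hf : SmoothOn f U W) (hU : IsOpen U) (hW : IsOpen W) (i : Fin m) :
    SmoothOn (dX i f) U W := by
  have h : ContDiffOn ℝ ((⊤ : ℕ∞) : WithTop ℕ∞)
      (fderiv ℝ (fun p : Euc m × Euc d => f p.1 p.2)) (U ×ˢ W) :=
    ContDiffOn.fderiv_of_isOpen hf (hU.prod hW) (by simp)
  exact (h.clm_apply (contDiffOn_const (c := ((EuclideanSpace.single i 1, 0) : Euc m × Euc d)))).congr
    fun p hp => hf.dX_eq hU hW hp.1 hp.2 i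

theorem SmoothOn.smoothOn_dW (hf : SmoothOn f U W) (hU : IsOpen U) (hW : IsOpen W) (j : Fin d) :
    SmoothOn (dW j f) U W := by
  have h : ContDiffOn ℝ ((⊤ : ℕ∞) : WithTop ℕ∞)
      (fderiv ℝ (fun p : Euc m × Euc d => f p.1 p.2)) (U ×ˢ W) :=
    ContDiffOn.fderiv_of_isOpen hf (hU.prod hW) (by simp)
  exact (h.clm_apply (contDiffOn_const (c := ((0, EuclideanSpace.single j 1) : Euc m × Euc d)))).congr
    fun p hp => hf.dW_eq hU hW hp.1 hp.2 j

theorem SmoothOn.hasDerivAt_line_left (hf : SmoothOn f U W) (hU : IsOpen U) (hW : IsOpen W)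
    {x y : Euc m} {ω : Euc d} {t : ℝ} (hx : x + t • y ∈ U) (hω : ω ∈ W) :
    HasDerivAt (fun t : ℝ => f (x + t • y) ω) (∑ i, y i • dX i f (x + t • y) ω) t := by
  have h1 := hf.hasFDerivAt_left hU hW hx hω
  have h2 : HasDerivAt (fun t : ℝ => x + t • y) y t := by
    simpa using ((hasDerivAt_id t).smul_const y).const_add x
  have h3 := h1.comp_hasDerivAt t h2
  refine h3.congr_deriv (Eq.symm ?_)
  conv_rhs => rw [← Euc.sum_smul_single y]
  rw [map_sum]
  refine Finset.sum_congr rfl fun i _ => ?_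
  rw [hf.dX_eq hU hW hx hω, map_smul]
  simp [Euc.sum_smul_single]

theorem SmoothOn.hasDerivAt_line_right (hf : SmoothOn f U W) (hU : IsOpen U) (hW : IsOpen W)
    {x : Euc m} {ω w : Euc d} {t : ℝ} (hx : x ∈ U) (hω : ω + t • w ∈ W) :
    HasDerivAt (fun t : ℝ => f x (ω + t • w)) (∑ j, w j • dW j f x (ω + t • w)) t := by
  have h1 := hf.hasFDerivAt_right hU hW hx hω
  have h2 : HasDerivAt (fun t : ℝ => ω + t • w) w t := by
    simpa using ((hasDerivAt_id t).smul_const w).const_add ω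
  have h3 := h1.comp_hasDerivAt t h2
  refine h3.congr_deriv (Eq.symm ?_)
  conv_rhs => rw [← Euc.sum_smul_single w]
  rw [map_sum]
  refine Finset.sum_congr rfl fun i _ => ?_
  rw [hf.dW_eq hU hW hx hω, map_smul]
  simp [Euc.sum_smul_single]

theorem SmoothOn.contDiffOn_line (hf : SmoothOn f U W) {ω : Euc d} (hω : ω ∈ W) (x y : Euc m)
    {O : Set ℝ} (hO : ∀ t ∈ O, x + t • y ∈ U) :
    ContDiffOn ℝ ((⊤ : ℕ∞) : WithTop ℕ∞) (fun t : ℝ => f (x + t • y) ω) O :=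
  ContDiffOn.comp (t := U ×ˢ W) (f := fun t : ℝ => (x + t • y, ω)) hf
    (by fun_prop) fun t ht => ⟨hO t ht, hω⟩

/-- Derivatives along a line are bounded by the partial derivatives. -/
theorem SmoothOn.norm_iteratedDerivWithin_line_le (hU : IsOpen U) (hW : IsOpen W) (n : ℕ) :
    ∀ {f : Euc m → Euc d → F}, SmoothOn f U W → ∀ {K : ℝ} {ω : Euc d}, ω ∈ W →
      (∀ α : List (Fin m), α.length = n → ∀ x ∈ U, ‖dMix α [] f x ω‖ ≤ K) →
      ∀ (x y : Euc m) {O : Set ℝ}, IsOpen O → (∀ t ∈ O, x + t • y ∈ U) → ∀ t ∈ O,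
        ‖iteratedDerivWithin n (fun t : ℝ => f (x + t • y) ω) O t‖ ≤ (∑ i, |y i|) ^ n * K := by
  induction n with
  | zero =>
    intro f _ K ω _ hK x y O _ hline t ht
    simpa [dMix] using hK [] rfl _ (hline t ht)
  | succ n ih =>
    intro f hf K ω hω hK x y O hO hline t ht
    have hd : EqOn (derivWithin (fun t : ℝ => f (x + t • y) ω) O)
        (fun t => ∑ i, y i • dX i f (x + t • y) ω) O := fun s hs =>
      ((hf.hasDerivAt_line_left hU hW (hline s hs) hω).hasDerivWithinAt).derivWithin
        (hO.uniqueDiffOn s hs)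
    have hsm : ∀ i, ContDiffOn ℝ ((⊤ : ℕ∞) : WithTop ℕ∞)
        (fun t : ℝ => dX i f (x + t • y) ω) O := fun i =>
      (hf.smoothOn_dX hU hW i).contDiffOn_line hω x y hline
    rw [iteratedDerivWithin_succ', iteratedDerivWithin_congr hd ht,
      iteratedDerivWithin_fun_sum ht hO.uniqueDiffOn
        (fun i _ => (((hsm i).const_smul (y i)).of_le (by exact_mod_cast le_top)) t ht)]
    calc ‖∑ i, iteratedDerivWithin n (fun t => y i • dX i f (x + t • y) ω) O t‖
        ≤ ∑ i, |y i| * ((∑ i, |y i|) ^ n * K) := by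
          refine norm_sum_le_of_le _ fun i _ => ?_
          rw [iteratedDerivWithin_fun_const_smul ht hO.uniqueDiffOn, norm_smul, Real.norm_eq_abs]
          refine mul_le_mul_of_nonneg_left ?_ (abs_nonneg _)
          · refine ih (hf.smoothOn_dX hU hW i) hω (fun α hα x hx => ?_) x y hO hline t ht
            -- `foldr` applies the last entry first, so appending `i` makes `dX i` the innermost
            -- derivative and no commutation of partials is needed.
            have := hK (α ++ [i]) (by simp [hα]) x hx
            simpa [dMix] using this
          · exact ((hsm i).of_le (by exact_mod_cast le_top)) t ht
      _ = (∑ i, |y i|) ^ (n + 1) * K := by rw [← Finset.sum_mul]; ring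

end Partials

/-! ### First- and second-order Taylor estimates. -/

section Taylor

variable {m d : ℕ} {f : Euc m → Euc d → ℝ} {U : Set (Euc m)} {W : Set (Euc d)}

theorem SmoothOn.abs_sub_le_right (hf : SmoothOn f U W) (hU : IsOpen U) (hW : IsOpen W)
    (hWc : Convex ℝ W) {x : Euc m} (hx : x ∈ U) {C : ℝ} (hC : ∀ j, ∀ ω ∈ W, |dW j f x ω| ≤ C)
    {ω ω' : Euc d} (hω : ω ∈ W) (hω' : ω' ∈ W) :
    |f x ω' - f x ω| ≤ C * ∑ j, |(ω' - ω) j| := by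
  have hseg : ∀ t ∈ Icc (0 : ℝ) 1, ω + t • (ω' - ω) ∈ W := fun t ht =>
    hWc.add_smul_sub_mem hω hω' ht
  have := norm_image_sub_le_of_norm_deriv_le_segment_01'
    (f := fun t : ℝ => f x (ω + t • (ω' - ω))) (C := C * ∑ j, |(ω' - ω) j|)
    (fun t ht => (hf.hasDerivAt_line_right hU hW hx (hseg t ht)).hasDerivWithinAt)
    (fun t ht => by
      rw [Finset.mul_sum]
      refine norm_sum_le_of_le _ fun j _ => ?_
      rw [norm_smul, mul_comm]
      exact mul_le_mul_of_nonneg_right (hC j _ (hseg t ⟨ht.1, ht.2.le⟩)) (norm_nonneg _))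
  simpa using this

theorem SmoothOn.abs_sub_le_left (hf : SmoothOn f U W) (hU : IsOpen U) (hW : IsOpen W)
    (hUc : Convex ℝ U) {ω : Euc d} (hω : ω ∈ W) {C : ℝ} (hC : ∀ i, ∀ x ∈ U, |dX i f x ω| ≤ C)
    {x x' : Euc m} (hx : x ∈ U) (hx' : x' ∈ U) :
    |f x' ω - f x ω| ≤ C * ∑ i, |(x' - x) i| := by
  have hseg : ∀ t ∈ Icc (0 : ℝ) 1, x + t • (x' - x) ∈ U := fun t ht =>
    hUc.add_smul_sub_mem hx hx' ht
  have := norm_image_sub_le_of_norm_deriv_le_segment_01'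
    (f := fun t : ℝ => f (x + t • (x' - x)) ω) (C := C * ∑ j, |(x' - x) j|)
    (fun t ht => (hf.hasDerivAt_line_left hU hW (hseg t ht) hω).hasDerivWithinAt)
    (fun t ht => by
      rw [Finset.mul_sum]
      refine norm_sum_le_of_le _ fun j _ => ?_
      rw [norm_smul, mul_comm]
      exact mul_le_mul_of_nonneg_right (hC j _ (hseg t ⟨ht.1, ht.2.le⟩)) (norm_nonneg _))
  simpa using this

/-- Second-order Taylor expansion in `ω`. -/
theorem SmoothOn.abs_sub_sub_le_right (hf : SmoothOn f U W) (hU : IsOpen U) (hW : IsOpen W)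
    (hWc : Convex ℝ W) {x : Euc m} (hx : x ∈ U) {C : ℝ} (hC0 : 0 ≤ C)
    (hC : ∀ i j, ∀ ω ∈ W, |dW i (dW j f) x ω| ≤ C)
    {ω ω' : Euc d} (hω : ω ∈ W) (hω' : ω' ∈ W) :
    |f x ω' - f x ω - ∑ j, (ω' - ω) j * dW j f x ω| ≤ C * (∑ j, |(ω' - ω) j|) ^ 2 := by
  have hseg : ∀ t ∈ Icc (0 : ℝ) 1, ω + t • (ω' - ω) ∈ W := fun t ht =>
    hWc.add_smul_sub_mem hω hω' ht
  -- After subtracting the linear term, the derivative at `t` is a difference of gradients at two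
  -- points of the segment, which the first-order estimate controls. The factor `1/2` is given up.
  have := norm_image_sub_le_of_norm_deriv_le_segment_01'
    (f := fun t : ℝ => f x (ω + t • (ω' - ω)) - t * ∑ j, (ω' - ω) j * dW j f x ω)
    (C := C * (∑ j, |(ω' - ω) j|) ^ 2)
    (fun t ht => ((hf.hasDerivAt_line_right hU hW hx (hseg t ht)).sub
      ((hasDerivAt_id t).mul_const _)).hasDerivWithinAt)
    (fun t ht => by
      have ht' : t ∈ Icc (0 : ℝ) 1 := ⟨ht.1, ht.2.le⟩
      simp only [one_mul, smul_eq_mul]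
      rw [← Finset.sum_sub_distrib]
      have h1 : ∀ j, |dW j f x (ω + t • (ω' - ω)) - dW j f x ω| ≤
          C * ∑ j, |(ω' - ω) j| := by
        intro j
        refine ((hf.smoothOn_dW hU hW j).abs_sub_le_right hU hW hWc hx (fun i => hC i j) hω
          (hseg t ht')).trans ?_
        refine mul_le_mul_of_nonneg_left (Finset.sum_le_sum fun i _ => ?_) hC0
        simp only [add_sub_cancel_left, PiLp.smul_apply, smul_eq_mul, abs_mul, abs_of_nonneg ht.1]
        exact mul_le_of_le_one_left (abs_nonneg _) ht.2.le
      calc ‖∑ j, ((ω' - ω) j * dW j f x (ω + t • (ω' - ω))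
            - (ω' - ω) j * dW j f x ω)‖
          ≤ ∑ j, |(ω' - ω) j| * (C * ∑ j, |(ω' - ω) j|) := by
            refine norm_sum_le_of_le _ fun j _ => ?_
            rw [← mul_sub, Real.norm_eq_abs, abs_mul]
            exact mul_le_mul_of_nonneg_left (h1 j) (abs_nonneg _)
        _ = C * (∑ j, |(ω' - ω) j|) ^ 2 := by rw [← Finset.sum_mul]; ring)
  have e : ω + (ω' - ω) = ω' := by abel
  simp only [one_smul, zero_smul, add_zero, one_mul, zero_mul, sub_zero, e] at this
  rwa [sub_right_comm, Real.norm_eq_abs] at this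

end Taylor

/-! ### Angles and distances -/

section Angles

variable {E : Type*} [NormedAddCommGroup E] [InnerProductSpace ℝ E]

/-- `t • v` is the orthogonal projection of `u` onto the line of `v`. This translates angles into
distances; both translations below use only `sin θ ≤ θ`, so constants are preserved. -/
theorem exists_norm_sub_smul_eq_sin_angle (u : E) {v : E} (hv : v ≠ 0) :
    ∃ t : ℝ, ‖u - t • v‖ = Real.sin (InnerProductGeometry.angle u v) * ‖u‖ := by
  have hv' : 0 < ‖v‖ := norm_pos_iff.2 hv
  refine ⟨inner ℝ u v / ‖v‖ ^ 2, ?_⟩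
  have h1 := InnerProductGeometry.sin_angle_mul_norm_mul_norm u v
  have h2 : ‖u - (inner ℝ u v / ‖v‖ ^ 2) • v‖ ^ 2 * ‖v‖ ^ 2 =
      inner ℝ u u * inner ℝ v v - inner ℝ u v * inner ℝ u v := by
    rw [norm_sub_sq_real, inner_smul_right, norm_smul, real_inner_self_eq_norm_sq,
      real_inner_self_eq_norm_sq, mul_pow, Real.norm_eq_abs, sq_abs]
    field_simp
    ring
  have h3 : ‖u - (inner ℝ u v / ‖v‖ ^ 2) • v‖ * ‖v‖ =
      Real.sin (InnerProductGeometry.angle u v) * ‖u‖ * ‖v‖ := by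
    rw [mul_assoc, h1, ← h2, ← mul_pow, Real.sqrt_sq (by positivity)]
  exact mul_right_cancel₀ hv'.ne' h3

theorem le_angle_of_forall_le_norm_sub {c : ℝ} {u v : E} (hu : u ≠ 0) (hv : v ≠ 0)
    (h : ∀ t : ℝ, c * ‖u‖ ≤ ‖u - t • v‖) : c ≤ InnerProductGeometry.angle v u := by
  obtain ⟨t, ht⟩ := exists_norm_sub_smul_eq_sin_angle u hv
  have h1 := h t
  rw [ht] at h1
  have h2 := le_of_mul_le_mul_right h1 (norm_pos_iff.2 hu)
  rw [InnerProductGeometry.angle_comm]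
  exact h2.trans (Real.sin_le (InnerProductGeometry.angle_nonneg _ _))

theorem exists_norm_sub_smul_le_of_angle_le {ε : ℝ} {u v : E} (hv : v ≠ 0)
    (h : InnerProductGeometry.angle u v ≤ ε) : ∃ t : ℝ, ‖u - t • v‖ ≤ ε * ‖u‖ := by
  obtain ⟨t, ht⟩ := exists_norm_sub_smul_eq_sin_angle u hv
  refine ⟨t, ht.le.trans (mul_le_mul_of_nonneg_right ?_ (norm_nonneg _))⟩
  exact (Real.sin_le (InnerProductGeometry.angle_nonneg _ _)).trans h

end Angles

/-! ### Choice of a transverse subspace -/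

section Transversal

open Module

/-- A subspace `U` splits into a part that makes a large angle with `V` and a part close to `V`. -/
theorem exists_split_by_projection {n : ℕ} (U V : Submodule ℝ (Euc n)) (c : ℝ) :
    ∃ Y E : Submodule ℝ (Euc n), Y ≤ U ∧ E ≤ U ∧ finrank ℝ Y + finrank ℝ E = finrank ℝ U ∧
      (∀ y ∈ Y, ‖V.starProjection y‖ ^ 2 ≤ c * ‖y‖ ^ 2) ∧
      ∀ e ∈ E, c * ‖e‖ ^ 2 ≤ ‖V.starProjection e‖ ^ 2 := by
  -- Diagonalise `B* B`, where `B` is the projection onto `V` restricted to `U`: eigenvectors with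
  -- eigenvalue at most `c` span `Y`, and `E` is the complement of `Y` in `U`.
  set B : U →ₗ[ℝ] Euc n := V.starProjection.toLinearMap ∘ₗ U.subtype with hB
  set T : U →ₗ[ℝ] U := LinearMap.adjoint B ∘ₗ B with hT
  have hsymm : T.IsSymmetric := fun x y => by
    simp [hT, LinearMap.adjoint_inner_left, LinearMap.adjoint_inner_right]
  set b := hsymm.eigenvectorBasis rfl with hb
  set ev := hsymm.eigenvalues rfl with hev
  have hexp : ∀ u : U, ‖B u‖ ^ 2 = ∑ i, ev i * inner ℝ (b i) u ^ 2 := by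
    intro u
    have h1 : ‖B u‖ ^ 2 = inner ℝ u (T u) := by
      change _ = inner ℝ u (LinearMap.adjoint B (B u))
      rw [LinearMap.adjoint_inner_right, real_inner_self_eq_norm_sq]
    rw [h1, ← b.sum_inner_mul_inner u (T u)]
    refine Finset.sum_congr rfl fun i _ => ?_
    have h2 : T (b i) = ev i • b i := hsymm.apply_eigenvectorBasis rfl i
    have h3 : inner ℝ (ev i • b i) u = ev i * inner ℝ (b i) u := by
      have := real_inner_smul_left (b i) u (ev i)
      exact this
    rw [← hsymm (b i) u, h2, h3, real_inner_comm u (b i)]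
    ring
  have hnorm : ∀ u : U, ‖u‖ ^ 2 = ∑ i, inner ℝ (b i) u ^ 2 := fun u => by
    rw [← b.sum_sq_norm_inner_right u]
    simp
  set I : Set (Fin (finrank ℝ U)) := {i | ev i ≤ c} with hI
  set Y' : Submodule ℝ U := Submodule.span ℝ (b '' I) with hY'
  have hYzero : ∀ u ∈ Y', ∀ i ∉ I, inner ℝ (b i) u = 0 := by
    intro u hu i hi
    have : Y' ≤ (ℝ ∙ b i)ᗮ := by
      rw [hY', Submodule.span_le]
      rintro _ ⟨j, hj, rfl⟩
      rw [SetLike.mem_coe, Submodule.mem_orthogonal_singleton_iff_inner_right]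
      exact b.orthonormal.2 (fun h => hi (h ▸ hj))
    exact Submodule.mem_orthogonal_singleton_iff_inner_right.1 (this hu)
  have hEzero : ∀ u ∈ Y'ᗮ, ∀ i ∈ I, inner ℝ (b i) u = 0 := fun u hu i hi =>
    (Submodule.mem_orthogonal _ _).1 hu _ (Submodule.subset_span ⟨i, hi, rfl⟩)
  have hfin : ∀ Z : Submodule ℝ U, finrank ℝ (Z.map U.subtype) = finrank ℝ Z := fun Z =>
    Submodule.finrank_map_subtype_eq U Z
  refine ⟨Y'.map U.subtype, Y'ᗮ.map U.subtype, Submodule.map_subtype_le _ _,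
    Submodule.map_subtype_le _ _, ?_, ?_, ?_⟩
  · rw [hfin, hfin, Submodule.finrank_add_finrank_orthogonal]
  · rintro _ ⟨u, hu, rfl⟩
    change ‖B u‖ ^ 2 ≤ c * ‖u‖ ^ 2
    rw [hexp, hnorm, Finset.mul_sum]
    refine Finset.sum_le_sum fun i _ => ?_
    by_cases hi : i ∈ I
    · exact mul_le_mul_of_nonneg_right hi (sq_nonneg _)
    · simp [hYzero u hu i hi]
  · rintro _ ⟨u, hu, rfl⟩
    change c * ‖u‖ ^ 2 ≤ ‖B u‖ ^ 2
    rw [hexp, hnorm, Finset.mul_sum]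
    refine Finset.sum_le_sum fun i _ => ?_
    by_cases hi : i ∈ I
    · simp [hEzero u hu i hi]
    · exact mul_le_mul_of_nonneg_right (not_le.1 hi).le (sq_nonneg _)

theorem norm_sub_orthogonalProjection_sq {n : ℕ} (V : Submodule ℝ (Euc n)) (y : Euc n) :
    ‖y - V.starProjection y‖ ^ 2 = ‖y‖ ^ 2 - ‖V.starProjection y‖ ^ 2 := by
  have h : inner ℝ (y - V.starProjection y) (V.starProjection y) = 0 :=
    V.starProjection_inner_eq_zero y _ (V.starProjection_apply_mem y)
  rw [inner_sub_left, real_inner_self_eq_norm_sq, sub_eq_zero] at h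
  rw [norm_sub_sq_real, h]
  ring

theorem toEuclideanCLM_signMatrix_apply {d : ℕ} (σ : ℕ) (v : Euc d) (i : Fin d) :
    Matrix.toEuclideanCLM (𝕜 := ℝ) (signMatrix d σ) v i =
      if (i : ℕ) < (d + σ) / 2 then v i else -v i := by
  have : Matrix.toEuclideanCLM (𝕜 := ℝ) (signMatrix d σ) v i =
      Matrix.mulVec (signMatrix d σ) v.ofLp i := rfl
  rw [this, signMatrix, Matrix.mulVec_diagonal]
  split_ifs <;> simp

theorem norm_toEuclideanCLM_signMatrix {d : ℕ} (σ : ℕ) (v : Euc d) :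
    ‖Matrix.toEuclideanCLM (𝕜 := ℝ) (signMatrix d σ) v‖ = ‖v‖ := by
  rw [EuclideanSpace.norm_eq, EuclideanSpace.norm_eq]
  congr 1
  refine Finset.sum_congr rfl fun i _ => ?_
  rw [toEuclideanCLM_signMatrix_apply]
  split_ifs <;> simp

theorem toEuclideanCLM_signMatrix_apply_self {d : ℕ} (σ : ℕ) (v : Euc d) :
    Matrix.toEuclideanCLM (𝕜 := ℝ) (signMatrix d σ)
      (Matrix.toEuclideanCLM (𝕜 := ℝ) (signMatrix d σ) v) = v := by
  ext i
  rw [toEuclideanCLM_signMatrix_apply, toEuclideanCLM_signMatrix_apply]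
  split_ifs <;> simp

/-- If `Q` is close to the symmetry `I_{d,σ}`, the orthogonal complement of `Q V` contains a
subspace of large dimension which is quantitatively transverse to `V`. -/
theorem exists_transverse_subspace {d σ : ℕ} (hσ : σ ≤ d) (Q : Euc d →ₗ[ℝ] Euc d)
    (hQ : ∀ v, ‖Q v - Matrix.toEuclideanCLM (𝕜 := ℝ) (signMatrix d σ) v‖ ≤ 1 / 4 * ‖v‖)
    (V : Submodule ℝ (Euc d)) :
    ∃ Y : Submodule ℝ (Euc d), (∀ y ∈ Y, ∀ v ∈ V, inner ℝ y (Q v) = 0) ∧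
      (∀ y ∈ Y, ∀ v ∈ V, 1 / 2 * ‖y‖ ≤ ‖y - v‖) ∧
      d ≤ finrank ℝ Y + 2 * finrank ℝ V ∧ (d + σ) / 2 ≤ finrank ℝ Y + finrank ℝ V := by
  set J := Matrix.toEuclideanCLM (𝕜 := ℝ) (signMatrix d σ) with hJ
  set U : Submodule ℝ (Euc d) := (V.map Q)ᗮ with hU
  have hUfin : d ≤ finrank ℝ U + finrank ℝ V := by
    have h1 := Submodule.finrank_add_finrank_orthogonal (V.map Q)
    have h2 : finrank ℝ (V.map Q) ≤ finrank ℝ V := Submodule.finrank_map_le Q V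
    rw [finrank_euclideanSpace_fin, ← hU] at h1
    omega
  have hUinner : ∀ u ∈ U, ∀ v ∈ V, inner ℝ u (Q v) = 0 := fun u hu v hv => by
    rw [real_inner_comm]
    exact (Submodule.mem_orthogonal _ _).1 hu _ ⟨v, hv, rfl⟩
  -- The threshold `3/4` means distance to `V` at least half the norm on `Y` and at most half the
  -- norm on `E`. It remains to bound `dim E` from above in two ways.
  obtain ⟨Y, E, hYU, hEU, hYE, hY, hE⟩ := exists_split_by_projection U V (3 / 4)
  have hVE : finrank ℝ E ≤ finrank ℝ V := by
    have hinj : Function.Injective (V.orthogonalProjectionOnto.toLinearMap ∘ₗ E.subtype) := by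
      rw [← LinearMap.ker_eq_bot, LinearMap.ker_eq_bot']
      rintro ⟨e, he⟩ h0
      have h0' : V.starProjection e = 0 := by
        rw [Submodule.starProjection_apply]
        exact congrArg Subtype.val h0
      have := hE e he
      rw [h0'] at this
      have : ‖e‖ = 0 := by
        simp only [norm_zero] at this
        nlinarith [norm_nonneg e]
      simpa using this
    exact LinearMap.finrank_le_finrank_of_injective hinj
  -- `E` has no vector supported on the positive coordinates. For such `e`, `⟨e, Q e⟩ ≥ (3/4)|e|²`;
  -- but with `v ∈ V` the projection of `e`, orthogonality to `Q V` gives `⟨e, Q e⟩ = ⟨e, Q(e - v)⟩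
  -- ≤ (5/4)(1/2)|e|²`. So the negative coordinates embed `E`.
  have hEneg : finrank ℝ E ≤ d - (d + σ) / 2 := by
    set L : Euc d →ₗ[ℝ] (Fin (d - (d + σ) / 2) → ℝ) := LinearMap.pi fun i =>
      EuclideanSpace.projₗ (𝕜 := ℝ) (⟨(d + σ) / 2 + i, by omega⟩ : Fin d) with hL
    have hinj : Function.Injective (L ∘ₗ E.subtype) := by
      rw [← LinearMap.ker_eq_bot, LinearMap.ker_eq_bot']
      rintro ⟨e, he⟩ h0
      have hcoord : ∀ i : Fin d, ¬ (i : ℕ) < (d + σ) / 2 → e i = 0 := by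
        intro i hi
        have h1 : L e ⟨i - (d + σ) / 2, by omega⟩ = 0 := congrFun h0 _
        have h2 : L e ⟨i - (d + σ) / 2, by omega⟩ = e i := by
          change e ⟨(d + σ) / 2 + (i - (d + σ) / 2), _⟩ = e i
          exact congrArg (fun k : Fin d => e k) (Fin.ext (by simp only; omega))
        rw [← h2, h1]
      have hJe : J e = e := by
        ext i
        rw [hJ, toEuclideanCLM_signMatrix_apply]
        split_ifs with hi
        · rfl
        · simp [hcoord i hi]
      set v : Euc d := V.starProjection e with hv
      have hvV : v ∈ V := V.starProjection_apply_mem e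
      have h1 : ‖e - v‖ ≤ 1 / 2 * ‖e‖ := by
        have h2 := norm_sub_orthogonalProjection_sq V e
        have h3 := hE e he
        refine abs_le_of_sq_le_sq' ?_ (by positivity) |>.2
        rw [hv, h2]
        nlinarith
      have h4 : inner ℝ e (Q e) = inner ℝ e (Q (e - v)) := by
        rw [map_sub, inner_sub_right, hUinner e (hEU he) v hvV, sub_zero]
      have h5 : ‖Q (e - v)‖ ≤ 5 / 4 * ‖e - v‖ := by
        have h6 := norm_add_le (Q (e - v) - J (e - v)) (J (e - v))
        rw [sub_add_cancel, hJ, norm_toEuclideanCLM_signMatrix] at h6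
        linarith [hQ (e - v)]
      have h7 : inner ℝ e (Q (e - v)) ≤ ‖e‖ * (5 / 8 * ‖e‖) :=
        (real_inner_le_norm _ _).trans (mul_le_mul_of_nonneg_left (by linarith) (norm_nonneg _))
      have h8 : ‖e‖ ^ 2 - ‖e‖ * (1 / 4 * ‖e‖) ≤ inner ℝ e (Q e) := by
        have h9 : inner ℝ e (Q e) = inner ℝ e (Q e - J e) + ‖e‖ ^ 2 := by
          rw [inner_sub_right, hJe, real_inner_self_eq_norm_sq]
          ring
        have h10 := neg_le_of_abs_le ((abs_real_inner_le_norm e (Q e - J e)).trans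
          (mul_le_mul_of_nonneg_left (hQ e) (norm_nonneg e)))
        rw [h9]
        linarith
      have : ‖e‖ = 0 := by nlinarith [norm_nonneg e]
      simpa using this
    simpa using LinearMap.finrank_le_finrank_of_injective hinj
  refine ⟨Y, fun y hy v hv => hUinner y (hYU hy) v hv, fun y hy v hv => ?_, by omega, by omega⟩
  have h1 : ‖y - V.starProjection y‖ ≤ ‖y - v‖ := by
    have hsq : ‖y - v‖ ^ 2 = ‖y - V.starProjection y‖ ^ 2
        + ‖V.starProjection y - v‖ ^ 2 := by
      have h0 : inner ℝ (y - V.starProjection y) (V.starProjection y - v) = 0 :=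
        V.starProjection_inner_eq_zero y _ (V.sub_mem (V.starProjection_apply_mem y) hv)
      have h2 : y - v = (y - V.starProjection y) + (V.starProjection y - v) := by
        abel
      rw [h2, norm_add_sq_real, h0]
      ring
    refine abs_le_of_sq_le_sq' ?_ (by positivity) |>.2
    nlinarith [sq_nonneg ‖V.starProjection y - v‖]
  refine le_trans ?_ h1
  have h2 := norm_sub_orthogonalProjection_sq V y
  refine abs_le_of_sq_le_sq' ?_ (by positivity) |>.2
  nlinarith [hY y hy]

end Transversal

/-! ### Horizontal and vertical coordinates -/

section Coordinates

variable {d : ℕ}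

theorem horiz_add (x y : Euc (d + 1)) : horiz (x + y) = horiz x + horiz y := rfl

theorem horiz_sub (x y : Euc (d + 1)) : horiz (x - y) = horiz x - horiz y := rfl

theorem horiz_smul (t : ℝ) (x : Euc (d + 1)) : horiz (t • x) = t • horiz x := rfl

theorem norm_sq_eq_horiz (x : Euc (d + 1)) :
    ‖x‖ ^ 2 = ‖horiz x‖ ^ 2 + x (Fin.last d) ^ 2 := by
  rw [EuclideanSpace.real_norm_sq_eq, EuclideanSpace.real_norm_sq_eq, Fin.sum_univ_castSucc]
  rfl

theorem norm_horiz_le (x : Euc (d + 1)) : ‖horiz x‖ ≤ ‖x‖ := by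
  refine abs_le_of_sq_le_sq' ?_ (norm_nonneg _) |>.2
  nlinarith [norm_sq_eq_horiz x, sq_nonneg (x (Fin.last d))]

theorem Euc.abs_apply_le {n : ℕ} (x : Euc n) (i : Fin n) : |x i| ≤ ‖x‖ := by
  simpa using PiLp.norm_apply_le x i

theorem Euc.norm_le_sum_abs {n : ℕ} (x : Euc n) : ‖x‖ ≤ ∑ i, |x i| := by
  conv_lhs => rw [← Euc.sum_smul_single x]
  refine norm_sum_le_of_le _ fun i _ => ?_
  rw [norm_smul]
  simp

/-- `x ↦ x'` as a linear map. -/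
def horizL (d : ℕ) : Euc (d + 1) →ₗ[ℝ] Euc d where
  toFun := horiz
  map_add' := horiz_add
  map_smul' := horiz_smul

theorem contDiff_horiz {k : WithTop ℕ∞} : ContDiff ℝ k (horiz : Euc (d + 1) → Euc d) :=
  (horizL d).toContinuousLinearMap.contDiff

theorem continuous_horiz : Continuous (horiz : Euc (d + 1) → Euc d) :=
  (horizL d).toContinuousLinearMap.continuous

/-- `y ↦ (y, 0)`. -/
def embedL (d : ℕ) : Euc d →ₗ[ℝ] Euc (d + 1) where
  toFun y := WithLp.toLp 2 (Fin.snoc (α := fun _ => ℝ) (fun j => y j) 0)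
  map_add' x y := by
    ext i
    refine Fin.lastCases ?_ (fun j => ?_) i <;> simp
  map_smul' t x := by
    ext i
    refine Fin.lastCases ?_ (fun j => ?_) i <;> simp

@[simp] theorem embedL_last (y : Euc d) : embedL d y (Fin.last d) = 0 := by simp [embedL]

@[simp] theorem horiz_embedL (y : Euc d) : horiz (embedL d y) = y := by
  ext i
  simp [embedL, horiz]

theorem norm_embedL (y : Euc d) : ‖embedL d y‖ = ‖y‖ := by
  have := norm_sq_eq_horiz (embedL d y)
  rw [embedL_last, horiz_embedL] at this
  have h2 : ‖embedL d y‖ ^ 2 = ‖y‖ ^ 2 := by rw [this]; ring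
  exact (sq_eq_sq₀ (norm_nonneg _) (norm_nonneg _)).1 h2

theorem embedL_injective : Function.Injective (embedL d) := fun x y h => by
  rw [← horiz_embedL x, h, horiz_embedL]

theorem embedL_horiz {x : Euc (d + 1)} (h : x (Fin.last d) = 0) : embedL d (horiz x) = x := by
  ext i
  refine Fin.lastCases ?_ (fun j => ?_) i
  · simp [h]
  · simp [embedL, horiz]

theorem isOpen_spaceBox (rX rN : ℝ) : IsOpen (spaceBox d rX rN) :=
  (isOpen_lt (continuous_horiz.norm) continuous_const).inter
    (isOpen_lt (by fun_prop : Continuous fun x : Euc (d + 1) => |x (Fin.last d)|)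
      continuous_const)

theorem convex_spaceBox (rX rN : ℝ) : Convex ℝ (spaceBox d rX rN) := by
  have h1 : Convex ℝ ((horizL d) ⁻¹' ball 0 rX) := (convex_ball _ _).linear_preimage _
  have h2 : Convex ℝ ((EuclideanSpace.projₗ (𝕜 := ℝ) (Fin.last d)) ⁻¹' ball (0 : ℝ) rN) :=
    (convex_ball _ _).linear_preimage _
  convert h1.inter h2 using 1
  ext x
  simp [spaceBox, horizL]

theorem mem_spaceBox_of_norm_lt {rX rN : ℝ} {x : Euc (d + 1)} (h : ‖x‖ < min rX rN) :
    x ∈ spaceBox d rX rN :=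
  ⟨(norm_horiz_le x).trans_lt (h.trans_le (min_le_left _ _)),
    (Euc.abs_apply_le x _).trans_lt (h.trans_le (min_le_right _ _))⟩

end Coordinates

/-! ### The subspace transverse to `V` -/

section Transverse

open Module

variable {d : ℕ}

/-- Data at a frequency whose normal direction `(γ, 1)` is close to `V`: `N` stands for
`∂²_{ωx'} φ` and `S` for the second fundamental form. -/
theorem exists_transverse_of_normal_near {σ : ℕ} (hσ : σ ≤ d) (N S : Euc d →L[ℝ] Euc d)
    (hN : ‖N - 1‖ ≤ 1 / 100)
    (hS : ‖S - Matrix.toEuclideanCLM (𝕜 := ℝ) (signMatrix d σ)‖ ≤ 1 / 100)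
    (V : Submodule ℝ (Euc (d + 1))) {e : Euc (d + 1)} (he : e ∈ V)
    (heh : ‖horiz e‖ ≤ 1 / 25) (hen : |e (Fin.last d) - 1| ≤ 1 / 50) :
    ∃ V' : Submodule ℝ (Euc (d + 1)),
      muDim (d + 1) σ (finrank ℝ V) ≤ (finrank ℝ V' : ℤ) ∧
      (finrank ℝ V' : ℤ) ≤ ((d + 1 : ℕ) : ℤ) - (finrank ℝ V : ℤ) ∧
      (∀ v ∈ V, ∀ v' ∈ V', v ≠ 0 → v' ≠ 0 → 1 / 4 ≤ InnerProductGeometry.angle v v') ∧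
      (∀ v' ∈ V', v' (Fin.last d) = 0) ∧
      ∀ (q w : Euc d) (η η' : ℝ), (∃ u ∈ V, ‖horiz u - q‖ ≤ η ∧ |u (Fin.last d)| ≤ η) →
        ‖N q + S w‖ ≤ η' → ∀ v' ∈ V', |inner ℝ (N (horiz v')) w| ≤ 10 * (η + η') * ‖v'‖ := by
  set J := Matrix.toEuclideanCLM (𝕜 := ℝ) (signMatrix d σ) with hJ
  have hen0 : 49 / 50 ≤ e (Fin.last d) := by linarith [(abs_le.1 hen).1]
  have hNb : ∀ v, ‖N v - v‖ ≤ 1 / 100 * ‖v‖ := fun v =>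
    ((N - 1).le_opNorm v).trans (mul_le_mul_of_nonneg_right hN (norm_nonneg _))
  have hSb : ∀ v, ‖S v - J v‖ ≤ 1 / 100 * ‖v‖ := fun v =>
    ((S - J).le_opNorm v).trans (mul_le_mul_of_nonneg_right hS (norm_nonneg _))
  have hNle : ∀ v, ‖N v‖ ≤ 101 / 100 * ‖v‖ := fun v => by
    have := norm_add_le (N v - v) v
    rw [sub_add_cancel] at this
    linarith [hNb v]
  have hSge : ∀ v, 99 / 100 * ‖v‖ ≤ ‖S v‖ := fun v => by
    have := norm_sub_norm_le (J v) (J v - S v)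
    rw [sub_sub_cancel, norm_sub_rev, hJ, norm_toEuclideanCLM_signMatrix] at this
    linarith [hSb v]
  have hSinj : Function.Injective S.toLinearMap := by
    rw [← LinearMap.ker_eq_bot, LinearMap.ker_eq_bot']
    intro v hv
    have h1 : S v = 0 := hv
    have := hSge v
    rw [h1, norm_zero] at this
    exact norm_le_zero_iff.1 (by linarith)
  -- `T = S⁻¹`, which is close to the involution `J` because `S` is.
  set T : Euc d ≃ₗ[ℝ] Euc d := (LinearEquiv.ofInjectiveEndo S.toLinearMap hSinj).symm with hT
  have hST : ∀ u, S (T u) = u := fun u =>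
    (LinearEquiv.ofInjectiveEndo S.toLinearMap hSinj).apply_symm_apply u
  have hTS : ∀ u, T (S u) = u := fun u =>
    (LinearEquiv.ofInjectiveEndo S.toLinearMap hSinj).symm_apply_apply u
  have hTle : ∀ u, ‖T u‖ ≤ 100 / 99 * ‖u‖ := fun u => by
    have := hSge (T u)
    rw [hST] at this
    linarith
  have hTJ : ∀ u, ‖T u - J u‖ ≤ 1 / 99 * ‖u‖ := fun u => by
    have h1 : T u - J u = J (J (T u) - S (T u)) := by
      rw [map_sub, hST, hJ, toEuclideanCLM_signMatrix_apply_self]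
    rw [h1, hJ, norm_toEuclideanCLM_signMatrix, ← hJ, norm_sub_rev]
    linarith [hSb (T u), hTle u]
  -- `⟨y, Q v⟩ = ⟨N y, S⁻¹ N v⟩` is, up to sign, the change of the gradient in direction `y` when
  -- the normal moves by `v`.
  set Q : Euc d →ₗ[ℝ] Euc d :=
    (ContinuousLinearMap.adjoint N).toLinearMap ∘ₗ T.toLinearMap ∘ₗ N.toLinearMap with hQ
  have hQapp : ∀ y v, inner ℝ y (Q v) = inner ℝ (N y) (T (N v)) := fun y v =>
    ContinuousLinearMap.adjoint_inner_right N y (T (N v))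
  have hNadj : ∀ v, ‖ContinuousLinearMap.adjoint N v - v‖ ≤ 1 / 100 * ‖v‖ := fun v => by
    have h1 : ‖ContinuousLinearMap.adjoint N - 1‖ ≤ 1 / 100 := by
      have h2 : ContinuousLinearMap.adjoint N - 1 = ContinuousLinearMap.adjoint (N - 1) := by
        rw [map_sub]
        congr 1
        exact (star_one (Euc d →L[ℝ] Euc d)).symm
      rw [h2, LinearIsometryEquiv.norm_map]
      exact hN
    exact ((ContinuousLinearMap.adjoint N - 1).le_opNorm v).trans
      (mul_le_mul_of_nonneg_right h1 (norm_nonneg _))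
  have hQJ : ∀ v, ‖Q v - J v‖ ≤ 1 / 4 * ‖v‖ := fun v => by
    have h1 : Q v - J v = (ContinuousLinearMap.adjoint N (T (N v)) - T (N v)) +
        (T (N v) - J (N v)) + J (N v - v) := by
      rw [map_sub]
      change ContinuousLinearMap.adjoint N (T (N v)) - J v = _
      abel
    have h2 : ‖J (N v - v)‖ ≤ 1 / 100 * ‖v‖ := by
      rw [hJ, norm_toEuclideanCLM_signMatrix]
      exact hNb v
    rw [h1]
    refine (norm_add₃_le).trans ?_
    linarith [hNadj (T (N v)), hTle (N v), hTJ (N v), hNle v, norm_nonneg v]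
  set V0 : Submodule ℝ (Euc d) := V.comap (embedL d) with hV0
  -- Subtracting a multiple of `e` removes the vertical coordinate without leaving `V`; since `e` is
  -- nearly vertical, this hardly moves the horizontal part.
  have hred : ∀ u ∈ V, horiz (u - (u (Fin.last d) / e (Fin.last d)) • e) ∈ V0 := by
    intro u hu
    have hlast : (u - (u (Fin.last d) / e (Fin.last d)) • e) (Fin.last d) = 0 := by
      simp only [PiLp.sub_apply, PiLp.smul_apply, smul_eq_mul]
      field_simp
      ring
    rw [hV0, Submodule.mem_comap, embedL_horiz hlast]
    exact V.sub_mem hu (V.smul_mem _ he)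
  have hredn : ∀ u : Euc (d + 1), ‖(u (Fin.last d) / e (Fin.last d)) • horiz e‖ ≤
      1 / 20 * |u (Fin.last d)| := by
    intro u
    rw [norm_smul, Real.norm_eq_abs, abs_div, abs_of_pos (by linarith : 0 < e (Fin.last d)),
      div_mul_eq_mul_div, div_le_iff₀ (by linarith)]
    nlinarith [abs_nonneg (u (Fin.last d)), mul_le_mul_of_nonneg_left heh
      (abs_nonneg (u (Fin.last d))), mul_le_mul_of_nonneg_left hen0 (abs_nonneg (u (Fin.last d)))]
  -- The vertical coordinate does not vanish on `V`, because of `e`, and its kernel is `V0`. This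
  -- shift by one matches the dimension bounds for `V0` in `ℝ^d` with `μ` in `ℝ^{d+1}`.
  have hVfin : finrank ℝ V = finrank ℝ V0 + 1 := by
    set L : V →ₗ[ℝ] ℝ := EuclideanSpace.projₗ (𝕜 := ℝ) (Fin.last d) ∘ₗ V.subtype with hL
    have hsurj : LinearMap.range L = ⊤ := by
      rw [LinearMap.range_eq_top]
      refine LinearMap.surjective fun h0 => ?_
      have h1 : L ⟨e, he⟩ = 0 := by rw [h0]; rfl
      have h2 : e (Fin.last d) = 0 := h1
      linarith
    have hmap : (LinearMap.ker L).map V.subtype = V0.map (embedL d) := by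
      ext x
      simp only [Submodule.mem_map, LinearMap.mem_ker, hV0, Submodule.mem_comap]
      constructor
      · rintro ⟨⟨v, hv⟩, h0, rfl⟩
        have h1 : embedL d (horiz v) = v := embedL_horiz h0
        exact ⟨horiz v, by rwa [h1], h1⟩
      · rintro ⟨y, hy, rfl⟩
        exact ⟨⟨embedL d y, hy⟩, embedL_last y, rfl⟩
    have hker : finrank ℝ (LinearMap.ker L) = finrank ℝ V0 := by
      rw [← Submodule.finrank_map_subtype_eq V (LinearMap.ker L), hmap,
        (Submodule.equivMapOfInjective (embedL d) embedL_injective V0).finrank_eq]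
    have := LinearMap.finrank_range_add_finrank_ker L
    rw [hsurj, finrank_top, finrank_self, hker] at this
    omega
  obtain ⟨Y, hYQ, hYV, hdim1, hdim2⟩ := exists_transverse_subspace hσ Q hQJ V0
  have hYfin : finrank ℝ (Y.map (embedL d)) = finrank ℝ Y :=
    (Submodule.equivMapOfInjective (embedL d) embedL_injective Y).finrank_eq.symm
  refine ⟨Y.map (embedL d), ?_, ?_, ?_, ?_, ?_⟩
  · rw [hYfin, hVfin, muDim]
    push_cast
    omega
  · have hdisj : Disjoint Y V0 := by
      rw [Submodule.disjoint_def]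
      intro y hy hy'
      have := hYV y hy y hy'
      rw [sub_self, norm_zero] at this
      exact norm_le_zero_iff.1 (by linarith)
    have := Submodule.finrank_add_finrank_le_of_disjoint hdisj
    rw [finrank_euclideanSpace_fin] at this
    rw [hYfin, hVfin]
    push_cast
    omega
  · rintro v hv _ ⟨y, hy, rfl⟩ hv0 hy0
    refine le_angle_of_forall_le_norm_sub hy0 hv0 fun t => ?_
    set u := t • v with hu
    have huV : u ∈ V := V.smul_mem t hv
    rw [norm_embedL]
    -- Transversality to `V0` passes to `V`: the reduction costs at most `1/20` of the vertical
    -- coordinate of `u`, which is itself at most the distance from `y` to `u`.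
    have h1 := hYV y hy _ (hred u huV)
    have h2 : ‖y - horiz (u - (u (Fin.last d) / e (Fin.last d)) • e)‖ ≤
        ‖y - horiz u‖ + 1 / 20 * |u (Fin.last d)| := by
      have h3 : y - horiz (u - (u (Fin.last d) / e (Fin.last d)) • e) =
          (y - horiz u) + (u (Fin.last d) / e (Fin.last d)) • horiz e := by
        rw [horiz_sub, horiz_smul]
        abel
      rw [h3]
      exact (norm_add_le _ _).trans (by linarith [hredn u])
    have h4 : ‖y - horiz u‖ ≤ ‖embedL d y - u‖ := by
      have := norm_horiz_le (embedL d y - u)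
      rwa [horiz_sub, horiz_embedL] at this
    have h5 : |u (Fin.last d)| ≤ ‖embedL d y - u‖ := by
      have := Euc.abs_apply_le (embedL d y - u) (Fin.last d)
      rwa [PiLp.sub_apply, embedL_last, zero_sub, abs_neg] at this
    linarith [norm_nonneg (embedL d y - u)]
  · rintro _ ⟨y, _, rfl⟩
    exact embedL_last y
  · rintro q w η η' ⟨u, huV, hu1, hu2⟩ hw _ ⟨y, hy, rfl⟩
    rw [horiz_embedL, norm_embedL]
    set v := horiz (u - (u (Fin.last d) / e (Fin.last d)) • e) with hv
    have hqv : ‖q - v‖ ≤ 2 * η := by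
      have h1 : q - v = (q - horiz u) + (u (Fin.last d) / e (Fin.last d)) • horiz e := by
        rw [hv, horiz_sub, horiz_smul]
        abel
      rw [h1]
      refine (norm_add_le _ _).trans ?_
      rw [norm_sub_rev]
      linarith [hredn u, abs_nonneg (u (Fin.last d))]
    -- Solve for `w`. The main term `T (N v)` with `v ∈ V0` is orthogonal to `N y` by the choice of
    -- `Y`; the other two are errors of size `η'` and `η`.
    have hwT : w = T (N q + S w) - T (N (q - v)) - T (N v) := by
      rw [map_sub N, map_sub T, map_add T, hTS]
      abel
    have hzero : inner ℝ (N y) (T (N v)) = 0 := by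
      rw [← hQapp]
      exact hYQ y hy v (hred u huV)
    have h1 : |inner ℝ (N y) (T (N q + S w))| ≤ ‖N y‖ * ‖T (N q + S w)‖ :=
      abs_real_inner_le_norm _ _
    have h2 : |inner ℝ (N y) (T (N (q - v)))| ≤ ‖N y‖ * ‖T (N (q - v))‖ :=
      abs_real_inner_le_norm _ _
    have h3 : ‖T (N q + S w)‖ ≤ 2 * η' := by linarith [hTle (N q + S w), norm_nonneg (N q + S w)]
    have h4 : ‖T (N (q - v))‖ ≤ 3 * η := by
      linarith [hTle (N (q - v)), hNle (q - v), norm_nonneg (q - v)]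
    have h5 : ‖N y‖ ≤ 2 * ‖y‖ := by linarith [hNle y, norm_nonneg y]
    rw [hwT, inner_sub_right, inner_sub_right, hzero, sub_zero]
    calc |inner ℝ (N y) (T (N q + S w)) - inner ℝ (N y) (T (N (q - v)))|
        ≤ |inner ℝ (N y) (T (N q + S w))| + |inner ℝ (N y) (T (N (q - v)))| := abs_sub _ _
      _ ≤ 2 * ‖y‖ * (2 * η') + 2 * ‖y‖ * (3 * η) := by
          refine add_le_add (h1.trans ?_) (h2.trans ?_)
          · exact mul_le_mul h5 h3 (norm_nonneg _) (by positivity)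
          · exact mul_le_mul h5 h4 (norm_nonneg _) (by positivity)
      _ ≤ 10 * (η + η') * ‖y‖ := by
          have : 0 ≤ η := (norm_nonneg _).trans hu1
          have : 0 ≤ η' := (norm_nonneg _).trans hw
          nlinarith [norm_nonneg y, mul_nonneg this (norm_nonneg y),
            mul_nonneg ‹0 ≤ η› (norm_nonneg y)]

end Transverse

/-! ### Geometry of reduced phases -/

section ReducedPhase

variable {d σ : ℕ} {cex : ℝ} {Nex : ℕ} {rX rN rW : ℝ} {φ : Euc (d + 1) → Euc d → ℝ}

theorem toEuclideanCLM_apply_eq_sum (M : Matrix (Fin d) (Fin d) ℝ) (v : Euc d) (i : Fin d) :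
    Matrix.toEuclideanCLM (𝕜 := ℝ) M v i = ∑ j, M i j * v j := rfl

theorem abs_apply_le_opNorm (M : Matrix (Fin d) (Fin d) ℝ) (i j : Fin d) : |M i j| ≤ opNorm M := by
  have h1 : Matrix.toEuclideanCLM (𝕜 := ℝ) M (EuclideanSpace.single j 1) i = M i j := by
    rw [toEuclideanCLM_apply_eq_sum]
    simp
  calc |M i j| ≤ ‖Matrix.toEuclideanCLM (𝕜 := ℝ) M (EuclideanSpace.single j 1)‖ := by
        rw [← h1]; exact Euc.abs_apply_le _ i
    _ ≤ opNorm M * ‖(EuclideanSpace.single j (1 : ℝ) : Euc d)‖ :=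
        ContinuousLinearMap.le_opNorm _ _
    _ = opNorm M := by simp

theorem opNorm_transpose (M : Matrix (Fin d) (Fin d) ℝ) : opNorm M.transpose = opNorm M := by
  have h : M.transpose = star M := by
    rw [Matrix.star_eq_conjTranspose]
    ext i j
    simp
  rw [opNorm, opNorm, h, map_star, ContinuousLinearMap.star_eq_adjoint,
    LinearIsometryEquiv.norm_map]

theorem isOpen_freqBall (d : ℕ) (rW : ℝ) : IsOpen (freqBall d rW) := isOpen_ball

theorem convex_freqBall (d : ℕ) (rW : ℝ) : Convex ℝ (freqBall d rW) := convex_ball _ _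

/-- Joint smoothness comes from the normal form; the quantitative information is read off the
derivative bounds. -/
theorem IsReducedPhase.smoothOn (hφ : IsReducedPhase d σ cex Nex rX rN rW φ) :
    SmoothOn φ (spaceBox d rX rN) (freqBall d rW) := by
  obtain ⟨h, E, hh, hE, -, -, -, hform⟩ := hφ.form
  have h1 : ContDiff ℝ ((⊤ : ℕ∞) : WithTop ℕ∞)
      (fun p : Euc (d + 1) × Euc d => inner ℝ (horiz p.1) p.2) :=
    (contDiff_horiz.comp contDiff_fst).inner ℝ contDiff_snd
  have h2 : ContDiffOn ℝ ((⊤ : ℕ∞) : WithTop ℕ∞)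
      (fun p : Euc (d + 1) × Euc d => h p.2) (spaceBox d rX rN ×ˢ freqBall d rW) :=
    hh.comp contDiff_snd.contDiffOn fun p hp => hp.2
  have h3 : ContDiff ℝ ((⊤ : ℕ∞) : WithTop ℕ∞)
      (fun p : Euc (d + 1) × Euc d => p.1 (Fin.last d)) := by fun_prop
  exact ((h1.contDiffOn.add (h3.contDiffOn.mul h2)).add hE).congr fun p hp =>
    hform p.1 hp.1 p.2 hp.2

/-- Cofactor expansion: the sum is the determinant whose last row repeats the `j`-th one. Thus the
Gauss map is normal to the hypersurface. -/
theorem sum_dW_mul_gaussZero (φ : Euc (d + 1) → Euc d → ℝ) (x : Euc (d + 1)) (ω : Euc d)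
    (j : Fin d) : ∑ k, dW j (dX k φ) x ω * gaussZero φ x ω k = 0 := by
  set A : Matrix (Fin (d + 1)) (Fin (d + 1)) ℝ := Matrix.of
    (Fin.snoc (α := fun _ => Fin (d + 1) → ℝ) (fun j k => dW j (dX k φ) x ω) 0) with hA
  have hrow : ∀ v : Fin (d + 1) → ℝ, Matrix.of
      (Fin.snoc (α := fun _ => Fin (d + 1) → ℝ) (fun j k => dW j (dX k φ) x ω) v) =
        A.updateRow (Fin.last d) v := by
    intro v
    ext a b
    refine Fin.lastCases ?_ (fun a => ?_) a
    · simp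
    · rw [Matrix.updateRow_ne (Fin.castSucc_lt_last a).ne]
      simp [hA]
  have hlin : ∀ v : Fin (d + 1) → ℝ, (A.updateRow (Fin.last d) v).det =
      ∑ k, v k * (A.updateRow (Fin.last d) (Pi.single k 1)).det := by
    intro v
    refine (LinearMap.pi_apply_eq_sum_univ
      (Matrix.detRowAlternating.toMultilinearMap.toLinearMap A (Fin.last d)) v).trans ?_
    refine Finset.sum_congr rfl fun k _ => ?_
    have : (fun j => if k = j then (1 : ℝ) else 0) = Pi.single k 1 := by
      ext j
      simp [Pi.single_apply, eq_comm]
    rw [this]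
    rfl
  have hz : ∀ k, gaussZero φ x ω k = (A.updateRow (Fin.last d) (Pi.single k 1)).det := by
    intro k
    rw [← hrow]
    rfl
  simp_rw [hz]
  rw [← hlin]
  refine Matrix.det_zero_of_row_eq (Fin.castSucc_lt_last j).ne ?_
  rw [Matrix.updateRow_self, Matrix.updateRow_ne (Fin.castSucc_lt_last j).ne]
  ext k
  simp [hA]

/-- The matrix `∂²_{ωx'} φ`. -/
def mixedMat (φ : Euc (d + 1) → Euc d → ℝ) (x : Euc (d + 1)) (ω : Euc d) :
    Matrix (Fin d) (Fin d) ℝ :=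
  Matrix.of fun i j => dW i (dX j.castSucc φ) x ω

/-- The matrix `∂²_{ωω} ∂_{x_k} φ`. -/
def curvMat (φ : Euc (d + 1) → Euc d → ℝ) (k : Fin (d + 1)) (x : Euc (d + 1)) (ω : Euc d) :
    Matrix (Fin d) (Fin d) ℝ :=
  Matrix.of fun i j => dW i (dW j (dX k φ)) x ω

theorem IsReducedPhase.norm_mixed_sub_one_le (hφ : IsReducedPhase d σ cex Nex rX rN rW φ)
    {x : Euc (d + 1)} {ω : Euc d} (hx : x ∈ spaceBox d rX rN) (hω : ω ∈ freqBall d rW) :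
    ‖Matrix.toEuclideanCLM (𝕜 := ℝ) (mixedMat φ x ω) - 1‖ ≤ cex := by
  have := (hφ.mixed_hessian x hx ω hω).le
  rwa [opNorm, map_sub, map_one] at this

theorem abs_one_apply_le (i j : Fin d) : |(1 : Matrix (Fin d) (Fin d) ℝ) i j| ≤ 1 := by
  rw [Matrix.one_apply]
  split_ifs <;> simp

theorem abs_signMatrix_apply_le (i j : Fin d) : |signMatrix d σ i j| ≤ 1 := by
  rw [signMatrix, Matrix.diagonal_apply]
  split_ifs <;> simp

theorem IsReducedPhase.abs_dW_dX_le (hφ : IsReducedPhase d σ cex Nex rX rN rW φ) (hc : cex ≤ 1)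
    {x : Euc (d + 1)} {ω : Euc d} (hx : x ∈ spaceBox d rX rN) (hω : ω ∈ freqBall d rW)
    (j : Fin d) (k : Fin (d + 1)) : |dW j (dX k φ) x ω| ≤ 2 := by
  refine Fin.lastCases ?_ (fun k => ?_) k
  · have := (Euc.abs_apply_le _ j).trans (hφ.vertical x hx ω hω).le
    exact this.trans (by linarith)
  · have h1 := (abs_apply_le_opNorm _ j k).trans (hφ.mixed_hessian x hx ω hω).le
    rw [Matrix.sub_apply, Matrix.of_apply] at h1
    have h2 := abs_sub_abs_le_abs_sub (dW j (dX k.castSucc φ) x ω)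
      ((1 : Matrix (Fin d) (Fin d) ℝ) j k)
    linarith [abs_one_apply_le j k]

theorem IsReducedPhase.abs_curvMat_le (hφ : IsReducedPhase d σ cex Nex rX rN rW φ) (hc : cex ≤ 1)
    {x : Euc (d + 1)} {ω : Euc d} (hx : x ∈ spaceBox d rX rN) (hω : ω ∈ freqBall d rW)
    (i j : Fin d) (k : Fin (d + 1)) : |dW i (dW j (dX k φ)) x ω| ≤ 2 := by
  have h1 := (abs_apply_le_opNorm _ i j).trans (hφ.curvature x hx ω hω k).le
  rw [Matrix.sub_apply, Matrix.of_apply] at h1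
  have h2 := abs_sub_abs_le_abs_sub (dW i (dW j (dX k φ)) x ω)
    ((if k = Fin.last d then signMatrix d σ else 0) i j)
  have h3 : |(if k = Fin.last d then signMatrix d σ else 0) i j| ≤ 1 := by
    split_ifs
    · exact abs_signMatrix_apply_le i j
    · simp
  linarith

theorem IsReducedPhase.abs_third_le (hφ : IsReducedPhase d σ cex Nex rX rN rW φ) (hc : cex ≤ 1)
    (hN : 3 ≤ Nex) {x : Euc (d + 1)} {ω : Euc d} (hx : x ∈ spaceBox d rX rN)
    (hω : ω ∈ freqBall d rW) (i j l : Fin d) (k : Fin (d + 1)) :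
    |dW i (dW j (dW l (dX k φ))) x ω| ≤ 1 :=
  (hφ.higher [k] [i, j, l] (by simp; omega) (by simpa using hN) (Or.inl (by simp))
    x hx ω hω).le.trans hc

theorem IsReducedPhase.abs_dX_dX_le (hφ : IsReducedPhase d σ cex Nex rX rN rW φ) (hc : cex ≤ 1)
    (hN : 3 ≤ Nex) {x : Euc (d + 1)} {ω : Euc d} (hx : x ∈ spaceBox d rX rN)
    (hω : ω ∈ freqBall d rW) (i k : Fin (d + 1)) : |dX i (dX k φ) x ω| ≤ 1 :=
  (hφ.higher [i, k] [] (by simp; omega) (by simp) (Or.inr (by simp)) x hx ω hω).le.trans hc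

/-- If the Gauss map at `(x; ω)` is close to `V`, then so is the normal vector `(γ, 1)`. -/
theorem IsReducedPhase.exists_normal (hφ : IsReducedPhase d σ cex Nex rX rN rW φ)
    (hc : cex ≤ 1 / 100) {lam : ℝ} {xbar : Euc (d + 1)} {ω : Euc d}
    (hx : lam⁻¹ • xbar ∈ spaceBox d rX rN) (hω : ω ∈ freqBall d rW)
    {V : Submodule ℝ (Euc (d + 1))} {ε : ℝ} (hε : ε ≤ 1)
    (hang : AngleToLE (gaussL φ lam xbar ω) V ε) :
    ∃ γ : Euc d, ‖γ‖ ≤ 2 * cex ∧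
      (∀ j, ∑ k : Fin d, dW j (dX k.castSucc φ) (lam⁻¹ • xbar) ω * γ k
        + dW j (dX (Fin.last d) φ) (lam⁻¹ • xbar) ω = 0) ∧
      ∃ u ∈ V, ‖horiz u - γ‖ ≤ 2 * ε ∧ |u (Fin.last d) - 1| ≤ 2 * ε := by
  set z := lam⁻¹ • xbar with hz
  set G := gaussL φ lam xbar ω with hG
  obtain ⟨v, hvV, hv0, hang⟩ := hang
  have hGorth : ∀ j, ∑ k, dW j (dX k φ) z ω * G k = 0 := by
    intro j
    have h1 : ∀ k, dW j (dX k φ) z ω * G k =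
        ‖gaussZero φ z ω‖⁻¹ * (dW j (dX k φ) z ω * gaussZero φ z ω k) := by
      intro k
      have : G k = ‖gaussZero φ z ω‖⁻¹ * gaussZero φ z ω k := rfl
      rw [this]; ring
    simp_rw [h1]
    rw [← Finset.mul_sum, sum_dW_mul_gaussZero, mul_zero]
  -- A zero vector makes angle `π/2` with everything, which exceeds `ε ≤ 1`.
  have hG0 : gaussZero φ z ω ≠ 0 := by
    intro h0
    have h1 : G = 0 := by rw [hG, gaussL, ← hz, h0, smul_zero]
    rw [h1, InnerProductGeometry.angle_zero_left] at hang
    linarith [Real.pi_gt_three]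
  have hG1 : ‖G‖ = 1 := by
    rw [hG, gaussL, ← hz, norm_smul, norm_inv, norm_norm, inv_mul_cancel₀ (norm_ne_zero_iff.2 hG0)]
  set g := G (Fin.last d) with hg
  -- The orthogonality relations express `N` applied to the horizontal part of `G` through its
  -- vertical component `g`. Hence the horizontal part is `O(cex |g|)`, `|g| ≥ 1/2`, and `G` may be
  -- divided by `g`.
  have hNG : ‖Matrix.toEuclideanCLM (𝕜 := ℝ) (mixedMat φ z ω) (horiz G)‖ ≤ cex * |g| := by
    have h1 : Matrix.toEuclideanCLM (𝕜 := ℝ) (mixedMat φ z ω) (horiz G) =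
        -(g • (WithLp.toLp 2 fun j : Fin d => dW j (dX (Fin.last d) φ) z ω : Euc d)) := by
      ext j
      have h2 := hGorth j
      rw [Fin.sum_univ_castSucc] at h2
      have h3 : Matrix.toEuclideanCLM (𝕜 := ℝ) (mixedMat φ z ω) (horiz G) j =
        ∑ k : Fin d, dW j (dX k.castSucc φ) z ω * G k.castSucc := rfl
      rw [h3, PiLp.neg_apply, PiLp.smul_apply, smul_eq_mul]
      linarith
    rw [h1, norm_neg, norm_smul, Real.norm_eq_abs, mul_comm]
    exact mul_le_mul_of_nonneg_right (hφ.vertical z hx ω hω).le (abs_nonneg _)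
  have hhG : ‖horiz G‖ ≤ 2 * cex * |g| := by
    have h1 : ‖horiz G - Matrix.toEuclideanCLM (𝕜 := ℝ) (mixedMat φ z ω) (horiz G)‖ ≤
        cex * ‖horiz G‖ := by
      rw [norm_sub_rev]
      exact ((Matrix.toEuclideanCLM (𝕜 := ℝ) (mixedMat φ z ω) - 1).le_opNorm _).trans
        (mul_le_mul_of_nonneg_right (hφ.norm_mixed_sub_one_le hx hω) (norm_nonneg _))
    have h2 := norm_add_le (horiz G - Matrix.toEuclideanCLM (𝕜 := ℝ) (mixedMat φ z ω) (horiz G))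
      (Matrix.toEuclideanCLM (𝕜 := ℝ) (mixedMat φ z ω) (horiz G))
    rw [sub_add_cancel] at h2
    nlinarith [norm_nonneg (horiz G)]
  have hghalf : 1 / 2 ≤ |g| := by
    have h1 := norm_sq_eq_horiz G
    rw [hG1, ← hg, ← sq_abs g] at h1
    have h2 : ‖horiz G‖ ≤ |g| := hhG.trans (by nlinarith [abs_nonneg g])
    nlinarith [norm_nonneg (horiz G), abs_nonneg g]
  have hg0 : g ≠ 0 := fun h => by rw [h, abs_zero] at hghalf; linarith
  have hginv : |g⁻¹| ≤ 2 := by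
    rw [abs_inv, inv_le_comm₀ (by linarith) (by norm_num)]
    linarith
  refine ⟨g⁻¹ • horiz G, ?_, ?_, ?_⟩
  · rw [norm_smul, Real.norm_eq_abs, abs_inv, inv_mul_le_iff₀ (by linarith)]
    linarith
  · intro j
    have h2 := hGorth j
    rw [Fin.sum_univ_castSucc] at h2
    have h3 : ∀ k : Fin d, dW j (dX k.castSucc φ) z ω * (g⁻¹ • horiz G) k =
        g⁻¹ * (dW j (dX k.castSucc φ) z ω * G k.castSucc) := fun k => by
      have : (g⁻¹ • horiz G) k = g⁻¹ * G k.castSucc := rfl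
      rw [this]; ring
    simp_rw [h3]
    rw [← Finset.mul_sum, eq_neg_of_add_eq_zero_left h2, ← hg]
    field_simp
    ring
  · obtain ⟨t, ht⟩ := exists_norm_sub_smul_le_of_angle_le hv0 hang
    rw [hG1, mul_one] at ht
    refine ⟨g⁻¹ • t • v, V.smul_mem _ (V.smul_mem _ hvV), ?_, ?_⟩
    · rw [horiz_smul, ← smul_sub, norm_smul, ← horiz_sub, Real.norm_eq_abs]
      refine mul_le_mul hginv ((norm_horiz_le _).trans ?_) (norm_nonneg _) (by norm_num)
      rwa [norm_sub_rev]
    · have h1 : (g⁻¹ • t • v) (Fin.last d) - 1 = g⁻¹ * (t • v - G) (Fin.last d) := by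
        rw [PiLp.smul_apply, PiLp.sub_apply, ← hg, smul_eq_mul, mul_sub, inv_mul_cancel₀ hg0]
      rw [h1, abs_mul]
      refine mul_le_mul hginv ((Euc.abs_apply_le _ _).trans ?_) (abs_nonneg _) (by norm_num)
      rwa [norm_sub_rev]

end ReducedPhase

/-! ### The second fundamental form and the variation of the normal. -/

section ReducedPhase

variable {d σ : ℕ} {cex : ℝ} {Nex : ℕ} {rX rN rW : ℝ} {φ : Euc (d + 1) → Euc d → ℝ}

/-- The second fundamental form of `ω ↦ ∂_x φ(x;ω)` in the normal direction `(γ, 1)`. -/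
def secondForm (φ : Euc (d + 1) → Euc d → ℝ) (x : Euc (d + 1)) (ω γ : Euc d) :
    Euc d →L[ℝ] Euc d :=
  Matrix.toEuclideanCLM (𝕜 := ℝ) (curvMat φ (Fin.last d) x ω).transpose +
    ∑ k : Fin d, γ k • Matrix.toEuclideanCLM (𝕜 := ℝ) (curvMat φ k.castSucc x ω).transpose

/-- The transposes make the contraction run over the outer derivative, so this is literally the
linear term in the Taylor expansion of the normal equations; symmetry of second derivatives is not
needed. -/
theorem secondForm_apply (x : Euc (d + 1)) (ω γ w : Euc d) (j : Fin d) :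
    secondForm φ x ω γ w j = ∑ i, w i * dW i (dW j (dX (Fin.last d) φ)) x ω +
      ∑ k : Fin d, γ k * ∑ i, w i * dW i (dW j (dX k.castSucc φ)) x ω := by
  have h1 : ∀ k, Matrix.toEuclideanCLM (𝕜 := ℝ) (curvMat φ k x ω).transpose w j =
      ∑ i, w i * dW i (dW j (dX k φ)) x ω := fun k => by
    rw [toEuclideanCLM_apply_eq_sum]
    exact Finset.sum_congr rfl fun i _ => mul_comm _ _
  have h2 : secondForm φ x ω γ w =
      Matrix.toEuclideanCLM (𝕜 := ℝ) (curvMat φ (Fin.last d) x ω).transpose w +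
      ∑ k : Fin d, γ k •
        Matrix.toEuclideanCLM (𝕜 := ℝ) (curvMat φ k.castSucc x ω).transpose w := by
    simp [secondForm]
  rw [h2, PiLp.add_apply, h1]
  congr 1
  rw [WithLp.ofLp_sum, Finset.sum_apply]
  refine Finset.sum_congr rfl fun k _ => ?_
  rw [PiLp.smul_apply, h1, smul_eq_mul]

/-- The vertical term and each of the `d` horizontal terms, weighted by `|γ k| ≤ 1`, err by at most
`cex`. -/
theorem IsReducedPhase.norm_secondForm_sub_le (hφ : IsReducedPhase d σ cex Nex rX rN rW φ)
    {x : Euc (d + 1)} {ω γ : Euc d} (hx : x ∈ spaceBox d rX rN)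
    (hω : ω ∈ freqBall d rW) (hγ : ‖γ‖ ≤ 1) :
    ‖secondForm φ x ω γ - Matrix.toEuclideanCLM (𝕜 := ℝ) (signMatrix d σ)‖ ≤ (d + 1) * cex := by
  have h1 : ‖Matrix.toEuclideanCLM (𝕜 := ℝ) (curvMat φ (Fin.last d) x ω).transpose -
      Matrix.toEuclideanCLM (𝕜 := ℝ) (signMatrix d σ)‖ ≤ cex := by
    have h2 := (hφ.curvature x hx ω hω (Fin.last d)).le
    have hdiag : (signMatrix d σ).transpose = signMatrix d σ := Matrix.diagonal_transpose _
    rw [if_pos rfl, ← opNorm_transpose, Matrix.transpose_sub, hdiag, opNorm, map_sub] at h2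
    exact h2
  have h2 : ∀ k : Fin d, ‖γ k • Matrix.toEuclideanCLM (𝕜 := ℝ)
      (curvMat φ k.castSucc x ω).transpose‖ ≤ cex := by
    intro k
    have h3 := (hφ.curvature x hx ω hω k.castSucc).le
    rw [if_neg (Fin.castSucc_lt_last k).ne, ← opNorm_transpose, sub_zero, opNorm] at h3
    rw [norm_smul, Real.norm_eq_abs]
    exact (mul_le_of_le_one_left (norm_nonneg _) ((Euc.abs_apply_le γ k).trans hγ)).trans h3
  have h3 : secondForm φ x ω γ - Matrix.toEuclideanCLM (𝕜 := ℝ) (signMatrix d σ) =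
      (Matrix.toEuclideanCLM (𝕜 := ℝ) (curvMat φ (Fin.last d) x ω).transpose -
        Matrix.toEuclideanCLM (𝕜 := ℝ) (signMatrix d σ)) +
      ∑ k : Fin d, γ k • Matrix.toEuclideanCLM (𝕜 := ℝ) (curvMat φ k.castSucc x ω).transpose := by
    rw [secondForm]
    abel
  rw [h3]
  refine (norm_add_le _ _).trans ?_
  have h4 : ‖∑ k : Fin d, γ k • Matrix.toEuclideanCLM (𝕜 := ℝ)
      (curvMat φ k.castSucc x ω).transpose‖ ≤ ∑ _k : Fin d, cex :=
    norm_sum_le_of_le _ fun k _ => h2 k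
  rw [Finset.sum_const, Finset.card_univ, Fintype.card_fin, nsmul_eq_mul] at h4
  linarith

theorem Euc.norm_le_of_forall_abs_le {n : ℕ} {x : Euc n} {C : ℝ} (h : ∀ i, |x i| ≤ C) :
    ‖x‖ ≤ n * C := by
  refine (Euc.norm_le_sum_abs x).trans ((Finset.sum_le_sum fun i _ => h i).trans ?_)
  simp

/-- First-order variation of the normal vector. -/
theorem IsReducedPhase.norm_normal_variation_le (hφ : IsReducedPhase d σ cex Nex rX rN rW φ)
    (hc : cex ≤ 1 / 100) (hN : 3 ≤ Nex) {x : Euc (d + 1)} {ω₀ ω₁ γ₀ γ₁ : Euc d}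
    (hx : x ∈ spaceBox d rX rN) (h₀ : ω₀ ∈ freqBall d rW) (h₁ : ω₁ ∈ freqBall d rW)
    (hγ₁ : ‖γ₁‖ ≤ 1)
    (heq₀ : ∀ j, ∑ k : Fin d, dW j (dX k.castSucc φ) x ω₀ * γ₀ k
        + dW j (dX (Fin.last d) φ) x ω₀ = 0)
    (heq₁ : ∀ j, ∑ k : Fin d, dW j (dX k.castSucc φ) x ω₁ * γ₁ k
        + dW j (dX (Fin.last d) φ) x ω₁ = 0) :
    ‖Matrix.toEuclideanCLM (𝕜 := ℝ) (mixedMat φ x ω₀) (γ₁ - γ₀) +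
      secondForm φ x ω₀ γ₀ (ω₁ - ω₀)‖ ≤ 9 * (d + 1) ^ 4 * (∑ j, |(ω₁ - ω₀) j|) ^ 2 := by
  have hc1 : cex ≤ 1 := by linarith
  have hU := isOpen_spaceBox (d := d) rX rN
  have hW := isOpen_freqBall d rW
  have hWc := convex_freqBall d rW
  have hsm := hφ.smoothOn
  set s := ∑ j, |(ω₁ - ω₀) j| with hs
  have hs0 : 0 ≤ s := Finset.sum_nonneg fun j _ => abs_nonneg _
  set p := fun (k : Fin (d + 1)) (j : Fin d) (ω : Euc d) => dW j (dX k φ) x ω with hp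
  have hlip : ∀ k j, |p k j ω₁ - p k j ω₀| ≤ 2 * s := fun k j =>
    ((hsm.smoothOn_dX hU hW k).smoothOn_dW hU hW j).abs_sub_le_right hU hW hWc hx
      (fun i ω hω => hφ.abs_curvMat_le hc1 hx hω i j k) h₀ h₁
  have htay : ∀ k j, |p k j ω₁ - p k j ω₀ -
      ∑ i, (ω₁ - ω₀) i * dW i (dW j (dX k φ)) x ω₀| ≤ s ^ 2 := fun k j => by
    have := ((hsm.smoothOn_dX hU hW k).smoothOn_dW hU hW j).abs_sub_sub_le_right hU hW hWc hx
      (C := 1) (by norm_num) (fun i l ω hω => hφ.abs_third_le hc1 hN hx hω i l j k) h₀ h₁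
    rwa [one_mul] at this
  set N := Matrix.toEuclideanCLM (𝕜 := ℝ) (mixedMat φ x ω₀) with hNdef
  have hNapp : ∀ (v : Euc d) j, N v j = ∑ k : Fin d, p k.castSucc j ω₀ * v k := fun v j => rfl
  have hγ₁k : ∀ k, |γ₁ k| ≤ 1 := fun k => (Euc.abs_apply_le γ₁ k).trans hγ₁
  -- A linear bound first: it makes the cross term of `γ₁ - γ₀` with the increment of the
  -- coefficients quadratic below.
  have hq : ‖γ₁ - γ₀‖ ≤ 4 * (d + 1) ^ 2 * s := by
    have h1 : ∀ j, |N (γ₁ - γ₀) j| ≤ 2 * (d + 1) * s := by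
      intro j
      have h2 : N (γ₁ - γ₀) j = -(∑ k : Fin d, (p k.castSucc j ω₁ - p k.castSucc j ω₀) * γ₁ k
          + (p (Fin.last d) j ω₁ - p (Fin.last d) j ω₀)) := by
        rw [map_sub, PiLp.sub_apply, hNapp, hNapp]
        simp_rw [sub_mul]
        rw [Finset.sum_sub_distrib]
        linarith [heq₀ j, heq₁ j]
      rw [h2, abs_neg]
      refine (abs_add_le _ _).trans ?_
      have h3 : |∑ k : Fin d, (p k.castSucc j ω₁ - p k.castSucc j ω₀) * γ₁ k| ≤
          ∑ _k : Fin d, 2 * s := by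
        refine Finset.abs_sum_le_sum_abs _ _ |>.trans (Finset.sum_le_sum fun k _ => ?_)
        rw [abs_mul]
        exact (mul_le_of_le_one_right (abs_nonneg _) (hγ₁k k)).trans (hlip _ j)
      rw [Finset.sum_const, Finset.card_univ, Fintype.card_fin, nsmul_eq_mul] at h3
      linarith [hlip (Fin.last d) j]
    have h2 := Euc.norm_le_of_forall_abs_le h1
    have h3 : ‖(γ₁ - γ₀) - N (γ₁ - γ₀)‖ ≤ 1 / 100 * ‖γ₁ - γ₀‖ := by
      rw [norm_sub_rev]
      exact ((N - 1).le_opNorm _).trans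
        (mul_le_mul_of_nonneg_right ((hφ.norm_mixed_sub_one_le hx h₀).trans hc) (norm_nonneg _))
    have h4 := norm_add_le ((γ₁ - γ₀) - N (γ₁ - γ₀)) (N (γ₁ - γ₀))
    rw [sub_add_cancel] at h4
    have h5 : (d : ℝ) * (2 * (d + 1) * s) ≤ 2 * (d + 1) ^ 2 * s := by
      have : 0 ≤ ((d : ℝ) + 1) * s := by positivity
      nlinarith
    linarith [norm_nonneg (γ₁ - γ₀)]
  have hcoord : ∀ j, |(N (γ₁ - γ₀) + secondForm φ x ω₀ γ₀ (ω₁ - ω₀)) j| ≤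
      9 * (d + 1) ^ 3 * s ^ 2 := by
    intro j
    set c := fun k : Fin (d + 1) => ∑ i, (ω₁ - ω₀) i * dW i (dW j (dX k φ)) x ω₀ with hcdef
    have hcb : ∀ k, |c k| ≤ 2 * s := by
      intro k
      rw [hs, Finset.mul_sum]
      refine Finset.abs_sum_le_sum_abs _ _ |>.trans (Finset.sum_le_sum fun i _ => ?_)
      rw [abs_mul, mul_comm]
      exact mul_le_mul_of_nonneg_right (hφ.abs_curvMat_le hc1 hx h₀ i j k) (abs_nonneg _)
    -- The difference of the two normal equations, arranged exactly: what remains are second-order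
    -- Taylor remainders and the cross term.
    have h2 : (N (γ₁ - γ₀) + secondForm φ x ω₀ γ₀ (ω₁ - ω₀)) j =
        -(∑ k : Fin d, ((p k.castSucc j ω₁ - p k.castSucc j ω₀ - c k.castSucc) * γ₁ k
          + (γ₁ - γ₀) k * c k.castSucc)
          + (p (Fin.last d) j ω₁ - p (Fin.last d) j ω₀ - c (Fin.last d))) := by
      rw [PiLp.add_apply, map_sub, PiLp.sub_apply, hNapp, hNapp, secondForm_apply]
      have h3 : ∑ k : Fin d, ((p k.castSucc j ω₁ - p k.castSucc j ω₀ - c k.castSucc) * γ₁ k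
          + (γ₁ - γ₀) k * c k.castSucc) = ∑ k : Fin d, p k.castSucc j ω₁ * γ₁ k
          - ∑ k : Fin d, p k.castSucc j ω₀ * γ₁ k - ∑ k : Fin d, γ₀ k * c k.castSucc := by
        rw [← Finset.sum_sub_distrib, ← Finset.sum_sub_distrib]
        refine Finset.sum_congr rfl fun k _ => ?_
        rw [PiLp.sub_apply]
        ring
      rw [h3]
      linarith [heq₀ j, heq₁ j]
    rw [h2, abs_neg]
    refine (abs_add_le _ _).trans ?_
    have h3 : |∑ k : Fin d, ((p k.castSucc j ω₁ - p k.castSucc j ω₀ - c k.castSucc) * γ₁ k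
          + (γ₁ - γ₀) k * c k.castSucc)| ≤
        ∑ _k : Fin d, (s ^ 2 + 4 * (d + 1) ^ 2 * s * (2 * s)) := by
      refine Finset.abs_sum_le_sum_abs _ _ |>.trans (Finset.sum_le_sum fun k _ => ?_)
      refine (abs_add_le _ _).trans (add_le_add ?_ ?_)
      · rw [abs_mul]
        exact (mul_le_of_le_one_right (abs_nonneg _) (hγ₁k k)).trans (htay _ j)
      · rw [abs_mul]
        exact mul_le_mul ((Euc.abs_apply_le _ k).trans hq) (hcb _) (abs_nonneg _) (by positivity)
    rw [Finset.sum_const, Finset.card_univ, Fintype.card_fin, nsmul_eq_mul] at h3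
    have h4 := htay (Fin.last d) j
    have h5 : (d : ℝ) * (s ^ 2 + 4 * (d + 1) ^ 2 * s * (2 * s)) + s ^ 2 ≤
        9 * (d + 1) ^ 3 * s ^ 2 := by
      have h6 : (d : ℝ) * (1 + 8 * (d + 1) ^ 2) + 1 ≤ 9 * (d + 1) ^ 3 := by
        have hd : (0 : ℝ) ≤ d := Nat.cast_nonneg d
        nlinarith [mul_nonneg hd hd, mul_nonneg hd (mul_nonneg hd hd)]
      have := mul_le_mul_of_nonneg_right h6 (sq_nonneg s)
      linarith
    linarith
  refine (Euc.norm_le_of_forall_abs_le hcoord).trans ?_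
  have : 0 ≤ 9 * ((d : ℝ) + 1) ^ 3 * s ^ 2 := by positivity
  nlinarith

/-- Frequencies whose normal directions are close to `V` have almost the same spatial gradient in
the directions of a large subspace which is transverse to `V`. -/
theorem IsReducedPhase.exists_transverse (hφ : IsReducedPhase d σ cex Nex rX rN rW φ)
    (hσ : σ ≤ d) (hc0 : 0 ≤ cex) (hc : cex ≤ 1 / (100 * (d + 1))) (hN : 3 ≤ Nex)
    {lam : ℝ} {xbar : Euc (d + 1)} (hx : lam⁻¹ • xbar ∈ spaceBox d rX rN)
    {V : Submodule ℝ (Euc (d + 1))} {ε : ℝ} (hε : ε ≤ 1 / 100)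
    {ω₀ : Euc d} (h₀ : ω₀ ∈ freqBall d rW) (hang₀ : AngleToLE (gaussL φ lam xbar ω₀) V ε) :
    ∃ V' : Submodule ℝ (Euc (d + 1)),
      muDim (d + 1) σ (Module.finrank ℝ V) ≤ (Module.finrank ℝ V' : ℤ) ∧
      (Module.finrank ℝ V' : ℤ) ≤ ((d + 1 : ℕ) : ℤ) - (Module.finrank ℝ V : ℤ) ∧
      (∀ v ∈ V, ∀ v' ∈ V', v ≠ 0 → v' ≠ 0 → 1 / 4 ≤ InnerProductGeometry.angle v v') ∧
      ∀ ω₁ ∈ freqBall d rW, AngleToLE (gaussL φ lam xbar ω₁) V ε → ∀ v' ∈ V',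
        |∑ k, v' k * (dX k φ (lam⁻¹ • xbar) ω₁ - dX k φ (lam⁻¹ • xbar) ω₀)| ≤
          100 * (d + 1) ^ 6 * (ε + ‖ω₁ - ω₀‖ ^ 2) * ‖v'‖ := by
  have hd1 : (1 : ℝ) ≤ d + 1 := by linarith [(Nat.cast_nonneg d : (0 : ℝ) ≤ d)]
  have hcd : (d + 1) * cex ≤ 1 / 100 := by
    rw [le_div_iff₀ (by positivity)] at hc
    linarith
  have hc' : cex ≤ 1 / 100 := by nlinarith
  have hc1 : cex ≤ 1 := by linarith
  obtain ⟨γ₀, hγ₀, heq₀, u₀, hu₀V, hu₀h, hu₀n⟩ :=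
    hφ.exists_normal hc' hx h₀ (by linarith) hang₀
  set z := lam⁻¹ • xbar with hz
  have hu₀h' : ‖horiz u₀‖ ≤ 1 / 25 := by
    have := norm_add_le (horiz u₀ - γ₀) γ₀
    rw [sub_add_cancel] at this
    linarith
  obtain ⟨V', hdim, hdim', hang, hlast, hV'⟩ := exists_transverse_of_normal_near hσ
    (Matrix.toEuclideanCLM (𝕜 := ℝ) (mixedMat φ z ω₀)) (secondForm φ z ω₀ γ₀)
    ((hφ.norm_mixed_sub_one_le hx h₀).trans hc')
    ((hφ.norm_secondForm_sub_le hx h₀ (by linarith)).trans hcd) V hu₀V hu₀h' (by linarith)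
  refine ⟨V', hdim, hdim', hang, fun ω₁ h₁ hang₁ v' hv' => ?_⟩
  obtain ⟨γ₁, hγ₁, heq₁, u₁, hu₁V, hu₁h, hu₁n⟩ :=
    hφ.exists_normal hc' hx h₁ (by linarith) hang₁
  have hε0 : 0 ≤ ε := by linarith [norm_nonneg (horiz u₁ - γ₁)]
  set s := ∑ j, |(ω₁ - ω₀) j| with hs
  have hs0 : 0 ≤ s := Finset.sum_nonneg fun j _ => abs_nonneg _
  have hsw : s ^ 2 ≤ (d + 1) ^ 2 * ‖ω₁ - ω₀‖ ^ 2 := by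
    rw [← mul_pow]
    refine pow_le_pow_left₀ hs0 ((Euc.sum_abs_le _).trans ?_) 2
    exact mul_le_mul_of_nonneg_right (by linarith) (norm_nonneg _)
  -- Both normals have vertical coordinate one, so in `u₁ - u₀` it cancels up to `4 ε`.
  have hmain := hV' (γ₁ - γ₀) (ω₁ - ω₀) (4 * ε) (9 * (d + 1) ^ 4 * s ^ 2)
    ⟨u₁ - u₀, V.sub_mem hu₁V hu₀V, by
      have : horiz (u₁ - u₀) - (γ₁ - γ₀) = (horiz u₁ - γ₁) - (horiz u₀ - γ₀) := by
        rw [horiz_sub]; abel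
      rw [this]
      exact (norm_sub_le _ _).trans (by linarith), by
      have : (u₁ - u₀) (Fin.last d) = (u₁ (Fin.last d) - 1) - (u₀ (Fin.last d) - 1) := by
        rw [PiLp.sub_apply]; ring
      rw [this]
      exact (abs_sub _ _).trans (by linarith)⟩
    (hφ.norm_normal_variation_le hc' hN hx h₀ h₁ (by linarith) heq₀ heq₁) v' hv'
  have htay : ∀ k : Fin (d + 1), |dX k φ z ω₁ - dX k φ z ω₀ -
      ∑ j, (ω₁ - ω₀) j * dW j (dX k φ) z ω₀| ≤ 2 * s ^ 2 := fun k =>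
    (hφ.smoothOn.smoothOn_dX (isOpen_spaceBox rX rN) (isOpen_freqBall d rW) k).abs_sub_sub_le_right
      (isOpen_spaceBox rX rN) (isOpen_freqBall d rW) (convex_freqBall d rW) hx (by norm_num)
      (fun i j ω hω => hφ.abs_curvMat_le hc1 hx hω i j k) h₀ h₁
  have hinner : inner ℝ (Matrix.toEuclideanCLM (𝕜 := ℝ) (mixedMat φ z ω₀) (horiz v')) (ω₁ - ω₀) =
      ∑ k : Fin d, v' k.castSucc * ∑ j, (ω₁ - ω₀) j * dW j (dX k.castSucc φ) z ω₀ := by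
    rw [PiLp.inner_apply]
    have h1 : ∀ j, Matrix.toEuclideanCLM (𝕜 := ℝ) (mixedMat φ z ω₀) (horiz v') j =
        ∑ k : Fin d, dW j (dX k.castSucc φ) z ω₀ * v' k.castSucc := fun j => rfl
    simp only [h1, RCLike.inner_apply, conj_trivial, Finset.mul_sum]
    rw [Finset.sum_comm]
    refine Finset.sum_congr rfl fun k _ => Finset.sum_congr rfl fun j _ => ?_
    ring
  -- The vertical derivative drops out because `V'` is horizontal; the linear part of the rest is
  -- the inner product that `hmain` bounds.
  have hsplit : ∑ k, v' k * (dX k φ z ω₁ - dX k φ z ω₀) =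
      inner ℝ (Matrix.toEuclideanCLM (𝕜 := ℝ) (mixedMat φ z ω₀) (horiz v')) (ω₁ - ω₀) +
      ∑ k : Fin d, v' k.castSucc * (dX k.castSucc φ z ω₁ - dX k.castSucc φ z ω₀ -
        ∑ j, (ω₁ - ω₀) j * dW j (dX k.castSucc φ) z ω₀) := by
    rw [Fin.sum_univ_castSucc, hlast v' hv', zero_mul, add_zero, hinner,
      ← Finset.sum_add_distrib]
    refine Finset.sum_congr rfl fun k _ => ?_
    ring
  have hrest : |∑ k : Fin d, v' k.castSucc * (dX k.castSucc φ z ω₁ - dX k.castSucc φ z ω₀ -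
      ∑ j, (ω₁ - ω₀) j * dW j (dX k.castSucc φ) z ω₀)| ≤ ∑ _k : Fin d, ‖v'‖ * (2 * s ^ 2) := by
    refine Finset.abs_sum_le_sum_abs _ _ |>.trans (Finset.sum_le_sum fun k _ => ?_)
    rw [abs_mul]
    exact mul_le_mul (Euc.abs_apply_le v' _) (htay _) (abs_nonneg _) (norm_nonneg _)
  rw [Finset.sum_const, Finset.card_univ, Fintype.card_fin, nsmul_eq_mul] at hrest
  rw [hsplit]
  refine (abs_add_le _ _).trans ?_
  have hv0 := norm_nonneg v'
  have hD : (1 : ℝ) ≤ (d + 1) ^ 4 := one_le_pow₀ hd1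
  have hD6 : (1 : ℝ) ≤ (d + 1) ^ 6 := one_le_pow₀ hd1
  have hDd : (d : ℝ) ≤ (d + 1) ^ 4 := by
    have := le_self_pow₀ hd1 (n := 4) (by norm_num)
    linarith
  have e1 : 10 * (4 * ε + 9 * (d + 1) ^ 4 * s ^ 2) * ‖v'‖ + d * (‖v'‖ * (2 * s ^ 2)) ≤
      (40 * ε + 92 * ((d + 1) ^ 4 * s ^ 2)) * ‖v'‖ := by
    have : (d : ℝ) * (s ^ 2 * ‖v'‖) ≤ (d + 1) ^ 4 * (s ^ 2 * ‖v'‖) :=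
      mul_le_mul_of_nonneg_right hDd (by positivity)
    linarith
  have e2 : ((d : ℝ) + 1) ^ 4 * s ^ 2 ≤ (d + 1) ^ 6 * ‖ω₁ - ω₀‖ ^ 2 := by
    have := mul_le_mul_of_nonneg_left hsw (by positivity : (0 : ℝ) ≤ (d + 1) ^ 4)
    calc _ ≤ _ := this
      _ = _ := by ring
  have e3 : ε ≤ (d + 1) ^ 6 * ε := le_mul_of_one_le_left hε0 hD6
  have e4 : 40 * ε + 92 * ((d + 1) ^ 4 * s ^ 2) ≤
      100 * (d + 1) ^ 6 * (ε + ‖ω₁ - ω₀‖ ^ 2) := by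
    have : 0 ≤ ((d : ℝ) + 1) ^ 6 * ‖ω₁ - ω₀‖ ^ 2 := by positivity
    nlinarith
  have e5 := mul_le_mul_of_nonneg_right e4 hv0
  linarith

end ReducedPhase

/-! ### Derivatives of the oscillatory kernel along lines -/

theorem norm_iteratedDeriv_cexp_I_mul_le (n : ℕ) (u : ℝ) :
    ‖iteratedDeriv n (fun u : ℝ => Complex.exp (Complex.I * u)) u‖ ≤ 1 := by
  have h : ∀ n : ℕ, iteratedDeriv n (fun u : ℝ => Complex.exp (Complex.I * u)) =
      fun u : ℝ => Complex.I ^ n * Complex.exp (Complex.I * u) := by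
    intro n
    induction n with
    | zero => simp
    | succ n ih =>
      rw [iteratedDeriv_succ, ih]
      ext u
      have h1 : HasDerivAt (fun u : ℝ => Complex.I * (u : ℂ)) (Complex.I * 1) u :=
        (Complex.ofRealCLM.hasDerivAt (x := u)).const_mul Complex.I
      rw [(h1.cexp.const_mul (Complex.I ^ n)).deriv]
      ring
  rw [h, norm_mul, norm_pow, Complex.norm_I, one_pow, one_mul, mul_comm,
    Complex.norm_exp_ofReal_mul_I]

/-- Each derivative costs a factor `D`: the chain rule for `e^{iP}` contributes `n!` and the Leibniz
rule `2^n`. No bound on `P` itself enters. -/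
theorem norm_iteratedDerivWithin_cexp_mul_le {P : ℝ → ℝ} {α : ℝ → ℂ} {O : Set ℝ} (hO : IsOpen O)
    (hP : ContDiffOn ℝ ((⊤ : ℕ∞) : WithTop ℕ∞) P O)
    (hα : ContDiffOn ℝ ((⊤ : ℕ∞) : WithTop ℕ∞) α O) {t : ℝ} (ht : t ∈ O) {n : ℕ} {D A : ℝ}
    (hD : 0 ≤ D) (hA : 0 ≤ A)
    (hPD : ∀ i, 1 ≤ i → i ≤ n → ‖iteratedDerivWithin i P O t‖ ≤ D ^ i)
    (hαD : ∀ i ≤ n, ‖iteratedDerivWithin i α O t‖ ≤ A * D ^ i) :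
    ‖iteratedDerivWithin n (fun t => Complex.exp (Complex.I * P t) * α t) O t‖ ≤
      2 ^ n * n.factorial * A * D ^ n := by
  have hg : ContDiff ℝ ((⊤ : ℕ∞) : WithTop ℕ∞) (fun u : ℝ => Complex.exp (Complex.I * u)) :=
    (contDiff_const.mul Complex.ofRealCLM.contDiff).cexp
  have hn : ∀ i : ℕ, ((i : ℕ) : WithTop ℕ∞) ≤ ((⊤ : ℕ∞) : WithTop ℕ∞) := fun i => by
    exact_mod_cast le_top
  have hexp : ∀ i ≤ n, ‖iteratedFDerivWithin ℝ i (fun t => Complex.exp (Complex.I * P t)) O t‖ ≤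
      i.factorial * 1 * D ^ i := by
    intro i hi
    refine norm_iteratedFDerivWithin_comp_le (g := fun u : ℝ => Complex.exp (Complex.I * u))
      hg.contDiffOn hP (hn i) uniqueDiffOn_univ hO.uniqueDiffOn (mapsTo_univ _ _) ht ?_ ?_
    · intro j _
      rw [norm_iteratedFDerivWithin_eq_norm_iteratedDerivWithin, iteratedDerivWithin_univ]
      exact norm_iteratedDeriv_cexp_I_mul_le j _
    · intro j hj hji
      rw [norm_iteratedFDerivWithin_eq_norm_iteratedDerivWithin]
      exact hPD j hj (hji.trans hi)
  rw [← norm_iteratedFDerivWithin_eq_norm_iteratedDerivWithin]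
  refine (norm_iteratedFDerivWithin_mul_le (hg.comp_contDiffOn hP) hα hO.uniqueDiffOn ht
    (hn n)).trans ?_
  calc ∑ i ∈ Finset.range (n + 1), (n.choose i : ℝ) *
        ‖iteratedFDerivWithin ℝ i (fun t => Complex.exp (Complex.I * P t)) O t‖ *
        ‖iteratedFDerivWithin ℝ (n - i) α O t‖
      ≤ ∑ i ∈ Finset.range (n + 1), (n.choose i : ℝ) * (n.factorial * A * D ^ n) := by
        refine Finset.sum_le_sum fun i hi => ?_
        have hi' : i ≤ n := Nat.lt_succ_iff.1 (Finset.mem_range.1 hi)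
        rw [mul_assoc]
        refine mul_le_mul_of_nonneg_left ?_ (Nat.cast_nonneg _)
        have h1 := hexp i hi'
        have h2 := hαD (n - i) (Nat.sub_le _ _)
        rw [← norm_iteratedFDerivWithin_eq_norm_iteratedDerivWithin] at h2
        refine (mul_le_mul h1 h2 (norm_nonneg _) (by positivity)).trans ?_
        have h3 : (i.factorial : ℝ) ≤ n.factorial := by exact_mod_cast Nat.factorial_le hi'
        have h4 : D ^ i * D ^ (n - i) = D ^ n := by rw [← pow_add, Nat.add_sub_cancel' hi']
        calc (i.factorial : ℝ) * 1 * D ^ i * (A * D ^ (n - i))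
            = i.factorial * A * (D ^ i * D ^ (n - i)) := by ring
          _ ≤ n.factorial * A * D ^ n := by
            rw [h4]
            gcongr
    _ = 2 ^ n * n.factorial * A * D ^ n := by
        rw [← Finset.sum_mul]
        have : ∑ i ∈ Finset.range (n + 1), (n.choose i : ℝ) = 2 ^ n := by
          exact_mod_cast Nat.sum_range_choose n
        rw [this]
        ring

section Kernel

variable {d σ : ℕ} {cex : ℝ} {Nex : ℕ} {A rX rN rW : ℝ} {φ : Euc (d + 1) → Euc d → ℝ}
  {a : Euc (d + 1) → Euc d → ℂ} {lam : ℝ}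

/-- The kernel `e^{2πi φ^λ} a^λ` of `T^λ`. -/
def kernelT (φ : Euc (d + 1) → Euc d → ℝ) (a : Euc (d + 1) → Euc d → ℂ) (lam : ℝ)
    (x : Euc (d + 1)) (ω : Euc d) : ℂ :=
  Complex.exp (2 * Real.pi * Complex.I * (phaseL φ lam x ω : ℂ)) * a (lam⁻¹ • x) ω

/-- The kernel along a line, demodulated by the frequency `ξ`. -/
def kernelLine (φ : Euc (d + 1) → Euc d → ℝ) (a : Euc (d + 1) → Euc d → ℂ) (lam : ℝ)
    (x y : Euc (d + 1)) (ξ : ℝ) (ω : Euc d) (t : ℝ) : ℂ :=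
  Complex.exp (Complex.I * ((-(2 * Real.pi * ξ) * t : ℝ) : ℂ)) * kernelT φ a lam (x + t • y) ω

/-- Demodulation by `ξ` leaves a phase with first derivative at most `D`. Its derivatives of order
`i ≥ 2` have size `λ(|y|/λ)^i`, which is at most `D^i` when `|y|² ≤ D²λ`; those of the amplitude are
`O((|y|/λ)^i)`. -/
theorem norm_fwdDiff_kernelLine_le (hφ : IsReducedPhase d σ cex Nex rX rN rW φ)
    (ha : IsReducedAmplitude d Nex A rX rN rW a) (hc0 : 0 ≤ cex) (hc : cex ≤ 1 / 100)
    (hlam : 1 ≤ lam) {x y : Euc (d + 1)} {ω : Euc d} (hω : ω ∈ freqBall d rW) {ξ D : ℝ}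
    (hD : 0 ≤ D)
    (hline : ∀ t ∈ Icc 0 (Nex : ℝ), lam⁻¹ • (x + t • y) ∈ spaceBox d rX rN)
    (hfirst : ∀ t ∈ Icc 0 (Nex : ℝ),
      |∑ i, y i * dX i φ (lam⁻¹ • (x + t • y)) ω - ξ| ≤ D / (2 * Real.pi))
    (hy : (∑ i, |y i|) ^ 2 ≤ D ^ 2 * lam) :
    ‖(fwdDiff 1)^[Nex] (kernelLine φ a lam x y ξ ω) 0‖ ≤
      2 ^ Nex * Nex.factorial * A * D ^ Nex := by
  have hlam0 : 0 < lam := by linarith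
  have hA : 0 ≤ A := (norm_nonneg _).trans (ha.bound [] [] (by simp) (by simp) 0 0)
  set x' := lam⁻¹ • x with hx'
  set y' := lam⁻¹ • y with hy'
  have hxy : ∀ t : ℝ, lam⁻¹ • (x + t • y) = x' + t • y' := fun t => by
    rw [smul_add, smul_comm]
  set s := ∑ i, |y i| with hs
  have hs0 : 0 ≤ s := Finset.sum_nonneg fun _ _ => abs_nonneg _
  have hs' : ∑ i, |y' i| = s / lam := by
    rw [hs, Finset.sum_div]
    refine Finset.sum_congr rfl fun i _ => ?_
    rw [hy', PiLp.smul_apply, smul_eq_mul, abs_mul, abs_inv, abs_of_pos hlam0]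
    field_simp
  have hslam : s / lam ≤ D := by
    rw [div_le_iff₀ hlam0]
    refine abs_le_of_sq_le_sq' ?_ (by positivity) |>.2
    rw [mul_pow]
    exact hy.trans (mul_le_mul_of_nonneg_left (by nlinarith) (sq_nonneg D))
  set O : Set ℝ := {t | x' + t • y' ∈ spaceBox d rX rN} with hOdef
  have hO : IsOpen O := (isOpen_spaceBox rX rN).preimage (by fun_prop)
  have hOline : ∀ t ∈ O, x' + t • y' ∈ spaceBox d rX rN := fun t ht => ht
  have hsub : Icc 0 (Nex : ℝ) ⊆ O := fun t ht => by
    have := hline t ht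
    rwa [hxy] at this
  have hsm := hφ.smoothOn
  have hU := isOpen_spaceBox (d := d) rX rN
  have hW := isOpen_freqBall d rW
  have hφline : ContDiffOn ℝ ((⊤ : ℕ∞) : WithTop ℕ∞) (fun t : ℝ => φ (x' + t • y') ω) O :=
    hsm.contDiffOn_line hω x' y' hOline
  have hasm : SmoothOn a univ univ := ha.smooth.contDiffOn
  have haline : ContDiffOn ℝ ((⊤ : ℕ∞) : WithTop ℕ∞) (fun t : ℝ => a (x' + t • y') ω) O :=
    hasm.contDiffOn_line (mem_univ ω) x' y' fun _ _ => mem_univ _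
  set P : ℝ → ℝ := fun t => -(2 * Real.pi * ξ) * t + 2 * Real.pi * lam * φ (x' + t • y') ω with hP
  have hPsm : ContDiffOn ℝ ((⊤ : ℕ∞) : WithTop ℕ∞) P O :=
    (contDiff_const.mul contDiff_id).contDiffOn.add (contDiffOn_const.mul hφline)
  have hker : kernelLine φ a lam x y ξ ω =
      fun t => Complex.exp (Complex.I * P t) * a (x' + t • y') ω := by
    ext t
    rw [kernelLine, kernelT, phaseL, hxy, ← mul_assoc, ← Complex.exp_add, hP]
    congr 2
    push_cast
    ring
  have hPder : ∀ t ∈ O, HasDerivAt P (-(2 * Real.pi * ξ) + 2 * Real.pi * lam *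
      ∑ i, y' i * dX i φ (x' + t • y') ω) t := by
    intro t ht
    have h1 := (hsm.hasDerivAt_line_left hU hW ht hω).const_mul (2 * Real.pi * lam)
    have h2 := (hasDerivAt_id t).const_mul (-(2 * Real.pi * ξ))
    refine (h2.add h1).congr_deriv ?_
    simp
  rw [hker]
  refine norm_fwdDiff_iter_le_of_contDiffOn hO ?_ hsub fun t ht => ?_
  · exact (((contDiff_const.mul Complex.ofRealCLM.contDiff).cexp :
      ContDiff ℝ ((⊤ : ℕ∞) : WithTop ℕ∞)
        (fun u : ℝ => Complex.exp (Complex.I * u))).comp_contDiffOn hPsm).mul haline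
  · have htO := hsub ht
    refine norm_iteratedDerivWithin_cexp_mul_le hO hPsm haline htO hD hA ?_ ?_
    · intro i hi1 hiN
      obtain rfl | hi2 := eq_or_lt_of_le hi1
      · rw [iteratedDerivWithin_one, (hPder t htO).hasDerivWithinAt.derivWithin
          (hO.uniqueDiffOn t htO), pow_one, Real.norm_eq_abs]
        have h1 : ∑ i, y' i * dX i φ (x' + t • y') ω =
            lam⁻¹ * ∑ i, y i * dX i φ (x' + t • y') ω := by
          rw [Finset.mul_sum]
          refine Finset.sum_congr rfl fun i _ => ?_
          rw [hy', PiLp.smul_apply, smul_eq_mul]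
          ring
        have h2 := hfirst t ht
        rw [hxy, le_div_iff₀ (by positivity)] at h2
        have h3 : -(2 * Real.pi * ξ) + 2 * Real.pi * lam * (lam⁻¹ *
            ∑ i, y i * dX i φ (x' + t • y') ω) =
            (∑ i, y i * dX i φ (x' + t • y') ω - ξ) * (2 * Real.pi) := by
          field_simp
          ring
        rw [h1, h3, abs_mul, abs_of_pos (by positivity : (0 : ℝ) < 2 * Real.pi)]
        exact h2
      · obtain ⟨m, rfl⟩ : ∃ m, i = m + 2 := ⟨i - 2, by omega⟩
        -- From the second derivative on, the linear demodulating term has disappeared.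
        have hlin : iteratedDerivWithin (m + 2) P O t =
            2 * Real.pi * lam * iteratedDerivWithin (m + 2) (fun t => φ (x' + t • y') ω) O t := by
          rw [iteratedDerivWithin_succ', iteratedDerivWithin_succ' (f := fun t => φ (x' + t • y') ω)]
          have hE1 : EqOn (derivWithin P O) (fun t => -(2 * Real.pi * ξ) + 2 * Real.pi * lam *
              ∑ i, y' i * dX i φ (x' + t • y') ω) O := fun r hr =>
            (hPder r hr).hasDerivWithinAt.derivWithin (hO.uniqueDiffOn r hr)
          have hE2 : EqOn (derivWithin (fun t => φ (x' + t • y') ω) O)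
              (fun t => ∑ i, y' i * dX i φ (x' + t • y') ω) O := fun r hr => by
            simpa using (hsm.hasDerivAt_line_left hU hW hr hω).hasDerivWithinAt.derivWithin
              (hO.uniqueDiffOn r hr)
          rw [iteratedDerivWithin_congr hE1 htO, iteratedDerivWithin_congr hE2 htO,
            iteratedDerivWithin_const_add (by omega), iteratedDerivWithin_const_mul htO
              hO.uniqueDiffOn]
          refine ContDiffWithinAt.sum fun i _ => contDiffWithinAt_const.mul ?_
          exact (((hsm.smoothOn_dX hU hW i).contDiffOn_line hω x' y' hOline) t htO).of_le
            (by exact_mod_cast le_top)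
        have hb := SmoothOn.norm_iteratedDerivWithin_line_le hU hW (m + 2) hsm hω (K := cex)
          (fun α hα z hz => (hφ.higher α [] (hα.le.trans hiN) (by simp) (Or.inr (by omega))
            z hz ω hω).le) x' y' hO hOline t htO
        rw [hs'] at hb
        rw [hlin, norm_mul, Real.norm_eq_abs, abs_of_pos (by positivity : 0 < 2 * Real.pi * lam)]
        -- Two factors `s / lam` absorb the large factor `lam`; the remaining ones are at most `D`
        -- each.
        have h1 : lam * (s / lam) ^ 2 ≤ D ^ 2 := by
          rw [div_pow, mul_div_assoc', div_le_iff₀ (by positivity)]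
          nlinarith
        have h2 : 2 * Real.pi * cex ≤ 1 := by nlinarith [Real.pi_le_four]
        calc 2 * Real.pi * lam * ‖iteratedDerivWithin (m + 2) (fun t => φ (x' + t • y') ω) O t‖
            ≤ 2 * Real.pi * lam * ((s / lam) ^ (m + 2) * cex) := by gcongr
          _ = (2 * Real.pi * cex) * ((lam * (s / lam) ^ 2) * (s / lam) ^ m) := by ring
          _ ≤ 1 * (D ^ 2 * D ^ m) := by gcongr
          _ = D ^ (m + 2) := by ring
    · intro i hi
      have hb := SmoothOn.norm_iteratedDerivWithin_line_le isOpen_univ isOpen_univ i hasm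
        (mem_univ ω) (K := A) (fun α hα z _ => ha.bound α [] (hα.le.trans hi) (by simp) z ω)
        x' y' hO (fun _ _ => mem_univ _) t htO
      rw [hs'] at hb
      refine hb.trans ?_
      rw [mul_comm]
      gcongr

end Kernel

/-! ### The operator `T^λ` -/

section Operator

variable {d σ : ℕ} {cex : ℝ} {Nex : ℕ} {A rX rN rW : ℝ} {φ : Euc (d + 1) → Euc d → ℝ}
  {a : Euc (d + 1) → Euc d → ℂ} {lam : ℝ}

theorem norm_kernelT (x : Euc (d + 1)) (ω : Euc d) :
    ‖kernelT φ a lam x ω‖ = ‖a (lam⁻¹ • x) ω‖ := by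
  have h : 2 * Real.pi * Complex.I * (phaseL φ lam x ω : ℂ) =
      ((2 * Real.pi * phaseL φ lam x ω : ℝ) : ℂ) * Complex.I := by
    push_cast
    ring
  rw [kernelT, norm_mul, h, Complex.norm_exp_ofReal_mul_I, one_mul]

theorem IsReducedAmplitude.nonneg (ha : IsReducedAmplitude d Nex A rX rN rW a) : 0 ≤ A :=
  (norm_nonneg _).trans (ha.bound [] [] (by simp) (by simp) 0 0)

theorem norm_kernelT_le (ha : IsReducedAmplitude d Nex A rX rN rW a) (x : Euc (d + 1))
    (ω : Euc d) : ‖kernelT φ a lam x ω‖ ≤ A := by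
  rw [norm_kernelT]
  exact ha.bound [] [] (by simp) (by simp) _ ω

theorem kernelT_eq_zero (ha : IsReducedAmplitude d Nex A rX rN rW a) (x : Euc (d + 1))
    {ω : Euc d} (hω : ω ∉ freqBall d rW) : kernelT φ a lam x ω = 0 := by
  rw [← norm_eq_zero, norm_kernelT, norm_eq_zero]
  by_contra h
  exact hω (ha.support _ _ h).2

theorem norm_kernelLine (x y : Euc (d + 1)) (ξ : ℝ) (ω : Euc d) (t : ℝ) :
    ‖kernelLine φ a lam x y ξ ω t‖ = ‖kernelT φ a lam (x + t • y) ω‖ := by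
  rw [kernelLine, norm_mul, mul_comm Complex.I, Complex.norm_exp_ofReal_mul_I, one_mul]

/-- The phase is controlled only on `X × Ω`. Elsewhere `a` vanishes, and continuity at a zero of `a`
follows from the modulus of the kernel being that of `a`. -/
theorem continuous_kernelT (hφ : IsReducedPhase d σ cex Nex rX rN rW φ)
    (ha : IsReducedAmplitude d Nex A rX rN rW a) :
    Continuous fun p : Euc (d + 1) × Euc d => kernelT φ a lam p.1 p.2 := by
  have hL : Continuous fun p : Euc (d + 1) × Euc d => (lam⁻¹ • p.1, p.2) := by fun_prop
  have hacont : Continuous fun p : Euc (d + 1) × Euc d => a (lam⁻¹ • p.1) p.2 :=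
    ha.smooth.continuous.comp hL
  rw [continuous_iff_continuousAt]
  intro p
  by_cases h0 : a (lam⁻¹ • p.1) p.2 = 0
  · have hk : kernelT φ a lam p.1 p.2 = 0 := by
      rw [← norm_eq_zero, norm_kernelT, h0, norm_zero]
    rw [ContinuousAt, hk, tendsto_zero_iff_norm_tendsto_zero]
    simp_rw [norm_kernelT]
    have := hacont.norm.tendsto p
    rwa [h0, norm_zero] at this
  · obtain ⟨hx, hω⟩ := ha.support _ _ h0
    have hφc : ContinuousAt (fun p : Euc (d + 1) × Euc d => φ (lam⁻¹ • p.1) p.2) p :=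
      ContinuousAt.comp (f := fun p : Euc (d + 1) × Euc d => (lam⁻¹ • p.1, p.2))
        (hφ.smoothOn.differentiableAt (isOpen_spaceBox rX rN) (isOpen_freqBall d rW)
          hx hω).continuousAt hL.continuousAt
    have hph : ContinuousAt (fun p : Euc (d + 1) × Euc d => phaseL φ lam p.1 p.2) p :=
      hφc.const_mul lam
    refine ContinuousAt.mul ?_ hacont.continuousAt
    exact (continuousAt_const.mul (Complex.continuous_ofReal.continuousAt.comp hph)).cexp

theorem opT_eq_integral (g : Euc d → ℂ) (x : Euc (d + 1)) :
    opT φ a lam g x = ∫ ω in unitBall d, kernelT φ a lam x ω * g ω := rfl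

theorem volume_unitBall_lt_top : volume (unitBall d) < ⊤ := measure_ball_lt_top

theorem integrableOn_unitBall {g : Euc d → ℂ} (hg : MemLp g 2 volume) :
    IntegrableOn g (unitBall d) := by
  have : IsFiniteMeasure (volume.restrict (unitBall d)) := ⟨by simpa using volume_unitBall_lt_top⟩
  exact (hg.restrict _).integrable (by norm_num)

theorem integrableOn_kernelT_mul (hφ : IsReducedPhase d σ cex Nex rX rN rW φ)
    (ha : IsReducedAmplitude d Nex A rX rN rW a) {g : Euc d → ℂ} (hg : MemLp g 2 volume)
    (x : Euc (d + 1)) : IntegrableOn (fun ω => kernelT φ a lam x ω * g ω) (unitBall d) := by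
  refine (integrableOn_unitBall hg).bdd_mul (c := A) ?_
    (Filter.Eventually.of_forall fun ω => norm_kernelT_le ha x ω)
  exact ((continuous_kernelT hφ ha).comp (by fun_prop :
    Continuous fun ω : Euc d => (x, ω))).aestronglyMeasurable

theorem continuous_opT (hφ : IsReducedPhase d σ cex Nex rX rN rW φ)
    (ha : IsReducedAmplitude d Nex A rX rN rW a) {g : Euc d → ℂ} (hg : MemLp g 2 volume) :
    Continuous (opT φ a lam g) := by
  refine continuous_of_dominated (F := fun x ω => kernelT φ a lam x ω * g ω)
    (bound := fun ω => A * ‖g ω‖)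
    (fun x => (integrableOn_kernelT_mul hφ ha hg x).aestronglyMeasurable)
    (fun x => Filter.Eventually.of_forall fun ω => ?_)
    ((integrableOn_unitBall hg).norm.const_mul A)
    (Filter.Eventually.of_forall fun ω => ?_)
  · rw [norm_mul]
    exact mul_le_mul_of_nonneg_right (norm_kernelT_le ha x ω) (norm_nonneg _)
  · exact ((continuous_kernelT hφ ha).comp (by fun_prop :
      Continuous fun x : Euc (d + 1) => (x, ω))).mul continuous_const

theorem integral_norm_le_l2norm {g : Euc d → ℂ} (hg : MemLp g 2 volume) :
    ∫ ω in unitBall d, ‖g ω‖ ≤ volume.real (unitBall d) ^ (1 / 2 : ℝ) * l2norm g := by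
  have hfin : MemLp g 2 (volume.restrict (unitBall d)) := hg.restrict _
  have h1 := eLpNorm_le_eLpNorm_mul_rpow_measure_univ (p := 1) (q := 2) (by norm_num)
    hfin.aestronglyMeasurable
  rw [integral_norm_eq_lintegral_enorm hfin.aestronglyMeasurable, ← eLpNorm_one_eq_lintegral_enorm]
  have hvol : volume (unitBall d) ≠ ⊤ := volume_unitBall_lt_top.ne
  refine (ENNReal.toReal_mono ?_ h1).trans_eq ?_
  · exact ENNReal.mul_ne_top hfin.eLpNorm_ne_top
      (ENNReal.rpow_ne_top_of_nonneg (by norm_num) (by simpa using hvol))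
  · rw [ENNReal.toReal_mul, ← ENNReal.toReal_rpow, mul_comm, Measure.restrict_apply_univ]
    congr 2
    norm_num

theorem norm_opT_le
    (ha : IsReducedAmplitude d Nex A rX rN rW a) {g : Euc d → ℂ} (hg : MemLp g 2 volume)
    (x : Euc (d + 1)) :
    ‖opT φ a lam g x‖ ≤ A * (volume.real (unitBall d) ^ (1 / 2 : ℝ) * l2norm g) := by
  rw [opT_eq_integral]
  calc ‖∫ ω in unitBall d, kernelT φ a lam x ω * g ω‖ ≤ ∫ ω in unitBall d, A * ‖g ω‖ := by
        refine norm_integral_le_of_norm_le ((integrableOn_unitBall hg).norm.const_mul A)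
          (Filter.Eventually.of_forall fun ω => ?_)
        rw [norm_mul]
        exact mul_le_mul_of_nonneg_right (norm_kernelT_le ha x ω) (norm_nonneg _)
    _ = A * ∫ ω in unitBall d, ‖g ω‖ := integral_const_mul _ _
    _ ≤ _ := mul_le_mul_of_nonneg_left (integral_norm_le_l2norm hg) ha.nonneg

theorem fwdDiff_iter_zero_eq_sum (f : ℝ → ℂ) (N : ℕ) :
    (fwdDiff 1)^[N] f 0 =
      ∑ k ∈ Finset.range (N + 1), (((-1) ^ (N - k) * N.choose k : ℤ) : ℂ) * f k := by
  rw [fwdDiff_iter_eq_sum_shift]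
  refine Finset.sum_congr rfl fun k _ => ?_
  simp [zsmul_eq_mul]

theorem norm_choose_coeff_le (N k : ℕ) : ‖(((-1) ^ (N - k) * N.choose k : ℤ) : ℂ)‖ ≤ N.choose k := by
  simp

/-- If the iterated differences of the kernel are small wherever `g` is not small, then
`|T^λ g(x)|` is controlled by the values of `T^λ g` at the points `x + j y`. -/
theorem norm_opT_le_sum (hφ : IsReducedPhase d σ cex Nex rX rN rW φ)
    (ha : IsReducedAmplitude d Nex A rX rN rW a) {g : Euc d → ℂ} (hg : MemLp g 2 volume)
    {x y : Euc (d + 1)} {ξ M e : ℝ} {N : ℕ} (hM0 : 0 ≤ M) (he0 : 0 ≤ e)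
    (hM : ∀ᵐ ω ∂(volume.restrict (unitBall d)),
      ‖(fwdDiff 1)^[N] (kernelLine φ a lam x y ξ ω) 0‖ ≤ M ∨ ‖g ω‖ ≤ e) :
    ‖opT φ a lam g x‖ ≤ 2 ^ N * ∑ j ∈ Finset.Icc 1 N, ‖opT φ a lam g (x + (j : ℝ) • y)‖ +
      (M * (volume.real (unitBall d) ^ (1 / 2 : ℝ) * l2norm g)
        + 2 ^ N * A * e * volume.real (unitBall d)) := by
  have hA := ha.nonneg
  set mod : ℝ → ℂ := fun t => Complex.exp (Complex.I * ((-(2 * Real.pi * ξ) * t : ℝ) : ℂ)) with hmod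
  have hmodn : ∀ t, ‖mod t‖ = 1 := fun t => by
    rw [hmod]
    simp only
    rw [mul_comm, Complex.norm_exp_ofReal_mul_I]
  set c : ℕ → ℂ := fun k => (((-1) ^ (N - k) * N.choose k : ℤ) : ℂ) with hc
  have hint : ∀ k : ℕ, IntegrableOn
      (fun ω => c k * (kernelLine φ a lam x y ξ ω k * g ω)) (unitBall d) := by
    intro k
    have := ((integrableOn_kernelT_mul hφ ha hg (x + (k : ℝ) • y) (lam := lam)).const_mul
      (mod k)).const_mul (c k)
    refine this.congr (Filter.Eventually.of_forall fun ω => ?_)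
    simp only [kernelLine, hmod]
    ring
  -- By linearity the difference of the kernel integrates against `g` to an alternating sum of
  -- modulated values of `T^λ g`; the term `k = 0` is then isolated, its coefficient having modulus
  -- one.
  have hsum : ∑ k ∈ Finset.range (N + 1), c k * (mod k * opT φ a lam g (x + (k : ℝ) • y)) =
      ∫ ω in unitBall d, (fwdDiff 1)^[N] (kernelLine φ a lam x y ξ ω) 0 * g ω := by
    have h1 : ∀ ω, (fwdDiff 1)^[N] (kernelLine φ a lam x y ξ ω) 0 * g ω =
        ∑ k ∈ Finset.range (N + 1), c k * (kernelLine φ a lam x y ξ ω k * g ω) := fun ω => by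
      rw [fwdDiff_iter_zero_eq_sum, Finset.sum_mul]
      refine Finset.sum_congr rfl fun k _ => ?_
      rw [hc, mul_assoc]
    simp_rw [h1]
    rw [integral_finsetSum _ fun k _ => hint k]
    refine Finset.sum_congr rfl fun k _ => ?_
    rw [integral_const_mul, opT_eq_integral, ← integral_const_mul]
    congr 1
    refine integral_congr_ae (Filter.Eventually.of_forall fun ω => ?_)
    simp only [kernelLine, hmod]
    ring
  have hdiff : ∀ ω, ‖(fwdDiff 1)^[N] (kernelLine φ a lam x y ξ ω) 0‖ ≤ 2 ^ N * A := by
    intro ω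
    rw [fwdDiff_iter_zero_eq_sum]
    calc ‖∑ k ∈ Finset.range (N + 1), c k * kernelLine φ a lam x y ξ ω k‖
        ≤ ∑ k ∈ Finset.range (N + 1), (N.choose k : ℝ) * A := by
          refine norm_sum_le_of_le _ fun k _ => ?_
          rw [norm_mul]
          refine mul_le_mul (norm_choose_coeff_le N k) ?_ (norm_nonneg _) (Nat.cast_nonneg _)
          rw [norm_kernelLine]
          exact norm_kernelT_le ha _ ω
      _ = 2 ^ N * A := by
          rw [← Finset.sum_mul]
          congr 1
          exact_mod_cast Nat.sum_range_choose N
  have hbound : ‖∫ ω in unitBall d, (fwdDiff 1)^[N] (kernelLine φ a lam x y ξ ω) 0 * g ω‖ ≤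
      M * (volume.real (unitBall d) ^ (1 / 2 : ℝ) * l2norm g)
        + 2 ^ N * A * e * volume.real (unitBall d) := by
    have hi1 : IntegrableOn (fun ω => M * ‖g ω‖) (unitBall d) :=
      (integrableOn_unitBall hg).norm.const_mul M
    have hi2 : IntegrableOn (fun _ : Euc d => 2 ^ N * A * e) (unitBall d) :=
      integrableOn_const volume_unitBall_lt_top.ne
    calc _ ≤ ∫ ω in unitBall d, (M * ‖g ω‖ + 2 ^ N * A * e) := by
          refine norm_integral_le_of_norm_le (hi1.add hi2) ?_
          filter_upwards [hM] with ω hω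
          rw [norm_mul]
          rcases hω with h | h
          · have := mul_le_mul_of_nonneg_right h (norm_nonneg (g ω))
            have : 0 ≤ 2 ^ N * A * e := by positivity
            linarith
          · have h1 := mul_le_mul (hdiff ω) h (norm_nonneg _) (by positivity)
            have : 0 ≤ M * ‖g ω‖ := by positivity
            linarith
      _ = M * (∫ ω in unitBall d, ‖g ω‖) + 2 ^ N * A * e * volume.real (unitBall d) := by
          rw [integral_add hi1 hi2, integral_const_mul, setIntegral_const, smul_eq_mul,
            mul_comm (volume.real _)]
      _ ≤ _ := by
          have := mul_le_mul_of_nonneg_left (integral_norm_le_l2norm hg) hM0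
          linarith
  rw [← hsum, Finset.range_eq_Ico, Finset.sum_eq_sum_Ico_succ_bot (by omega)] at hbound
  have hIco : Finset.Ico (0 + 1) (N + 1) = Finset.Icc 1 N := by
    ext k
    simp only [Finset.mem_Ico, Finset.mem_Icc]
    omega
  rw [hIco] at hbound
  have hfirst : ‖c 0 * (mod (0 : ℕ) * opT φ a lam g (x + ((0 : ℕ) : ℝ) • y))‖ =
      ‖opT φ a lam g x‖ := by
    rw [norm_mul, norm_mul, hmodn, hc]
    simp
  have hrest : ‖∑ j ∈ Finset.Icc 1 N, c j * (mod j * opT φ a lam g (x + (j : ℝ) • y))‖ ≤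
      2 ^ N * ∑ j ∈ Finset.Icc 1 N, ‖opT φ a lam g (x + (j : ℝ) • y)‖ := by
    rw [Finset.mul_sum]
    refine norm_sum_le_of_le _ fun j _ => ?_
    rw [norm_mul, norm_mul, hmodn, one_mul]
    refine mul_le_mul_of_nonneg_right ((norm_choose_coeff_le N j).trans ?_) (norm_nonneg _)
    exact_mod_cast Nat.choose_le_two_pow N j
  rw [← hfirst]
  have h3 := norm_sub_le
    (c 0 * (mod (0 : ℕ) * opT φ a lam g (x + ((0 : ℕ) : ℝ) • y)) +
      ∑ j ∈ Finset.Icc 1 N, c j * (mod j * opT φ a lam g (x + (j : ℝ) • y)))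
    (∑ j ∈ Finset.Icc 1 N, c j * (mod j * opT φ a lam g (x + (j : ℝ) • y)))
  rw [add_sub_cancel_right] at h3
  exact (h3.trans (add_le_add hbound hrest)).trans_eq (add_comm _ _)

end Operator

/-! ### Integration over planes -/

section Planes

variable {n : ℕ}

/-- The isometric parametrisation of `W` underlying `planeMeasure`. -/
def planeParam (W : Submodule ℝ (Euc n)) : Euc (Module.finrank ℝ W) →ₗᵢ[ℝ] Euc n :=
  W.subtypeₗᵢ.comp (stdOrthonormalBasis ℝ W).repr.symm.toLinearIsometry

theorem planeParam_mem (W : Submodule ℝ (Euc n)) (y : Euc (Module.finrank ℝ W)) :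
    planeParam W y ∈ W := ((stdOrthonormalBasis ℝ W).repr.symm y).2

theorem setIntegral_planeMeasure (W : Submodule ℝ (Euc n)) (p : Euc n) (f : Euc n → ℝ)
    (S : Set (Euc n)) :
    ∫ x in S, f x ∂(planeMeasure W p) =
      ∫ y in {y | p + planeParam W y ∈ S}, f (p + planeParam W y) := by
  have hiso : Isometry fun y => p + planeParam W y :=
    (IsometryEquiv.addLeft p).isometry.comp (planeParam W).isometry
  exact hiso.isClosedEmbedding.measurableEmbedding.setIntegral_map f S

theorem planeParam_preimage_ball (W : Submodule ℝ (Euc n)) (p : Euc n) (r : ℝ) :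
    {y | p + planeParam W y ∈ ball p r} = ball 0 r := by
  ext y
  simp

theorem measurableSet_planeParam_preimage_ball (W : Submodule ℝ (Euc n)) (p q : Euc n) (r : ℝ) :
    MeasurableSet {y | p + planeParam W y ∈ ball q r} :=
  (isOpen_ball.preimage (by fun_prop : Continuous fun y => p + planeParam W y)).measurableSet

theorem planeParam_preimage_ball_subset (W : Submodule ℝ (Euc n)) (p q : Euc n) (r : ℝ) :
    {y | p + planeParam W y ∈ ball q r} ⊆ ball 0 (r + dist p q) := by
  intro y hy
  rw [mem_ofPred_eq, mem_ball_iff_norm] at hy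
  rw [mem_ball_zero_iff, ← (planeParam W).norm_map, dist_eq_norm]
  have : planeParam W y = (p + planeParam W y - q) - (p - q) := by abel
  rw [this]
  exact (norm_sub_le _ _).trans_lt (by linarith)

theorem volume_real_ball_zero {k : ℕ} {r : ℝ} (hr : 0 < r) :
    volume.real (ball (0 : Euc k) r) = r ^ k * volume.real (ball (0 : Euc k) 1) := by
  rw [Measure.real, Measure.addHaar_ball_of_pos volume (0 : Euc k) hr, ENNReal.toReal_mul,
    ENNReal.toReal_ofReal (by positivity), finrank_euclideanSpace_fin, Measure.real]

theorem volume_real_ball_pos {k : ℕ} {r : ℝ} (hr : 0 < r) :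
    0 < volume.real (ball (0 : Euc k) r) :=
  ENNReal.toReal_pos (measure_ball_pos _ _ hr).ne' measure_ball_lt_top.ne

theorem setIntegral_planeMeasure_nonneg (W : Submodule ℝ (Euc n)) (p : Euc n) (F : Euc n → ℂ)
    (S : Set (Euc n)) : 0 ≤ ∫ x in S, ‖F x‖ ^ 2 ∂(planeMeasure W p) :=
  integral_nonneg fun _ => sq_nonneg _

theorem setIntegral_planeMeasure_ball_mono (W : Submodule ℝ (Euc n)) (p : Euc n) {F : Euc n → ℂ}
    (hF : Continuous F) {q q' : Euc n} {r r' : ℝ} (h : ball q r ⊆ ball q' r') :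
    ∫ x in ball q r, ‖F x‖ ^ 2 ∂(planeMeasure W p) ≤
      ∫ x in ball q' r', ‖F x‖ ^ 2 ∂(planeMeasure W p) := by
  rw [setIntegral_planeMeasure, setIntegral_planeMeasure]
  refine setIntegral_mono_set ?_ (Filter.Eventually.of_forall fun _ => sq_nonneg _)
    (Filter.Eventually.of_forall fun y hy => h hy)
  refine IntegrableOn.mono_set ?_ (planeParam_preimage_ball_subset W p q' r')
  exact ((by fun_prop : Continuous fun y => ‖F (p + planeParam W y)‖ ^ 2).continuousOn.integrableOn_compact
    (isCompact_closedBall 0 _)).mono_set ball_subset_closedBall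

theorem setIntegral_planeMeasure_le_of_norm_le (W : Submodule ℝ (Euc n)) {p q : Euc n}
    {F : Euc n → ℂ} {r s B : ℝ} (hs : 0 < s) (hrs : r + dist p q ≤ s)
    (hB : ∀ x, ‖F x‖ ≤ B) :
    ∫ x in ball q r, ‖F x‖ ^ 2 ∂(planeMeasure W p) ≤
      B ^ 2 * (s ^ Module.finrank ℝ W *
        volume.real (ball (0 : Euc (Module.finrank ℝ W)) 1)) := by
  rw [setIntegral_planeMeasure, ← volume_real_ball_zero hs]
  have hsub := (planeParam_preimage_ball_subset W p q r).trans (ball_subset_ball hrs)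
  have hlt : volume {y | p + planeParam W y ∈ ball q r} < ⊤ :=
    (measure_mono hsub).trans_lt measure_ball_lt_top
  have h1 := norm_setIntegral_le_of_norm_le_const (μ := volume)
    (f := fun y => ‖F (p + planeParam W y)‖ ^ 2) (C := B ^ 2) hlt (fun y _ => by
      rw [Real.norm_of_nonneg (sq_nonneg _)]
      exact pow_le_pow_left₀ (norm_nonneg _) (hB _) 2)
  refine (Real.le_norm_self _).trans (h1.trans (mul_le_mul_of_nonneg_left ?_ (sq_nonneg _)))
  exact measureReal_mono hsub measure_ball_lt_top.ne

/-- Local constancy: if `|F(x)|` is controlled by `|F(x + j u)|`, `1 ≤ j ≤ N`, for all `u ∈ W` with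
`|u| < r`, then the mass of `F` in a ball of the plane `p + W` is at most its share of the mass. -/
theorem setIntegral_planeMeasure_le_of_le_sum (W : Submodule ℝ (Euc n)) {p q : Euc n}
    {F : Euc n → ℂ} (hF : Continuous F) {N : ℕ} {r t s C E : ℝ} (hr : 0 < r) (ht : 0 < t)
    (hmem : ∀ x ∈ ball p t, ∀ u ∈ W, ‖u‖ < r → ∀ j ∈ Finset.Icc 1 N, x + (j : ℝ) • u ∈ ball q s)
    (hle : ∀ x ∈ ball p t, ∀ u ∈ W, ‖u‖ < r →
      ‖F x‖ ≤ C * ∑ j ∈ Finset.Icc 1 N, ‖F (x + (j : ℝ) • u)‖ + E) :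
    ∫ x in ball p t, ‖F x‖ ^ 2 ∂(planeMeasure W p) ≤
      2 * C ^ 2 * N ^ 2 * (t / r) ^ Module.finrank ℝ W *
        (∫ x in ball q s, ‖F x‖ ^ 2 ∂(planeMeasure W p)) +
      2 * E ^ 2 * (t ^ Module.finrank ℝ W *
        volume.real (ball (0 : Euc (Module.finrank ℝ W)) 1)) := by
  set k := Module.finrank ℝ W with hk
  set ι := planeParam W with hι
  have hFc : Continuous fun y => ‖F (p + ι y)‖ ^ 2 := by fun_prop
  rw [setIntegral_planeMeasure, setIntegral_planeMeasure, planeParam_preimage_ball]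
  set J := ∫ y in {y | p + ι y ∈ ball q s}, ‖F (p + ι y)‖ ^ 2 with hJ
  have hball : ∀ y ∈ ball (0 : Euc k) t, p + ι y ∈ ball p t := fun y hy => by
    have : y ∈ {y | p + ι y ∈ ball p t} := by
      rw [hι, planeParam_preimage_ball]; exact hy
    exact this
  -- Averaging is applied to the square of `F`: Cauchy–Schwarz over the `N` terms costs one factor
  -- `N`, the sum over dilates in `le_average_of_forall_le_sum` another.
  have hpoint : ∀ y ∈ ball (0 : Euc k) t, ‖F (p + ι y)‖ ^ 2 ≤
      2 * C ^ 2 * N * N * J / volume.real (ball (0 : Euc k) r) + 2 * E ^ 2 := by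
    intro y hy
    have hadd : ∀ (j : ℕ) (u : Euc k), p + ι (y + (j : ℝ) • u) = p + ι y + (j : ℝ) • ι u := by
      intro j u
      rw [map_add, map_smul, add_assoc]
    refine le_average_of_forall_le_sum (f := fun y => ‖F (p + ι y)‖ ^ 2) hFc
      (fun _ => sq_nonneg _) (measurableSet_planeParam_preimage_ball W p q s)
      (isBounded_ball.subset (planeParam_preimage_ball_subset W p q s)) hr (by positivity) ?_ ?_
    · intro u hu j hj
      rw [mem_ofPred_eq, ← hι, hadd]
      refine hmem _ (hball y hy) _ (planeParam_mem W u) ?_ j hj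
      rw [← hι, ι.norm_map]
      simpa using hu
    · intro u hu
      have h1 := hle _ (hball y hy) _ (planeParam_mem W u)
        (by rw [← hι, ι.norm_map]; simpa using hu)
      have h2 : (∑ j ∈ Finset.Icc 1 N, ‖F (p + ι y + (j : ℝ) • ι u)‖) ^ 2 ≤
          N * ∑ j ∈ Finset.Icc 1 N, ‖F (p + ι y + (j : ℝ) • ι u)‖ ^ 2 := by
        simpa using sq_sum_le_card_mul_sum_sq (s := Finset.Icc 1 N)
          (f := fun j : ℕ => ‖F (p + ι y + (j : ℝ) • ι u)‖)
      simp_rw [hadd]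
      have h3 := pow_le_pow_left₀ (norm_nonneg _) h1 2
      have h4 := mul_le_mul_of_nonneg_left h2 (by positivity : 0 ≤ 2 * C ^ 2)
      refine h3.trans ?_
      refine (add_sq_le (a := C * ∑ j ∈ Finset.Icc 1 N, ‖F (p + ι y + (j : ℝ) • ι u)‖)).trans ?_
      rw [mul_pow]
      linarith
  have hvr := volume_real_ball_zero (k := k) hr
  have hvt := volume_real_ball_zero (k := k) ht
  have hv1 : 0 < volume.real (ball (0 : Euc k) 1) := volume_real_ball_pos one_pos
  have hint : IntegrableOn (fun y => ‖F (p + ι y)‖ ^ 2) (ball (0 : Euc k) t) :=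
    (hFc.continuousOn.integrableOn_compact (isCompact_closedBall 0 t)).mono_set
      ball_subset_closedBall
  have h1 := setIntegral_mono_on hint (integrableOn_const measure_ball_lt_top.ne)
    measurableSet_ball hpoint
  rw [setIntegral_const, smul_eq_mul, hvr, hvt] at h1
  refine h1.trans_eq ?_
  rw [div_pow]
  field_simp

end Planes

/-! ### Wave packets tangent to `V` -/

section Packets

variable {d σ : ℕ} {cex : ℝ} {Nex : ℕ} {A rX rN rW : ℝ} {φ : Euc (d + 1) → Euc d → ℝ}
  {a : Euc (d + 1) → Euc d → ℂ} {lam : ℝ} {P : WavePacketProfile d} {R : ℝ}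

theorem wavePacket_eq_zero (Θ : CapSystem P R) (hR : 0 < R) (δ : ℝ) (f : Euc d → ℂ) {c ω : Euc d}
    (k : Fin d → ℤ) (hω : ω ∉ ball c (R ^ (-(1 / 2) : ℝ))) : wavePacket Θ δ f c k ω = 0 := by
  have h : P.bump (R ^ (1 / 2 : ℝ) • (ω - c)) = 0 := by
    by_contra h0
    have h1 := P.bump_support h0
    rw [mem_ball_zero_iff, norm_smul, Real.norm_of_nonneg (Real.rpow_nonneg hR.le _)] at h1
    apply hω
    rwa [mem_ball_iff_norm, Real.rpow_neg hR.le, ← one_div, lt_div_iff₀' (by positivity)]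
  rw [wavePacket, h, Complex.ofReal_zero, zero_mul]

/-- A function that is concentrated on wave packets from `S` is negligible away from the caps
of `S`. -/
theorem ConcentratedOn.exists_bound {Θ : CapSystem P R} (hR : 0 < R) {δ K : ℝ}
    {S : Set (Euc d × (Fin d → ℤ))} {g : Euc d → ℂ} (h : ConcentratedOn Θ δ Nex K S g) :
    ∀ᵐ ω ∂(volume.restrict (unitBall d)),
      (∃ p ∈ S, ω ∈ ball p.1 (R ^ (-(1 / 2) : ℝ))) ∨
        ‖g ω‖ ≤ K * R ^ (-Real.sqrt Nex) * l2norm g := by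
  obtain ⟨e, he, hae⟩ := h
  filter_upwards [hae] with ω hω
  by_cases hS : ∃ p ∈ S, ω ∈ ball p.1 (R ^ (-(1 / 2) : ℝ))
  · exact Or.inl hS
  · push Not at hS
    right
    have h0 : ∑' p : S, wavePacket Θ δ g p.1.1 p.1.2 ω = 0 := by
      rw [← tsum_zero (α := ℂ) (β := S)]
      congr 1
      ext p
      exact wavePacket_eq_zero Θ hR δ g _ (hS p.1 p.2)
    rw [h0, sub_zero] at hω
    refine hω.trans (mul_le_mul_of_nonneg_right ?_ ENNReal.toReal_nonneg)
    exact (le_abs_self e).trans (he _ le_rfl)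

/-- The dimension `n - dim V` is admissible because `dim V ≥ 1` and `σ ≤ n - 1`. This serves the
case without tangent packets, where no frequency is available to build `V'`. -/
theorem finrank_orthogonal_bounds (hσ : σ ≤ d) {V : Submodule ℝ (Euc (d + 1))} (hV : V ≠ ⊥) :
    muDim (d + 1) σ (Module.finrank ℝ V) ≤ (Module.finrank ℝ Vᗮ : ℤ) ∧
      (Module.finrank ℝ Vᗮ : ℤ) ≤ ((d + 1 : ℕ) : ℤ) - (Module.finrank ℝ V : ℤ) := by
  have h1 := Submodule.finrank_add_finrank_orthogonal V
  rw [finrank_euclideanSpace_fin] at h1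
  have h2 : 1 ≤ Module.finrank ℝ V := Submodule.one_le_finrank_iff.2 hV
  rw [muDim]
  push_cast
  omega

theorem ConcentratedOn.nonneg {Θ : CapSystem P R} (hR : 0 < R) {δ K : ℝ}
    {S : Set (Euc d × (Fin d → ℤ))} {g : Euc d → ℂ} (h : ConcentratedOn Θ δ Nex K S g) :
    0 ≤ K := by
  obtain ⟨e, he, -⟩ := h
  exact nonneg_of_mul_nonneg_left ((abs_nonneg e).trans (he _ le_rfl)) (Real.rpow_pos_of_pos hR _)

/-- The packets tangent to `V` have almost the same spatial gradient in the directions of a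
subspace transverse to `V`. -/
theorem exists_transverse_of_tangentPackets (hφ : IsReducedPhase d σ cex Nex rX rN rW φ)
    (hσ : σ ≤ d) (hc0 : 0 ≤ cex) (hc : cex ≤ 1 / (100 * (d + 1))) (hN : 3 ≤ Nex)
    (Θ : CapSystem P R) {δ δm Cang Cτ ρ rτ : ℝ} (hR : 1 ≤ R) (hδm : 0 ≤ δm) (hδm' : δm ≤ 1 / 10)
    (hCang : |Cang| * R ^ (-(1 / 2) + δm) ≤ 1 / 100) (hlam : 0 < lam)
    (hlamR : lam⁻¹ * (4 * R) < min rX rN) (hρ : R ^ (1 / 2 : ℝ) < ρ) (hrτ : 0 < rτ)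
    (hrτ' : rτ ≤ Cτ * ρ ^ (-(1 / 2) + δm)) (xbar : Euc (d + 1)) (τ₀ : Euc d)
    {V : Submodule ℝ (Euc (d + 1))} (hV : V ≠ ⊥) :
    ∃ V' : Submodule ℝ (Euc (d + 1)),
      muDim (d + 1) σ (Module.finrank ℝ V) ≤ (Module.finrank ℝ V' : ℤ) ∧
      (Module.finrank ℝ V' : ℤ) ≤ ((d + 1 : ℕ) : ℤ) - (Module.finrank ℝ V : ℤ) ∧
      (∀ v ∈ V, ∀ v' ∈ V', v ≠ 0 → v' ≠ 0 → 1 / 4 ≤ InnerProductGeometry.angle v v') ∧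
      ∃ Ξ : Fin (d + 1) → ℝ,
        ∀ p ∈ tangentPackets Θ rX rN rW φ lam δ δm Cang V xbar τ₀ rτ,
          p.1 ∈ freqBall d rW ∧ ‖xbar‖ < 2 * R ∧ ∀ u ∈ V',
            |∑ k, u k * (dX k φ (lam⁻¹ • xbar) p.1 - Ξ k)| ≤
              100 * (d + 1) ^ 6 * (|Cang| + 8 + Cτ ^ 2) * R ^ (-(1 / 2) + δm) * ‖u‖ := by
  have hR0 : 0 < R := by linarith
  rcases (tangentPackets Θ rX rN rW φ lam δ δm Cang V xbar τ₀ rτ).eq_empty_or_nonempty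
    with hS | ⟨p₀, hp₀⟩
  · obtain ⟨h1, h2⟩ := finrank_orthogonal_bounds hσ hV
    refine ⟨Vᗮ, h1, h2, fun v hv v' hv' _ _ => ?_, 0, fun p hp => ?_⟩
    · rw [InnerProductGeometry.inner_eq_zero_iff_angle_eq_pi_div_two v v' |>.1
        ((Submodule.mem_orthogonal _ _).1 hv' v hv)]
      linarith [Real.pi_gt_three]
    · rw [hS] at hp
      exact absurd hp (notMem_empty p)
  · set ε := |Cang| * R ^ (-(1 / 2) + δm) with hε
    have hfreq : ∀ p ∈ tangentPackets Θ rX rN rW φ lam δ δm Cang V xbar τ₀ rτ,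
        p.1 ∈ freqBall d rW ∧ ‖xbar‖ < 2 * R := by
      rintro p ⟨-, -, ⟨x, hx, hxB⟩, -⟩
      refine ⟨hx.2.1, ?_⟩
      have h1 : ‖x‖ < R := by simpa using hx.1
      have h2 : R ^ (1 / 2 + δm) ≤ R :=
        (Real.rpow_le_rpow_of_exponent_le hR (by linarith)).trans_eq (Real.rpow_one R)
      rw [mem_ball_iff_norm'] at hxB
      have h3 := norm_add_le (xbar - x) x
      rw [sub_add_cancel] at h3
      linarith
    have hang : ∀ p ∈ tangentPackets Θ rX rN rW φ lam δ δm Cang V xbar τ₀ rτ,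
        AngleToLE (gaussL φ lam xbar p.1) V ε := by
      rintro p ⟨-, ⟨v, hv, hv0, hle⟩, -⟩
      exact ⟨v, hv, hv0, hle.trans
        (mul_le_mul_of_nonneg_right (le_abs_self _) (Real.rpow_nonneg hR0.le _))⟩
    have hz : lam⁻¹ • xbar ∈ spaceBox d rX rN := by
      refine mem_spaceBox_of_norm_lt (lt_of_le_of_lt ?_ hlamR)
      rw [norm_smul, Real.norm_of_nonneg (inv_nonneg.2 hlam.le)]
      exact mul_le_mul_of_nonneg_left (by linarith [(hfreq p₀ hp₀).2]) (inv_nonneg.2 hlam.le)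
    obtain ⟨V', h1, h2, h3, h4⟩ := hφ.exists_transverse hσ hc0 hc hN hz hCang
      (hfreq p₀ hp₀).1 (hang p₀ hp₀)
    -- The reference gradient is that of one fixed tangent packet.
    refine ⟨V', h1, h2, h3, fun k => dX k φ (lam⁻¹ • xbar) p₀.1, fun p hp =>
      ⟨(hfreq p hp).1, (hfreq p hp).2, fun u hu => ?_⟩⟩
    refine (h4 p.1 (hfreq p hp).1 (hang p hp) u hu).trans
      (mul_le_mul_of_nonneg_right ?_ (norm_nonneg u))
    rw [mul_assoc _ (|Cang| + 8 + Cτ ^ 2)]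
    refine mul_le_mul_of_nonneg_left ?_ (by positivity)
    have hnear : ∀ p ∈ tangentPackets Θ rX rN rW φ lam δ δm Cang V xbar τ₀ rτ,
        dist p.1 τ₀ ≤ R ^ (-(1 / 2) : ℝ) + rτ / 10 := by
      rintro p ⟨-, -, -, ⟨η, hη1, hη2⟩⟩
      have := dist_triangle p.1 η τ₀
      rw [mem_ball'] at hη1
      rw [mem_ball] at hη2
      linarith
    have hdist : ‖p.1 - p₀.1‖ ≤ 2 * (R ^ (-(1 / 2) : ℝ)) + rτ / 5 := by
      rw [← dist_eq_norm]
      have := dist_triangle_right p.1 p₀.1 τ₀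
      linarith [hnear p hp, hnear p₀ hp₀]
    have hsq : ‖p.1 - p₀.1‖ ^ 2 ≤ 8 * (R ^ (-(1 / 2) : ℝ)) ^ 2 + rτ ^ 2 := by
      have := pow_le_pow_left₀ (norm_nonneg _) hdist 2
      nlinarith [sq_nonneg (2 * (R ^ (-(1 / 2) : ℝ)) - rτ / 5)]
    have hR1 : (R ^ (-(1 / 2) : ℝ)) ^ 2 ≤ R ^ (-(1 / 2) + δm) := by
      rw [← Real.rpow_natCast, ← Real.rpow_mul hR0.le]
      exact Real.rpow_le_rpow_of_exponent_le hR (by push_cast; linarith)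
    -- Here `ρ > R^{1/2}` matters: the square of the radius of `τ` is `O(ρ^{-1+2δ_m})`, hence
    -- `O(R^{-1/2+δ_m})`, the same size as the angular error.
    have hrt : rτ ^ 2 ≤ Cτ ^ 2 * R ^ (-(1 / 2) + δm) := by
      have hρ0 : 0 < ρ := (Real.rpow_pos_of_pos hR0 _).trans hρ
      have h5 := pow_le_pow_left₀ hrτ.le hrτ' 2
      rw [mul_pow] at h5
      refine h5.trans (mul_le_mul_of_nonneg_left ?_ (sq_nonneg _))
      have h6 : (ρ ^ (-(1 / 2) + δm)) ^ 2 = ρ ^ (-1 + 2 * δm) := by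
        rw [← Real.rpow_natCast, ← Real.rpow_mul hρ0.le]
        congr 1
        push_cast
        ring
      have h7 : ρ ^ (-1 + 2 * δm) ≤ (R ^ (1 / 2 : ℝ)) ^ (-1 + 2 * δm) :=
        Real.rpow_le_rpow_of_nonpos (Real.rpow_pos_of_pos hR0 _) hρ.le (by linarith)
      rw [h6]
      refine h7.trans_eq ?_
      rw [← Real.rpow_mul hR0.le]
      congr 1
      ring
    rw [hε]
    nlinarith

/-- Bound for the first derivative of the phase in the directions of `V'`. -/
theorem abs_gradient_sub_le (hφ : IsReducedPhase d σ cex Nex rX rN rW φ) (hc : cex ≤ 1)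
    (hN : 3 ≤ Nex) {z z' : Euc (d + 1)} {ω ω' : Euc d} (hz : z ∈ spaceBox d rX rN)
    (hz' : z' ∈ spaceBox d rX rN) (hω : ω ∈ freqBall d rW) (hω' : ω' ∈ freqBall d rW)
    (u : Euc (d + 1)) (Ξ : Fin (d + 1) → ℝ) :
    |∑ k, u k * dX k φ z' ω' - ∑ k, u k * Ξ k| ≤
      |∑ k, u k * (dX k φ z ω - Ξ k)| +
        (d + 1) ^ 2 * (‖z' - z‖ + 2 * ‖ω' - ω‖) * ‖u‖ := by
  have hU := isOpen_spaceBox (d := d) rX rN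
  have hW := isOpen_freqBall d rW
  have h1 : ∀ k, |dX k φ z' ω' - dX k φ z ω| ≤ (d + 1) * (‖z' - z‖ + 2 * ‖ω' - ω‖) := by
    intro k
    have h2 := (hφ.smoothOn.smoothOn_dX hU hW k).abs_sub_le_left hU hW (convex_spaceBox rX rN) hω'
      (fun i x hx => hφ.abs_dX_dX_le hc hN hx hω' i k) hz hz'
    have h3 := (hφ.smoothOn.smoothOn_dX hU hW k).abs_sub_le_right hU hW (convex_freqBall d rW) hz
      (fun j ω hω => hφ.abs_dW_dX_le hc hz hω j k) hω hω'
    have h4 := Euc.sum_abs_le (z' - z)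
    have h5 := Euc.sum_abs_le (ω' - ω)
    have h6 := abs_add_le (dX k φ z' ω' - dX k φ z ω') (dX k φ z ω' - dX k φ z ω)
    rw [sub_add_sub_cancel] at h6
    push_cast at h4
    nlinarith [norm_nonneg (ω' - ω)]
  have h2 : ∑ k, u k * dX k φ z' ω' - ∑ k, u k * Ξ k =
      ∑ k, u k * (dX k φ z ω - Ξ k) + ∑ k, u k * (dX k φ z' ω' - dX k φ z ω) := by
    rw [← Finset.sum_sub_distrib, ← Finset.sum_add_distrib]
    refine Finset.sum_congr rfl fun k _ => ?_
    ring
  have h3 : |∑ k, u k * (dX k φ z' ω' - dX k φ z ω)| ≤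
      ∑ k, |u k| * ((d + 1) * (‖z' - z‖ + 2 * ‖ω' - ω‖)) := by
    refine Finset.abs_sum_le_sum_abs _ _ |>.trans (Finset.sum_le_sum fun k _ => ?_)
    rw [abs_mul]
    exact mul_le_mul_of_nonneg_left (h1 k) (abs_nonneg _)
  rw [← Finset.sum_mul] at h3
  have h4 := Euc.sum_abs_le u
  push_cast at h4
  rw [h2]
  refine (abs_add_le _ _).trans (add_le_add_right (h3.trans ?_) _)
  calc (∑ k, |u k|) * ((d + 1) * (‖z' - z‖ + 2 * ‖ω' - ω‖))
      ≤ ((d + 1) * ‖u‖) * ((d + 1) * (‖z' - z‖ + 2 * ‖ω' - ω‖)) :=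
        mul_le_mul_of_nonneg_right h4 (by positivity)
    _ = (d + 1) ^ 2 * (‖z' - z‖ + 2 * ‖ω' - ω‖) * ‖u‖ := by ring

end Packets

/-! ### Local constancy along the transverse subspace. -/

section LocalConstancy

variable {d σ : ℕ} {cex : ℝ} {Nex : ℕ} {A rX rN rW : ℝ} {φ : Euc (d + 1) → Euc d → ℝ}
  {a : Euc (d + 1) → Euc d → ℂ} {lam : ℝ} {P : WavePacketProfile d} {R : ℝ}

/-- `T^λ g` is locally constant at scale `R^{1/2}` in directions in which the spatial gradients of
the phase at the relevant frequencies almost agree. -/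
theorem norm_opT_le_sum_of_concentratedOn (hφ : IsReducedPhase d σ cex Nex rX rN rW φ)
    (ha : IsReducedAmplitude d Nex A rX rN rW a) (hc0 : 0 ≤ cex) (hc : cex ≤ 1 / 100)
    (hN : 3 ≤ Nex) {Θ : CapSystem P R} {δ δm K B : ℝ} (hR : 1 ≤ R) (hδm : 0 ≤ δm)
    (hδm' : δm ≤ 1 / 10) (hlam : R ≤ lam) (hlamR : lam⁻¹ * (4 * R) < min rX rN) (hB : 0 ≤ B)
    {xbar : Euc (d + 1)} {V' : Submodule ℝ (Euc (d + 1))} {Ξ : Fin (d + 1) → ℝ}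
    {S : Set (Euc d × (Fin d → ℤ))}
    (hS : ∀ p ∈ S, p.1 ∈ freqBall d rW ∧ ‖xbar‖ < 2 * R ∧ ∀ u ∈ V',
      |∑ k, u k * (dX k φ (lam⁻¹ • xbar) p.1 - Ξ k)| ≤ B * R ^ (-(1 / 2) + δm) * ‖u‖)
    {g : Euc d → ℂ} (hg : MemLp g 2 volume) (hconc : ConcentratedOn Θ δ Nex K S g)
    {x u : Euc (d + 1)} (hu : u ∈ V') (hun : ‖u‖ ≤ R ^ (1 / 2 - 3 * δm))
    (hline : ∀ t ∈ Icc 0 (Nex : ℝ), ‖x + t • u - xbar‖ ≤ 2 * R ^ (1 / 2 + δm)) :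
    ‖opT φ a lam g x‖ ≤ 2 ^ Nex * ∑ j ∈ Finset.Icc 1 Nex, ‖opT φ a lam g (x + (j : ℝ) • u)‖ +
      (2 ^ Nex * Nex.factorial * A * (2 * Real.pi * (B + 4 * (d + 1) ^ 2) * R ^ (-δm)) ^ Nex *
          (volume.real (unitBall d) ^ (1 / 2 : ℝ) * l2norm g)
        + 2 ^ Nex * A * (K * R ^ (-Real.sqrt Nex) * l2norm g) * volume.real (unitBall d)) := by
  have hR0 : 0 < R := by linarith
  have hlam0 : 0 < lam := by linarith
  have hA := ha.nonneg
  have hd0 : (0 : ℝ) ≤ d := Nat.cast_nonneg d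
  have hl : 0 ≤ l2norm g := ENNReal.toReal_nonneg
  have hK := hconc.nonneg hR0
  set D := 2 * Real.pi * (B + 4 * (d + 1) ^ 2) * R ^ (-δm) with hD
  have hD0 : 0 ≤ D := by positivity
  -- `ξ` is the common frequency in direction `u`. Outside the caps of `S`, `g` is negligible;
  -- inside them the kernel difference is small.
  refine norm_opT_le_sum hφ ha hg (ξ := ∑ k, u k * Ξ k) (by positivity) (by positivity) ?_
  filter_upwards [hconc.exists_bound hR0] with ω hω
  rcases hω with ⟨p, hp, hωp⟩ | h
  swap
  · exact Or.inr h
  left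
  by_cases hωW : ω ∈ freqBall d rW
  swap
  · have hz : ∀ t, kernelLine φ a lam x u (∑ k, u k * Ξ k) ω t = 0 := fun t => by
      rw [← norm_eq_zero, norm_kernelLine, kernelT_eq_zero ha _ hωW, norm_zero]
    rw [fwdDiff_iter_zero_eq_sum]
    simp only [hz, mul_zero, Finset.sum_const_zero, norm_zero]
    positivity
  obtain ⟨hpW, hxbar, hgrad⟩ := hS p hp
  have hs0 : R ^ (1 / 2 + δm) ≤ R :=
    (Real.rpow_le_rpow_of_exponent_le hR (by linarith)).trans_eq (Real.rpow_one R)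
  have hbox : ∀ y : Euc (d + 1), ‖y‖ ≤ 4 * R → lam⁻¹ • y ∈ spaceBox d rX rN := fun y hy => by
    refine mem_spaceBox_of_norm_lt (lt_of_le_of_lt ?_ hlamR)
    rw [norm_smul, Real.norm_of_nonneg (inv_nonneg.2 hlam0.le)]
    exact mul_le_mul_of_nonneg_left hy (inv_nonneg.2 hlam0.le)
  have hlinebox : ∀ t ∈ Icc 0 (Nex : ℝ), lam⁻¹ • (x + t • u) ∈ spaceBox d rX rN := by
    intro t ht
    refine hbox _ ?_
    have := norm_add_le (x + t • u - xbar) xbar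
    rw [sub_add_cancel] at this
    linarith [hline t ht]
  refine norm_fwdDiff_kernelLine_le hφ ha hc0 hc (hR.trans hlam) hωW hD0 hlinebox ?_ ?_
  · intro t ht
    refine (abs_gradient_sub_le hφ (by linarith) hN (hbox xbar (by linarith)) (hlinebox t ht)
      hpW hωW u Ξ).trans ?_
    have h1 : ‖lam⁻¹ • (x + t • u) - lam⁻¹ • xbar‖ ≤ 2 * R ^ (-(1 / 2) + δm) := by
      rw [← smul_sub, norm_smul, Real.norm_of_nonneg (inv_nonneg.2 hlam0.le)]
      have h2 : lam⁻¹ ≤ R⁻¹ := inv_anti₀ hR0 hlam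
      have h3 : R ^ (-(1 / 2) + δm) = R⁻¹ * R ^ (1 / 2 + δm) := by
        rw [← Real.rpow_neg_one, ← Real.rpow_add hR0]
        congr 1
        ring
      rw [h3]
      calc lam⁻¹ * ‖x + t • u - xbar‖ ≤ R⁻¹ * (2 * R ^ (1 / 2 + δm)) :=
            mul_le_mul h2 (hline t ht) (norm_nonneg _) (inv_nonneg.2 hR0.le)
        _ = _ := by ring
    have h2 : ‖ω - p.1‖ ≤ R ^ (-(1 / 2) + δm) := by
      rw [mem_ball_iff_norm] at hωp
      exact hωp.le.trans (Real.rpow_le_rpow_of_exponent_le hR (by linarith))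
    have h3 := hgrad u hu
    have h4 : R ^ (-(1 / 2) + δm) * ‖u‖ ≤ R ^ (-δm) := by
      calc R ^ (-(1 / 2) + δm) * ‖u‖ ≤ R ^ (-(1 / 2) + δm) * R ^ (1 / 2 - 3 * δm) :=
            mul_le_mul_of_nonneg_left hun (Real.rpow_nonneg hR0.le _)
        _ = R ^ (-2 * δm) := by
            rw [← Real.rpow_add hR0]
            congr 1
            ring
        _ ≤ R ^ (-δm) := Real.rpow_le_rpow_of_exponent_le hR (by linarith)
    have h5 : D / (2 * Real.pi) = (B + 4 * (d + 1) ^ 2) * R ^ (-δm) := by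
      rw [hD]
      field_simp
    rw [h5]
    have h6 : ((d : ℝ) + 1) ^ 2 * (‖lam⁻¹ • (x + t • u) - lam⁻¹ • xbar‖ + 2 * ‖ω - p.1‖) * ‖u‖ ≤
        (d + 1) ^ 2 * (4 * R ^ (-(1 / 2) + δm)) * ‖u‖ := by
      gcongr
      linarith
    have h7 := mul_le_mul_of_nonneg_left h4 (by positivity : 0 ≤ B + 4 * ((d : ℝ) + 1) ^ 2)
    linarith
  · have h1 := Euc.sum_abs_le u
    have h2 : (∑ i, |u i|) ^ 2 ≤ (((d + 1 : ℕ) : ℝ) * ‖u‖) ^ 2 :=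
      pow_le_pow_left₀ (Finset.sum_nonneg fun _ _ => abs_nonneg _) h1 2
    have h3 : ‖u‖ ^ 2 ≤ (R ^ (-δm)) ^ 2 * R := by
      refine (pow_le_pow_left₀ (norm_nonneg u) hun 2).trans ?_
      rw [← Real.rpow_natCast, ← Real.rpow_mul hR0.le, ← Real.rpow_natCast, ← Real.rpow_mul hR0.le]
      nth_rewrite 3 [← Real.rpow_one R]
      rw [← Real.rpow_add hR0]
      exact Real.rpow_le_rpow_of_exponent_le hR (by push_cast; linarith)
    have h4 : ((d : ℝ) + 1) ≤ 2 * Real.pi * (B + 4 * (d + 1) ^ 2) := by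
      have := Real.pi_gt_three
      nlinarith
    have h5 : ((d : ℝ) + 1) ^ 2 ≤ (2 * Real.pi * (B + 4 * (d + 1) ^ 2)) ^ 2 :=
      pow_le_pow_left₀ (by positivity) h4 2
    calc (∑ i, |u i|) ^ 2 ≤ (((d + 1 : ℕ) : ℝ) * ‖u‖) ^ 2 := h2
      _ = ((d : ℝ) + 1) ^ 2 * ‖u‖ ^ 2 := by push_cast; ring
      _ ≤ (2 * Real.pi * (B + 4 * (d + 1) ^ 2)) ^ 2 * ((R ^ (-δm)) ^ 2 * lam) := by
          refine mul_le_mul h5 (h3.trans ?_) (sq_nonneg _) (sq_nonneg _)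
          exact mul_le_mul_of_nonneg_left hlam (sq_nonneg _)
      _ = D ^ 2 * lam := by rw [hD]; ring

end LocalConstancy

/-! ### The estimate on a plane. -/

section Assembly

variable {d σ : ℕ} {cex : ℝ} {Nex : ℕ} {A rX rN rW : ℝ} {φ : Euc (d + 1) → Euc d → ℝ}
  {a : Euc (d + 1) → Euc d → ℂ} {lam : ℝ} {P : WavePacketProfile d} {R : ℝ}

/-- An upper bound for the volumes of the unit balls of dimension at most `n`. -/
def maxBallVolume (n : ℕ) : ℝ :=
  ∑ k ∈ Finset.range (n + 1), volume.real (ball (0 : Euc k) 1)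

theorem le_maxBallVolume {n k : ℕ} (hk : k ≤ n) :
    volume.real (ball (0 : Euc k) 1) ≤ maxBallVolume n :=
  Finset.single_le_sum (f := fun k => volume.real (ball (0 : Euc k) 1))
    (fun _ _ => measureReal_nonneg) (Finset.mem_range.2 (by omega))

theorem maxBallVolume_nonneg (n : ℕ) : 0 ≤ maxBallVolume n :=
  Finset.sum_nonneg fun _ _ => measureReal_nonneg

/-- Trading a power of `R` for a small power of the `L²` norm. -/
theorem le_rpow_mul_rpow_of_le {J C R l n δ δm : ℝ} (hJ : 0 ≤ J) (hC : 1 ≤ C) (hR : 1 ≤ R)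
    (hl : 0 ≤ l) (hn : 0 ≤ n) (hδ : 0 < δ) (hδm : δ ≤ δm) (h : J ≤ C * R ^ n * l ^ 2) :
    J ≤ C * R ^ (n * δm) * l ^ (2 * δ / (1 + δ)) * J ^ (1 / (1 + δ)) := by
  have h1 : 0 < 1 + δ := by linarith
  have hR0 : 0 < R := by linarith
  have hθ0 : 0 ≤ δ / (1 + δ) := by positivity
  have hθ1 : δ / (1 + δ) ≤ 1 := by rw [div_le_one h1]; linarith
  have hθδ : δ / (1 + δ) ≤ δ := div_le_self hδ.le (by linarith)
  have hsplit : J = J ^ (δ / (1 + δ)) * J ^ (1 / (1 + δ)) := by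
    rw [← Real.rpow_add' hJ (by rw [← add_div, add_comm, div_self h1.ne']; norm_num), ← add_div,
      add_comm, div_self h1.ne', Real.rpow_one]
  have hpow : J ^ (δ / (1 + δ)) ≤ C * R ^ (n * δm) * l ^ (2 * δ / (1 + δ)) := by
    refine (Real.rpow_le_rpow hJ h hθ0).trans ?_
    rw [Real.mul_rpow (by positivity) (by positivity), Real.mul_rpow (by positivity) (by positivity)]
    have e1 : C ^ (δ / (1 + δ)) ≤ C :=
      (Real.rpow_le_rpow_of_exponent_le hC hθ1).trans_eq (Real.rpow_one C)
    have e2 : (R ^ n) ^ (δ / (1 + δ)) ≤ R ^ (n * δm) := by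
      rw [← Real.rpow_mul hR0.le]
      exact Real.rpow_le_rpow_of_exponent_le hR
        (mul_le_mul_of_nonneg_left (hθδ.trans hδm) hn)
    have e3 : (l ^ 2) ^ (δ / (1 + δ)) = l ^ (2 * δ / (1 + δ)) := by
      rw [← Real.rpow_natCast, ← Real.rpow_mul hl]
      congr 1
      push_cast
      ring
    rw [e3]
    gcongr
  nth_rewrite 1 [hsplit]
  exact mul_le_mul_of_nonneg_right hpow (Real.rpow_nonneg hJ _)

set_option maxHeartbeats 1000000 in
/-- The estimate on a plane without loss in the `L²` norm. -/
theorem setIntegral_opT_le (hφ : IsReducedPhase d σ cex Nex rX rN rW φ)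
    (ha : IsReducedAmplitude d Nex A rX rN rW a) (hc0 : 0 ≤ cex) (hc : cex ≤ 1 / 100)
    (hN : 3 ≤ Nex) {Θ : CapSystem P R} {δ δm K B ρ : ℝ} (hR : 1 ≤ R) (hδm : 0 ≤ δm)
    (hδm' : δm ≤ 1 / 10) (hNδ : Real.sqrt Nex ≤ δm * Nex) (hNd : (d + 1 : ℝ) ≤ Real.sqrt Nex)
    (hlam : R ≤ lam) (hlamR : lam⁻¹ * (4 * R) < min rX rN) (hB : 0 ≤ B)
    (hρ0 : 0 < ρ) (hρR : ρ < R)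
    {xbar x₀ : Euc (d + 1)} {V' : Submodule ℝ (Euc (d + 1))} {Ξ : Fin (d + 1) → ℝ}
    {S : Set (Euc d × (Fin d → ℤ))}
    (hS : ∀ p ∈ S, p.1 ∈ freqBall d rW ∧ ‖xbar‖ < 2 * R ∧ ∀ u ∈ V',
      |∑ k, u k * (dX k φ (lam⁻¹ • xbar) p.1 - Ξ k)| ≤ B * R ^ (-(1 / 2) + δm) * ‖u‖)
    {g : Euc d → ℂ} (hg : MemLp g 2 volume) (hconc : ConcentratedOn Θ δ Nex K S g)
    (hx₀ : x₀ ∈ ball xbar (R ^ (1 / 2 + δm))) :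
    ∫ x in ball x₀ (ρ ^ (1 / 2 + δm)), ‖opT φ a lam g x‖ ^ 2 ∂(planeMeasure V' x₀) ≤
      (2 * (2 ^ Nex) ^ 2 * Nex ^ 2 * (2 * Nex) ^ (d + 1) + 4 ^ (d + 1)) *
        R ^ (4 * (d + 1) * δm) * (ρ / R) ^ ((Module.finrank ℝ V' : ℝ) / 2) *
        (∫ x in ball xbar (2 * R ^ (1 / 2 + δm)), ‖opT φ a lam g x‖ ^ 2 ∂(planeMeasure V' x₀)) +
      2 * maxBallVolume (d + 1) *
        (2 ^ Nex * Nex.factorial * A * (2 * Real.pi * (B + 4 * (d + 1) ^ 2)) ^ Nex *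
          volume.real (unitBall d) ^ (1 / 2 : ℝ)
          + 2 ^ Nex * A * |K| * volume.real (unitBall d)) ^ 2 *
        R ^ (-Real.sqrt Nex) * l2norm g ^ 2 := by
  have hR0 : 0 < R := by linarith
  have hA := ha.nonneg
  have hl : 0 ≤ l2norm g := ENNReal.toReal_nonneg
  have hK := hconc.nonneg hR0
  have hN1 : (1 : ℝ) ≤ Nex := by exact_mod_cast (by omega : 1 ≤ Nex)
  have hk : Module.finrank ℝ V' ≤ d + 1 := by
    simpa using Submodule.finrank_le V'
  set k := Module.finrank ℝ V' with hkdef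
  have hcont : Continuous (opT φ a lam g) := continuous_opT hφ ha hg
  set s := R ^ (1 / 2 + δm) with hs
  have hs0 : 0 < s := Real.rpow_pos_of_pos hR0 _
  set t := ρ ^ (1 / 2 + δm) with ht
  have ht0 : 0 < t := Real.rpow_pos_of_pos hρ0 _
  have hts : t ≤ s := Real.rpow_le_rpow hρ0.le hρR.le (by linarith)
  set J := ∫ x in ball xbar (2 * s), ‖opT φ a lam g x‖ ^ 2 ∂(planeMeasure V' x₀) with hJ
  have hJ0 : 0 ≤ J := setIntegral_planeMeasure_nonneg _ _ _ _
  set v := volume.real (unitBall d) with hv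
  have hv0 : 0 ≤ v := measureReal_nonneg
  set C₅ := 2 ^ Nex * Nex.factorial * A * (2 * Real.pi * (B + 4 * (d + 1) ^ 2)) ^ Nex *
    v ^ (1 / 2 : ℝ) + 2 ^ Nex * A * |K| * v with hC₅
  have hC₅0 : 0 ≤ C₅ := by positivity
  have hRpow : 1 ≤ R ^ (4 * (d + 1) * δm) := Real.one_le_rpow hR (by positivity)
  have hρR0 : 0 < ρ / R := by positivity
  have hratio : 0 < (ρ / R) ^ ((k : ℝ) / 2) := Real.rpow_pos_of_pos hρR0 _
  have hmax := maxBallVolume_nonneg (d + 1)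
  have herr : 0 ≤ 2 * maxBallVolume (d + 1) * C₅ ^ 2 * R ^ (-Real.sqrt Nex) * l2norm g ^ 2 := by
    positivity
  rw [mem_ball_iff_norm] at hx₀
  -- The separation of scales leaves room for the translates inside `2B`: `s/4 + s + s/2 < 2s`. If
  -- `ρ` is comparable to `R`, then `(ρ/R)^{k/2} ≥ 4^{-k}` and inclusion of balls suffices.
  by_cases hcase : 16 * ρ ≤ R
  · have hts4 : t ≤ s / 4 := by
      have h1 : t ≤ (R / 16) ^ (1 / 2 + δm) :=
        Real.rpow_le_rpow hρ0.le (by linarith) (by linarith)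
      have h2 : (4 : ℝ) ≤ 16 ^ (1 / 2 + δm) := by
        have h3 : (16 : ℝ) ^ (1 / 2 : ℝ) = 4 := by
          rw [← Real.sqrt_eq_rpow, show (16 : ℝ) = 4 ^ 2 by norm_num, Real.sqrt_sq (by norm_num)]
        rw [← h3]
        exact Real.rpow_le_rpow_of_exponent_le (by norm_num) (by linarith)
      rw [Real.div_rpow hR0.le (by norm_num)] at h1
      exact h1.trans (div_le_div_of_nonneg_left hs0.le (by norm_num) h2)
    set r := R ^ (1 / 2 - 3 * δm) / (2 * Nex) with hr
    have hr0 : 0 < r := by positivity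
    have hNr : Nex * r ≤ s / 2 := by
      have h1 : Nex * r = R ^ (1 / 2 - 3 * δm) / 2 := by
        rw [hr]
        field_simp
      have h2 : R ^ (1 / 2 - 3 * δm) ≤ s := Real.rpow_le_rpow_of_exponent_le hR (by linarith)
      linarith
    have hdist : ∀ x ∈ ball x₀ t, ∀ u : Euc (d + 1), ‖u‖ < r → ∀ τ ∈ Icc 0 (Nex : ℝ),
        ‖x + τ • u - xbar‖ < 2 * s := by
      intro x hx u hu τ hτ
      rw [mem_ball_iff_norm] at hx
      have h1 : x + τ • u - xbar = (x - x₀) + (x₀ - xbar) + τ • u := by abel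
      have h2 : ‖τ • u‖ ≤ Nex * r := by
        rw [norm_smul, Real.norm_of_nonneg hτ.1]
        exact mul_le_mul hτ.2 hu.le (norm_nonneg _) (by positivity)
      rw [h1]
      refine (norm_add₃_le).trans_lt ?_
      linarith
    set E := C₅ * R ^ (-Real.sqrt Nex) * l2norm g with hE
    have hE1 : 2 ^ Nex * Nex.factorial * A *
        (2 * Real.pi * (B + 4 * (d + 1) ^ 2) * R ^ (-δm)) ^ Nex * (v ^ (1 / 2 : ℝ) * l2norm g)
        + 2 ^ Nex * A * (K * R ^ (-Real.sqrt Nex) * l2norm g) * v ≤ E := by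
      -- This is where `√N_ex ≤ δ_m N_ex` turns a gain of `R^{-δ_m}` per difference into rapid
      -- decay.
      have h1 : (R ^ (-δm)) ^ Nex ≤ R ^ (-Real.sqrt Nex) := by
        rw [← Real.rpow_natCast, ← Real.rpow_mul hR0.le]
        exact Real.rpow_le_rpow_of_exponent_le hR (by linarith)
      have h2 := mul_le_mul_of_nonneg_left h1 (by positivity :
        0 ≤ 2 ^ Nex * Nex.factorial * A * (2 * Real.pi * (B + 4 * ((d : ℝ) + 1) ^ 2)) ^ Nex *
          (v ^ (1 / 2 : ℝ) * l2norm g))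
      rw [hE, hC₅, mul_pow, abs_of_nonneg hK]
      linarith
    have hmain := setIntegral_planeMeasure_le_of_le_sum V' (p := x₀) (q := xbar) (F := opT φ a lam g)
      hcont (N := Nex) (r := r) (t := t) (s := 2 * s) (C := 2 ^ Nex) (E := E) hr0 ht0
      (fun x hx u _ hur j hj => by
        rw [mem_ball_iff_norm]
        refine hdist x hx u hur j ⟨Nat.cast_nonneg j, ?_⟩
        exact_mod_cast (Finset.mem_Icc.1 hj).2)
      (fun x hx u huV hur => by
        refine (norm_opT_le_sum_of_concentratedOn hφ ha hc0 hc hN hR hδm hδm' hlam hlamR hB hS hg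
          hconc huV ?_ fun τ hτ => (hdist x hx u hur τ hτ).le).trans
            (add_le_add_right hE1 _)
        refine hur.le.trans (div_le_self (by positivity) (by linarith)))
    rw [← hJ, ← hkdef] at hmain
    refine hmain.trans (add_le_add ?_ ?_)
    · refine mul_le_mul_of_nonneg_right ?_ hJ0
      -- One factor `R^{δ_m}` comes from the radius `t` and three from the shortened step `r`.
      have h1 : t / r ≤ 2 * Nex * ((ρ / R) ^ (1 / 2 : ℝ) * R ^ (4 * δm)) := by
        have h2 : t ≤ ρ ^ (1 / 2 : ℝ) * R ^ δm := by
          rw [ht, Real.rpow_add hρ0]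
          exact mul_le_mul_of_nonneg_left (Real.rpow_le_rpow hρ0.le hρR.le hδm) (by positivity)
        have h3 : (ρ / R) ^ (1 / 2 : ℝ) * R ^ (4 * δm) * R ^ (1 / 2 - 3 * δm) =
            ρ ^ (1 / 2 : ℝ) * R ^ δm := by
          have h4 : R ^ δm = R ^ (-(1 / 2) : ℝ) * R ^ (4 * δm) * R ^ (1 / 2 - 3 * δm) := by
            rw [← Real.rpow_add hR0, ← Real.rpow_add hR0]
            congr 1
            ring
          rw [Real.div_rpow hρ0.le hR0.le, h4, Real.rpow_neg hR0.le]
          field_simp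
        rw [div_le_iff₀ hr0, hr]
        refine h2.trans_eq ?_
        rw [← h3]
        field_simp
      have h2 : (t / r) ^ k ≤ (2 * Nex) ^ (d + 1) * (R ^ (4 * (d + 1) * δm) *
          (ρ / R) ^ ((k : ℝ) / 2)) := by
        refine (pow_le_pow_left₀ (by positivity) h1 k).trans ?_
        rw [mul_pow, mul_pow ((ρ / R) ^ (1 / 2 : ℝ))]
        have e1 : (2 * (Nex : ℝ)) ^ k ≤ (2 * Nex) ^ (d + 1) :=
          pow_le_pow_right₀ (by linarith) hk
        have e2 : ((ρ / R) ^ (1 / 2 : ℝ)) ^ k = (ρ / R) ^ ((k : ℝ) / 2) := by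
          rw [← Real.rpow_natCast, ← Real.rpow_mul hρR0.le]
          congr 1
          ring
        have e3 : (R ^ (4 * δm)) ^ k ≤ R ^ (4 * (d + 1) * δm) := by
          rw [← Real.rpow_natCast, ← Real.rpow_mul hR0.le]
          refine Real.rpow_le_rpow_of_exponent_le hR ?_
          have : (k : ℝ) ≤ d + 1 := by exact_mod_cast hk
          nlinarith
        rw [e2, mul_comm ((ρ / R) ^ ((k : ℝ) / 2))]
        gcongr
      have h3 : 0 ≤ (4 : ℝ) ^ (d + 1) * R ^ (4 * (d + 1) * δm) * (ρ / R) ^ ((k : ℝ) / 2) := by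
        positivity
      have h4 := mul_le_mul_of_nonneg_left h2 (by positivity : 0 ≤ 2 * (2 ^ Nex : ℝ) ^ 2 * Nex ^ 2)
      linarith
    · have h1 : t ^ k ≤ R ^ (d + 1) := by
        have h2 : t ≤ R := hts.trans
          ((Real.rpow_le_rpow_of_exponent_le hR (by linarith)).trans_eq (Real.rpow_one R))
        exact (pow_le_pow_left₀ ht0.le h2 k).trans (pow_le_pow_right₀ hR hk)
      -- The squared error carries `R^{-2√N_ex}`; one of the two factors pays for the volume of the
      -- ball.
      have h2 : R ^ (d + 1) * R ^ (-Real.sqrt Nex) ≤ 1 := by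
        rw [← Real.rpow_natCast, ← Real.rpow_add hR0]
        refine Real.rpow_le_one_of_one_le_of_nonpos hR ?_
        push_cast
        linarith
      have h3 : t ^ k * volume.real (ball (0 : Euc k) 1) ≤ R ^ (d + 1) * maxBallVolume (d + 1) :=
        mul_le_mul h1 (le_maxBallVolume hk) measureReal_nonneg (by positivity)
      calc 2 * E ^ 2 * (t ^ k * volume.real (ball (0 : Euc k) 1))
          ≤ 2 * E ^ 2 * (R ^ (d + 1) * maxBallVolume (d + 1)) :=
            mul_le_mul_of_nonneg_left h3 (by positivity)
        _ = (2 * maxBallVolume (d + 1) * C₅ ^ 2 * R ^ (-Real.sqrt Nex) * l2norm g ^ 2) *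
            (R ^ (d + 1) * R ^ (-Real.sqrt Nex)) := by rw [hE]; ring
        _ ≤ _ := mul_le_of_le_one_right herr h2
  · refine le_add_of_le_of_nonneg ?_ herr
    have hsub : ball x₀ t ⊆ ball xbar (2 * s) := by
      refine ball_subset_ball' ?_
      rw [dist_eq_norm]
      linarith
    refine (setIntegral_planeMeasure_ball_mono V' x₀ hcont hsub).trans ?_
    rw [← hJ]
    refine le_mul_of_one_le_left hJ0 ?_
    have h1 : (1 : ℝ) ≤ 4 ^ (d + 1) * (ρ / R) ^ ((k : ℝ) / 2) := by
      have h2 : (1 : ℝ) ≤ (16 * (ρ / R)) ^ ((k : ℝ) / 2) := by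
        refine Real.one_le_rpow ?_ (by positivity)
        rw [mul_div_assoc', le_div_iff₀ hR0]
        linarith
      rw [Real.mul_rpow (by norm_num) hρR0.le] at h2
      refine h2.trans (mul_le_mul_of_nonneg_right ?_ hratio.le)
      have h3 : (16 : ℝ) ^ ((k : ℝ) / 2) = 4 ^ k := by
        rw [show (16 : ℝ) = 4 ^ (2 : ℝ) by norm_num, ← Real.rpow_mul (by norm_num),
          mul_div_cancel₀ _ (by norm_num : (2 : ℝ) ≠ 0), Real.rpow_natCast]
      rw [h3]
      exact pow_le_pow_right₀ (by norm_num) hk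
    have h2 : 0 ≤ 2 * (2 ^ Nex : ℝ) ^ 2 * Nex ^ 2 * (2 * Nex) ^ (d + 1) *
        R ^ (4 * (d + 1) * δm) * (ρ / R) ^ ((k : ℝ) / 2) := by positivity
    have h3 : (1 : ℝ) * 1 ≤ R ^ (4 * (d + 1) * δm) * (4 ^ (d + 1) * (ρ / R) ^ ((k : ℝ) / 2)) :=
      mul_le_mul hRpow h1 zero_le_one (by positivity)
    linarith

end Assembly

end

set_option maxHeartbeats 1000000 in
/-- The dimension is `n = d + 1`. The constants `K₀`, `C₀`, `ctrans`, `c₀` depend only on `n` and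
`σ`; here `K₀` makes precise `δ ≪ δ_m ≪ 1`, `C₀` is the constant in `R^{O(δ_m)}`, and `R₀` makes
precise `1 ≪ R ≪ λ`. The constants `R₀` and `C K` do not depend on `δ_m`, on the phase and
amplitude, on the scales, on `V`, `B`, `τ`, or on `g`. -/
theorem lemma5p2 (d σ : ℕ) (hd : 1 ≤ d) (hσ : σ ≤ d) (hparity : Even (d - σ)) :
    ∃ K₀ C₀ ctrans c₀ : ℝ, 1 ≤ K₀ ∧ 0 < C₀ ∧ 0 < ctrans ∧ 0 < c₀ ∧
    ∀ δ : ℝ, 0 < δ →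
    ∃ N₀ : ℕ,
    ∀ (cex : ℝ) (Nex : ℕ), 0 < cex → cex ≤ c₀ → N₀ ≤ Nex →
    ∀ rX rN rW : ℝ, 0 < rX → rX ≤ 1 → 0 < rN → rN ≤ 1 → 0 < rW → rW ≤ 1 →
    ∀ (A Cang Cτ : ℝ) (P : WavePacketProfile d),
    ∃ (R₀ : ℝ) (C : ℝ → ℝ), 1 ≤ R₀ ∧
    ∀ δm : ℝ, K₀ * δ ≤ δm → K₀ * δm ≤ 1 →
    ∀ (φ : Euc (d + 1) → Euc d → ℝ) (a : Euc (d + 1) → Euc d → ℂ),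
      IsReducedPhase d σ cex Nex rX rN rW φ → IsReducedAmplitude d Nex A rX rN rW a →
    ∀ R lam : ℝ, R₀ ≤ R → R₀ * R ≤ lam →
    ∀ (Θ : CapSystem P R) (ρ : ℝ), R ^ (1 / 2 : ℝ) < ρ → ρ < R →
    ∀ (xbar : Euc (d + 1)) (τ₀ : Euc d) (rτ : ℝ),
      τ₀ ∈ unitBall d → 0 < rτ → rτ ≤ Cτ * ρ ^ (-(1 / 2) + δm) →
    ∀ V : Submodule ℝ (Euc (d + 1)), V ≠ ⊥ →
    ∃ V' : Submodule ℝ (Euc (d + 1)),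
      (muDim (d + 1) σ (Module.finrank ℝ V) ≤ (Module.finrank ℝ V' : ℤ) ∧
        (Module.finrank ℝ V' : ℤ) ≤ ((d + 1 : ℕ) : ℤ) - (Module.finrank ℝ V : ℤ)) ∧
      (∀ v ∈ V, ∀ v' ∈ V', v ≠ 0 → v' ≠ 0 → 2 * ctrans ≤ InnerProductGeometry.angle v v') ∧
      ∀ (K : ℝ) (g : Euc d → ℂ),
        MemLp g 2 volume → Function.support g ⊆ unitBall d →
        ConcentratedOn Θ δ Nex K
          (tangentPackets Θ rX rN rW φ lam δ δm Cang V xbar τ₀ rτ) g →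
        ∀ x₀ ∈ ball xbar (R ^ (1 / 2 + δm)),
          ∃ e : ℝ, RapDec Nex (C K) R e ∧
            ∫ x in ball x₀ (ρ ^ (1 / 2 + δm)), ‖opT φ a lam g x‖ ^ 2 ∂(planeMeasure V' x₀) ≤
              C K * R ^ (C₀ * δm) * (ρ / R) ^ ((Module.finrank ℝ V' : ℝ) / 2)
                * l2norm g ^ (2 * δ / (1 + δ))
                * (∫ x in ball xbar (2 * R ^ (1 / 2 + δm)),
                    ‖opT φ a lam g x‖ ^ 2 ∂(planeMeasure V' x₀)) ^ (1 / (1 + δ))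
              + e * l2norm g ^ 2 := by
  have hd0 : (0 : ℝ) ≤ d := Nat.cast_nonneg d
  -- `10` gives `δ ≤ δ_m ≤ 1/10`. In `5(d+1)`, four parts come from the ratio of radii and one from
  -- the trivial bound. `1/8` is half the angle `1/4`. The bound on `cex` puts the second
  -- fundamental form within `1/100` of its model, and `N₀` ensures `√N_ex ≥ d + 1 + 1/δ`.
  refine ⟨10, 5 * (d + 1), 1 / 8, 1 / (100 * (d + 1)), by norm_num, by positivity, by norm_num,
    by positivity, fun δ hδ => ⟨⌈((d + 1 : ℝ) + 1 / δ) ^ 2⌉₊ + 3, ?_⟩⟩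
  intro cex Nex hcex hcex' hNex rX rN rW hrX _ hrN _ _ _ A Cang Cτ P
  have hN3 : 3 ≤ Nex := by omega
  have hsqrt : (d + 1 : ℝ) + 1 / δ ≤ Real.sqrt Nex := by
    refine Real.le_sqrt_of_sq_le ((Nat.le_ceil _).trans ?_)
    exact_mod_cast (by omega : ⌈((d + 1 : ℝ) + 1 / δ) ^ 2⌉₊ ≤ Nex)
  have hδinv : 0 < 1 / δ := by positivity
  have hmin : 0 < min rX rN := lt_min hrX hrN
  set B := 100 * ((d : ℝ) + 1) ^ 6 * (|Cang| + 8 + Cτ ^ 2) with hB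
  have hB0 : 0 ≤ B := by positivity
  set v := volume.real (unitBall d) with hv
  have hv0 : 0 ≤ v := measureReal_nonneg
  set C₃ : ℝ := 2 * (2 ^ Nex) ^ 2 * Nex ^ 2 * (2 * Nex) ^ (d + 1) + 4 ^ (d + 1) with hC₃
  have hC₃0 : 0 ≤ C₃ := by positivity
  set C₄ : ℝ := A ^ 2 * v * 3 ^ (d + 1) * maxBallVolume (d + 1) + 1 with hC₄
  have hmax := maxBallVolume_nonneg (d + 1)
  have hC₄1 : 1 ≤ C₄ := by
    have : 0 ≤ A ^ 2 * v * 3 ^ (d + 1) * maxBallVolume (d + 1) := by positivity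
    linarith
  set C₆ : ℝ → ℝ := fun K => 2 * maxBallVolume (d + 1) *
    (2 ^ Nex * Nex.factorial * A * (2 * Real.pi * (B + 4 * (d + 1) ^ 2)) ^ Nex *
      v ^ (1 / 2 : ℝ) + 2 ^ Nex * A * |K| * v) ^ 2 with hC₆
  have hC₆0 : ∀ K, 0 ≤ C₆ K := fun K => by positivity
  -- The second term keeps `B(0, 4R)` inside `λX`; the fourth power makes the angular tolerance at
  -- most `1/100`, as `-1/2 + δ_m ≤ -1/4`.
  refine ⟨1 + 6 / min rX rN + (100 * (|Cang| + 1)) ^ 4, fun K => C₃ * C₄ + C₆ K, ?_, ?_⟩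
  · have : 0 ≤ 6 / min rX rN := by positivity
    have : 0 ≤ (100 * (|Cang| + 1)) ^ 4 := by positivity
    linarith
  intro δm hδδm hδm1 φ a hφ ha R lam hR₀ hlam₀ Θ ρ hρ hρR xbar τ₀ rτ _ hrτ hrτ' V hV
  have h6 : 0 < 6 / min rX rN := by positivity
  have h100 : 0 < (100 * (|Cang| + 1)) ^ 4 := by positivity
  have hR : 1 ≤ R := by linarith
  have hR0 : 0 < R := by linarith
  have hδm0 : 0 < δm := by linarith
  have hδm' : δm ≤ 1 / 10 := by linarith
  have hlam : R ≤ lam := le_trans (le_mul_of_one_le_left hR0.le (by linarith)) hlam₀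
  have hlam0 : 0 < lam := by linarith
  have hlamR : lam⁻¹ * (4 * R) < min rX rN := by
    rw [inv_mul_lt_iff₀ hlam0]
    have h1 : 6 / min rX rN * R ≤ lam := le_trans
      (mul_le_mul_of_nonneg_right (by linarith) hR0.le) hlam₀
    rw [div_mul_eq_mul_div, div_le_iff₀ hmin] at h1
    linarith
  have hCang : |Cang| * R ^ (-(1 / 2) + δm) ≤ 1 / 100 := by
    have h1 : R ^ (-(1 / 2) + δm) ≤ R ^ (-(1 / 4) : ℝ) :=
      Real.rpow_le_rpow_of_exponent_le hR (by linarith)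
    have h2 : 100 * (|Cang| + 1) ≤ R ^ (1 / 4 : ℝ) := by
      have h3 : ((100 * (|Cang| + 1)) ^ 4) ^ (1 / 4 : ℝ) ≤ R ^ (1 / 4 : ℝ) :=
        Real.rpow_le_rpow h100.le (by linarith) (by norm_num)
      refine le_trans (le_of_eq ?_) h3
      rw [← Real.rpow_natCast, ← Real.rpow_mul (by positivity)]
      norm_num
    have h4 : 0 < R ^ (1 / 4 : ℝ) := Real.rpow_pos_of_pos hR0 _
    refine (mul_le_mul_of_nonneg_left h1 (abs_nonneg _)).trans ?_
    rw [Real.rpow_neg hR0.le, ← div_eq_mul_inv, div_le_iff₀ h4]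
    linarith
  have hρ0 : 0 < ρ := (Real.rpow_pos_of_pos hR0 _).trans hρ
  have hcex100 : cex ≤ 1 / 100 := by
    refine hcex'.trans ?_
    rw [div_le_div_iff₀ (by positivity) (by norm_num)]
    linarith
  have hNδ : Real.sqrt Nex ≤ δm * Nex := by
    have h1 : 1 ≤ δm * Real.sqrt Nex := by
      have h2 : 1 / δ ≤ Real.sqrt Nex := by linarith
      rw [div_le_iff₀ hδ] at h2
      nlinarith [Real.sqrt_nonneg Nex]
    have h3 := mul_le_mul_of_nonneg_right h1 (Real.sqrt_nonneg Nex)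
    rwa [one_mul, mul_assoc, Real.mul_self_sqrt (Nat.cast_nonneg _)] at h3
  obtain ⟨V', hdim, hdim', hang, Ξ, hΞ⟩ := exists_transverse_of_tangentPackets (δ := δ) hφ hσ
    hcex.le hcex' hN3 Θ hR hδm0.le hδm' hCang hlam0 hlamR hρ hrτ hrτ' xbar τ₀ hV
  refine ⟨V', ⟨hdim, hdim'⟩, fun w hw w' hw' hw0 hw0' => ?_, ?_⟩
  · exact le_trans (by norm_num) (hang w hw w' hw' hw0 hw0')
  intro K g hg _ hconc x₀ hx₀
  have hl : 0 ≤ l2norm g := ENNReal.toReal_nonneg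
  refine ⟨C₆ K * R ^ (-Real.sqrt Nex), ?_, ?_⟩
  · intro N hN
    rw [abs_of_nonneg (mul_nonneg (hC₆0 K) (Real.rpow_nonneg hR0.le _))]
    refine mul_le_mul ?_ (Real.rpow_le_rpow_of_exponent_le hR (by linarith))
      (Real.rpow_nonneg hR0.le _) ?_
    · exact le_add_of_nonneg_left (by positivity)
    · exact add_nonneg (by positivity) (hC₆0 K)
  have hclean := setIntegral_opT_le (P := P) hφ ha hcex.le hcex100 hN3 hR hδm0.le hδm' hNδ
    (by linarith) hlam hlamR hB0 hρ0 hρR hΞ hg hconc hx₀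
  rw [← hv] at hclean
  set J := ∫ x in ball xbar (2 * R ^ (1 / 2 + δm)),
    ‖opT φ a lam g x‖ ^ 2 ∂(planeMeasure V' x₀) with hJ
  have hJ0 : 0 ≤ J := setIntegral_planeMeasure_nonneg _ _ _ _
  have hk : Module.finrank ℝ V' ≤ d + 1 := by
    simpa using Submodule.finrank_le V'
  -- The trivial bound: `|T^λ g|` is `O(‖g‖₂)` pointwise, on a piece of plane contained in a ball of
  -- radius `3R`.
  have hJle : J ≤ C₄ * R ^ ((d : ℝ) + 1) * l2norm g ^ 2 := by
    have hs : R ^ (1 / 2 + δm) ≤ R :=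
      (Real.rpow_le_rpow_of_exponent_le hR (by linarith)).trans_eq (Real.rpow_one R)
    have h1 := setIntegral_planeMeasure_le_of_norm_le V' (p := x₀) (q := xbar)
      (F := opT φ a lam g) (r := 2 * R ^ (1 / 2 + δm)) (s := 3 * R) (by positivity)
      (by rw [mem_ball] at hx₀; linarith) (norm_opT_le ha hg)
    refine h1.trans ?_
    have h2 : (v ^ (1 / 2 : ℝ)) ^ 2 = v := by
      rw [← Real.sqrt_eq_rpow, Real.sq_sqrt hv0]
    have h3 : (3 * R) ^ Module.finrank ℝ V' *
        volume.real (ball (0 : Euc (Module.finrank ℝ V')) 1) ≤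
        (3 * R) ^ (d + 1) * maxBallVolume (d + 1) :=
      mul_le_mul (pow_le_pow_right₀ (by linarith) hk) (le_maxBallVolume hk) measureReal_nonneg
        (by positivity)
    refine (mul_le_mul_of_nonneg_left h3 (sq_nonneg _)).trans ?_
    rw [← hv, mul_pow A, mul_pow _ (l2norm g), h2, mul_pow 3 R]
    have h4 : R ^ ((d : ℝ) + 1) = R ^ (d + 1) := by
      rw [← Real.rpow_natCast]
      push_cast
      rfl
    rw [h4]
    have h5 : 0 ≤ R ^ (d + 1) * l2norm g ^ 2 := by positivity
    rw [hC₄]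
    linarith
  -- Only the power `δ/(1+δ) ≤ δ_m` of the trivial bound is spent, so its `R^{d+1}` costs just
  -- `R^{(d+1)δ_m}`.
  have hloss := le_rpow_mul_rpow_of_le hJ0 hC₄1 hR hl (by positivity) hδ
    (by linarith : δ ≤ δm) hJle
  refine hclean.trans (add_le_add_left ?_ _)
  set q := (ρ / R) ^ ((Module.finrank ℝ V' : ℝ) / 2) with hq
  have hq0 : 0 ≤ q := Real.rpow_nonneg (by positivity) _
  set L := l2norm g ^ (2 * δ / (1 + δ)) with hL
  have hL0 : 0 ≤ L := Real.rpow_nonneg hl _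
  set J' := J ^ (1 / (1 + δ)) with hJ'
  have hJ'0 : 0 ≤ J' := Real.rpow_nonneg hJ0 _
  have hRR : R ^ (4 * ((d : ℝ) + 1) * δm) * R ^ (((d : ℝ) + 1) * δm) =
      R ^ (5 * ((d : ℝ) + 1) * δm) := by
    rw [← Real.rpow_add hR0]
    congr 1
    ring
  calc C₃ * R ^ (4 * ((d : ℝ) + 1) * δm) * q * J
      ≤ C₃ * R ^ (4 * ((d : ℝ) + 1) * δm) * q * (C₄ * R ^ (((d : ℝ) + 1) * δm) * L * J') :=
        mul_le_mul_of_nonneg_left hloss (by positivity)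
    _ = C₃ * C₄ * (R ^ (4 * ((d : ℝ) + 1) * δm) * R ^ (((d : ℝ) + 1) * δm)) * q * L * J' := by ring
    _ ≤ (C₃ * C₄ + C₆ K) * R ^ (5 * ((d : ℝ) + 1) * δm) * q * L * J' := by
        rw [hRR]
        gcongr
        exact le_add_of_nonneg_right (hC₆0 K)
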